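/- **Setting.** Let $d\ge 2$ and write $x=(\tilde x,x_d)\in[0,1]^{d-1}\times[0,1]$. A classification problem is a probability measure $\mathbb P_X$ on $[0,1]^d$ together with a measurable regression function $\eta:[0,1]^d\to[0,1]$, $\eta(x)=\mathbb P(Y=1\mid X=x)$, $Y\in\{0,1\}$. For $f:[0,1]^d\to\{0,1\}$ let $R(f)=\mathbb P(Y\ne f(X))$, $f^*=\mathbf 1\{\eta\ge 1/2\}$ and $\mathcal E(f)=R(f)-R(f^*)$. A learner may request labels at points $x$ of its choice; each request at $x$ is answered by a fresh independent label of law $\mathrm{Bernoulli}(\eta(x))$. For $a>0$ let $\lfloor a\rfloor_-$ be the largest integer strictly smaller than $a$. The class $\Sigma(\lambda,\alpha)$ consists of the functions $g:[0,1]^{d-1}\to[0,1]$ that are $\lfloor\alpha\rfloor_-$ times continuously differentiable and satisfy $|g(x)-\mathrm{TP}_{y,\lfloor\beta\rfloor_-}(x)|\le\lambda\|x-y\|_\infty^\beta$ for all $x,y\in[0,1]^{d-1}$ and $0<\beta\le\alpha$, where $\mathrm{TP}_{y,k}$ is the Taylor polynomial of $g$ of degree $k$ at $y$. **Assumptions.**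 For some $g^*\in\Sigma(\lambda,\alpha)$ with $\lambda\ge1$, $\alpha>0$, and constants $c>0$, $\kappa>1$, $\kappa'>0$, $C_M>0$, $\Delta_0>0$: 1. $\{x:\eta(x)\ge1/2\}=\{x\in[0,1]^d:x_d\ge g^*(\tilde x)\}$; 2. $|\eta(x)-\tfrac12|\ge c\,|x_d-g^*(\tilde x)|^{\kappa-1}$ for all $x\in[0,1]^d$; 3. $\int_{\{x:|x_d-g^*(\tilde x)|\le\Delta\}}|1-2\eta|\,d\mathbb P_X\le C_M\Delta^{\kappa'}$ for all $\Delta\in[0,\Delta_0]$. **Line search** with parameters $(\varepsilon,\delta)$ on the line above $\tilde x$. Let $K=\lceil\log_2\frac1{2\varepsilon}\rceil$ and $[L_1,R_1]=[0,1]$. For $k=1,\dots,K-1$ put $\delta_k=\delta/(K2^k)$ and let $U<M<V$ be the points that divide $[L_k,R_k]$ into four equal parts. In rounds $t=1,2,\dots$ request one fresh label at each of $(\tilde x,U),(\tilde x,M),(\tilde x,V)$; let $\hat\eta_t(\cdot)$ be the mean of the $t$ labels received at a point in this epoch and $r_t=2\sqrt{\log(t/\delta_k)/(2t)}$. The epoch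 ends at the first $t$ with $|\hat\eta_t(M)-\frac12|\ge r_t$, or with both $\hat\eta_t(V)-\frac12\ge r_t$ and $\frac12-\hat\eta_t(U)\ge r_t$. In the first case $[L_{k+1},R_{k+1}]=[L_k,M]$ if $\hat\eta_t(M)>\frac12$ and $[M,R_k]$ otherwise; if only the second condition holds, $[L_{k+1},R_{k+1}]=[U,V]$. The threshold estimate is the midpoint of the last interval ($\frac12$ if there is no epoch). **Subroutine** with parameters $(n,\delta,\alpha,\lambda)$. Put $m=\lfloor\alpha\rfloor_-$. At depth $l=1,2,\dots$ let $M_l=\max(1,m)2^l$, $\varepsilon_l=\lambda2^{-l\alpha}$, $\delta_l=\delta/(\max(1,m)2^{l(d+1)})$, and run the line search with parameters $(\varepsilon_l,\delta_l)$ above each grid point $\tilde a/M_l$, $\tilde a\in\{0,\dots,M_l\}^{d-1}$, giving threshold estimates $T_{l,\tilde a}$. Stop when the budget of $n$ labels is spent, and let $l^*$ be the last depth all of whose line searches were completed. If $l^*=0$, output $S^0=S^1=\emptyset$. Otherwise let $\hat P$ be the following function: on each of the cells of side $2^{-l^*}$ that tile $[0,1]^{d-1}$, it is the tensor-product Lagrange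 interpolation, of degree $m$ in each variable, of the values $T_{l^*,\tilde a}$ at the grid points $\tilde a/M_{l^*}$ of the cell (for $\alpha\le1$: the constant $T_{l^*,\tilde a}$ with $\tilde a/M_{l^*}$ the lower corner of the cell). With $b=\lambda\lceil\alpha\rceil^{d\lceil\alpha\rceil}M_{l^*}^{-\alpha}$, output $S^0=\{x\in[0,1]^d:x_d\le\hat P(\tilde x)-4b\}$ and $S^1=\{x\in[0,1]^d:x_d\ge\hat P(\tilde x)+4b\}$. **Adaptive procedure** with parameters $(n,\delta,\lambda)$. Let $s_0^0=s_0^1=\emptyset$. For $i=1,\dots,\lfloor\log n\rfloor^2$ run the subroutine with fresh labels and parameters $\big(n/\lfloor\log n\rfloor^2,\ \delta/\lfloor\log n\rfloor^2,\ i/\lfloor\log n\rfloor,\ \lambda\big)$ to get $S_i^0,S_i^1$, and set $s_i^y=s_{i-1}^y\cup(S_i^y\setminus s_{i-1}^{1-y})$ for $y\in\{0,1\}$. Let $S^1$ be the final set $s_i^1$, let $\hat g_n(\tilde x)=\inf\{x_d:(\tilde x,x_d)\in S^1\}$ (the infimum in $[0,1]$, so $\inf\emptyset=1$), and let $\hat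 f_n(x)=\mathbf 1\{x_d\ge\hat g_n(\tilde x)\}$. **Claim.** Fix $d,c,\alpha,\kappa,\Delta_0$. There is a function $N=N(\lambda,\delta)$ such that for all $\kappa',C_M>0$ there is a constant $C>0$ for which the following holds for all $\lambda\ge1$, $\delta>0$ and $n\ge N(\lambda,\delta)$ with $\alpha\in[\lfloor\log n\rfloor^{-1},\lfloor\log n\rfloor]$, and all problems satisfying assumptions 1–3 with these constants. With probability at least $1-2\delta$, $$\mathcal E(\hat f_n)\le C\,\lambda^{\frac{\kappa'(d-1)}{2\alpha(\kappa-1)+d-1}}\Big(\frac{\log^3(n/\delta)}{n}\Big)^{\frac{\alpha\kappa'}{2\alpha(\kappa-1)+d-1}},$$ and, on the same event, the classifier $\mathbf 1\{x\in S^1\}$ (which can differ from $\hat f_n$ only where $x_d=\hat g_n(\tilde x)$) satisfies the same bound. In particular $C$ does not depend on $\lambda,n,\delta$. -/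

import Mathlib

open MeasureTheory ProbabilityTheory

noncomputable section

namespace ActiveBoundary

/-! ### Feature space and classification problems -/

/-- Points `x = (x̃, x_d)` of `ℝ^{d-1} × ℝ`; the first factor carries the sup norm. -/
abbrev Point (d : ℕ) : Type := (Fin (d - 1) → ℝ) × ℝ

/-- The cube `[0,1]^{d-1}`. -/
def baseCube (d : ℕ) : Set (Fin (d - 1) → ℝ) := Set.Icc 0 1

/-- The cube `[0,1]^d = [0,1]^{d-1} × [0,1]`. -/
def cube (d : ℕ) : Set (Point d) := baseCube d ×ˢ Set.Icc (0 : ℝ) 1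

/-- A binary classification problem on `[0,1]^d`, given by the marginal law `P_X` of the feature and
the regression function `η(x) = P(Y = 1 | X = x)`, which is specified at every point of the cube
(its values outside the cube play no role). -/
structure Problem (d : ℕ) where
  PX : Measure (Point d)
  isProb : IsProbabilityMeasure PX
  supported : PX (cube d)ᶜ = 0
  eta : Point d → ℝ
  eta_measurable : Measurable eta
  eta_mem : ∀ x ∈ cube d, eta x ∈ Set.Icc (0 : ℝ) 1

/-- The joint law of `(X, Y)`; the label `1` is `true`, the label `0` is `false`. -/
def Problem.joint {d : ℕ} (P : Problem d) : Measure (Point d × Bool) :=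
  (P.PX.withDensity fun x => ENNReal.ofReal (P.eta x)).map (fun x => (x, true)) +
    (P.PX.withDensity fun x => ENNReal.ofReal (1 - P.eta x)).map (fun x => (x, false))

/-- The `0`-`1` risk `R(f) = P(Y ≠ f(X))`. -/
def Problem.risk {d : ℕ} (P : Problem d) (f : Point d → Bool) : ℝ :=
  (P.joint {p | p.2 ≠ f p.1}).toReal

open Classical in
/-- The Bayes classifier `1{η(x) ≥ 1/2}`. -/
def Problem.bayes {d : ℕ} (P : Problem d) (x : Point d) : Bool := decide (1 / 2 ≤ P.eta x)

/-- The excess risk `R(f) - R(f*)`. -/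
def Problem.excessRisk {d : ℕ} (P : Problem d) (f : Point d → Bool) : ℝ :=
  P.risk f - P.risk P.bayes

/-! ### Assumptions on the problem -/

/-- The largest integer strictly smaller than `α` (for `α > 0`). -/
def strictFloor (α : ℝ) : ℕ := ⌈α⌉₊ - 1

/-- The Taylor polynomial of degree `k` of `g` at `y`, evaluated at `x`; derivatives are taken
within the cube. -/
def taylorPoly {d : ℕ} (g : (Fin (d - 1) → ℝ) → ℝ) (k : ℕ) (y x : Fin (d - 1) → ℝ) : ℝ :=
  ∑ j ∈ Finset.range (k + 1),
    ((j.factorial : ℝ))⁻¹ * iteratedFDerivWithin ℝ j g (baseCube d) y (fun _ => x - y)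

/-- The Hölder class `Σ(λ, α)` of functions `[0,1]^{d-1} → [0,1]`. -/
structure HolderClass {d : ℕ} (lam α : ℝ) (g : (Fin (d - 1) → ℝ) → ℝ) : Prop where
  mapsTo : Set.MapsTo g (baseCube d) (Set.Icc 0 1)
  contDiffOn : ContDiffOn ℝ (strictFloor α : ℕ) g (baseCube d)
  taylor_bound : ∀ β : ℝ, 0 < β → β ≤ α → ∀ x ∈ baseCube d, ∀ y ∈ baseCube d,
    |g x - taylorPoly g (strictFloor β) y x| ≤ lam * ‖x - y‖ ^ β

/-- The epigraph of `g` in the cube. -/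
def epi {d : ℕ} (g : (Fin (d - 1) → ℝ) → ℝ) : Set (Point d) := {x ∈ cube d | g x.1 ≤ x.2}

/-- Smoothness of the decision boundary: `{x : η(x) ≥ 1/2}` is the epigraph of a function `g` of
the class `Σ(λ, α)`. -/
def SmoothBoundary {d : ℕ} (P : Problem d) (lam α : ℝ) (g : (Fin (d - 1) → ℝ) → ℝ) : Prop :=
  HolderClass lam α g ∧ {x ∈ cube d | 1 / 2 ≤ P.eta x} = epi g

/-- The geometric noise condition, relative to the boundary function `g`. -/
def GeometricNoise {d : ℕ} (P : Problem d) (c κ : ℝ) (g : (Fin (d - 1) → ℝ) → ℝ) : Prop :=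
  ∀ x ∈ cube d, c * |x.2 - g x.1| ^ (κ - 1) ≤ |P.eta x - 1 / 2|

/-- The risk carried by the points within distance `Δ` of the boundary is at most `C Δ^{κ'}`, for
all `Δ ∈ [0, Δ₀]`. -/
def BoundaryMass {d : ℕ} (P : Problem d) (CM Δ₀ κ' : ℝ) (g : (Fin (d - 1) → ℝ) → ℝ) : Prop :=
  ∀ Δ ∈ Set.Icc (0 : ℝ) Δ₀,
    ∫ x in {x ∈ cube d | |x.2 - g x.1| ≤ Δ}, |1 - 2 * P.eta x| ∂P.PX ≤ CM * Δ ^ κ'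

/-! ### Label requests -/

/-- A label request. The algorithm never makes two requests with the same address: `run` is the
call of the subroutine, `depth` the depth of the grid, `epoch` the epoch of the line search that
makes the request, `pt` the point at which a label is requested, and `rep` counts the requests made
at this point in this epoch. -/
structure Request (d : ℕ) where
  run : ℕ
  depth : ℕ
  epoch : ℕ
  rep : ℕ
  pt : Point d

/-- `Y r` is the answer to the request `r`: the answers to distinct requests are independent, and
a request at the point `x` is answered by a label with law `P_{Y | X = x}`. -/
structure IsLabelOracle {d : ℕ} (P : Problem d) {Ω : Type*} [MeasurableSpace Ω] (μ : Measure Ω)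
    (Y : Request d → Ω → Bool) : Prop where
  measurable : ∀ r, Measurable (Y r)
  indep : iIndepFun Y μ
  law : ∀ r, r.pt ∈ cube d → μ {ω | Y r ω = true} = ENNReal.ofReal (P.eta r.pt)

/-! ### Line search

`lab k z s` is the answer to the `s`-th request (`s = 1, 2, …`) made in epoch `k` at height `z` on
the line that is being searched. -/

/-- The mean of the first `t` labels received at height `z` in epoch `k`. -/
def empMean (lab : ℕ → ℝ → ℕ → Bool) (k : ℕ) (z : ℝ) (t : ℕ) : ℝ :=
  (∑ s ∈ Finset.Icc 1 t, if lab k z s then (1 : ℝ) else 0) / t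

/-- The confidence term `2 √(log(t/δ) / (2t))`. -/
def confRadius (δ : ℝ) (t : ℕ) : ℝ := 2 * Real.sqrt (Real.log (t / δ) / (2 * t))

/-- After `t` rounds the label of the midpoint `M` of `[L, R]` is known with confidence. -/
def midDecided (lab : ℕ → ℝ → ℕ → Bool) (δk : ℝ) (k : ℕ) (L R : ℝ) (t : ℕ) : Prop :=
  confRadius δk t ≤ |empMean lab k ((L + R) / 2) t - 1 / 2|

/-- After `t` rounds the labels of the quartiles `U` and `V` of `[L, R]` are known with confidence
to be `0` and `1`. -/
def quartilesDecided (lab : ℕ → ℝ → ℕ → Bool) (δk : ℝ) (k : ℕ) (L R : ℝ) (t : ℕ) : Prop :=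
  confRadius δk t ≤ empMean lab k ((L + R) / 2 + (R - L) / 4) t - 1 / 2 ∧
    confRadius δk t ≤ 1 / 2 - empMean lab k (L + (R - L) / 4) t

/-- The rounds at which epoch `k` on `[L, R]` may end; it ends at the first of them. -/
def endRounds (lab : ℕ → ℝ → ℕ → Bool) (δk : ℝ) (k : ℕ) (L R : ℝ) : Set ℕ :=
  {t | 1 ≤ t ∧ (midDecided lab δk k L R t ∨ quartilesDecided lab δk k L R t)}

/-- The number of labels that epoch `k` requests (three per round; `⊤` if it never ends). -/
def epochCost (lab : ℕ → ℝ → ℕ → Bool) (δk : ℝ) (k : ℕ) (L R : ℝ) : ℕ∞ :=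
  3 * ⨅ t ∈ endRounds lab δk k L R, (t : ℕ∞)

open Classical in
/-- The interval that epoch `k`, started on `[L, R]`, hands over to the next epoch. -/
def epochNext (lab : ℕ → ℝ → ℕ → Bool) (δk : ℝ) (k : ℕ) (L R : ℝ) : ℝ × ℝ :=
  let t := sInf (endRounds lab δk k L R)
  if midDecided lab δk k L R t then
    if 1 / 2 < empMean lab k ((L + R) / 2) t then (L, (L + R) / 2) else ((L + R) / 2, R)
  else (L + (R - L) / 4, (L + R) / 2 + (R - L) / 4)

/-- `K = ⌈log₂(1/(2ε))⌉` (read as `0` when it is negative). -/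
def searchDepth (ε : ℝ) : ℕ := ⌈Real.logb 2 (1 / (2 * ε))⌉₊

/-- The interval `[L_{k+1}, R_{k+1}]` reached after the epochs `1, …, k`, and the number of labels
requested in them. -/
def searchState (lab : ℕ → ℝ → ℕ → Bool) (ε δ : ℝ) : ℕ → (ℝ × ℝ) × ℕ∞
  | 0 => ((0, 1), 0)
  | k + 1 =>
    let s := searchState lab ε δ k
    let δk := δ / (searchDepth ε * 2 ^ (k + 1))
    (epochNext lab δk (k + 1) s.1.1 s.1.2, s.2 + epochCost lab δk (k + 1) s.1.1 s.1.2)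

/-- The threshold estimate of the line search: the midpoint of the interval reached after the
epochs `1, …, K - 1`. -/
def searchThreshold (lab : ℕ → ℝ → ℕ → Bool) (ε δ : ℝ) : ℝ :=
  let s := searchState lab ε δ (searchDepth ε - 1)
  (s.1.1 + s.1.2) / 2

/-- The number of labels that the line search requests. -/
def searchCost (lab : ℕ → ℝ → ℕ → Bool) (ε δ : ℝ) : ℕ∞ :=
  (searchState lab ε δ (searchDepth ε - 1)).2

/-! ### The procedure in dimension `d` with known smoothness

`lab` answers the requests of one call, in the order depth, epoch, point, repetition. -/

/-- `max(1, ⌊α⌋)`. -/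
def cellDegree (α : ℝ) : ℕ := max 1 (strictFloor α)

/-- `M_l = max(1, ⌊α⌋) 2^l`. -/
def gridSize (α : ℝ) (l : ℕ) : ℕ := cellDegree α * 2 ^ l

/-- The precision `ε_l` of the line searches at depth `l`. -/
def depthPrec (lam α : ℝ) (l : ℕ) : ℝ := lam * (2 : ℝ) ^ (-((l : ℝ) * α))

/-- The confidence parameter `δ_l` of the line searches at depth `l`. -/
def depthConf (d : ℕ) (δ α : ℝ) (l : ℕ) : ℝ := δ / (cellDegree α * 2 ^ (l * (d + 1)))

/-- The labels received on the line above the grid point `M_l⁻¹ ã`. -/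
def lineLabels {d : ℕ} (lab : ℕ → ℕ → Point d → ℕ → Bool) (α : ℝ) (l : ℕ)
    (a : Fin (d - 1) → ℕ) : ℕ → ℝ → ℕ → Bool :=
  fun k z s => lab l k (fun i => (a i : ℝ) / gridSize α l, z) s

/-- The threshold estimate `T_{l, ã}`. -/
def threshold {d : ℕ} (lab : ℕ → ℕ → Point d → ℕ → Bool) (δ lam α : ℝ) (l : ℕ)
    (a : Fin (d - 1) → ℕ) : ℝ :=
  searchThreshold (lineLabels lab α l a) (depthPrec lam α l) (depthConf d δ α l)

/-- The number `N_l` of labels requested by the line searches above all the grid points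
`ã ∈ {0, …, M_l}^{d-1}`. -/
def depthCost {d : ℕ} (lab : ℕ → ℕ → Point d → ℕ → Bool) (δ lam α : ℝ) (l : ℕ) : ℕ∞ :=
  ∑ a ∈ Fintype.piFinset fun _ : Fin (d - 1) => Finset.range (gridSize α l + 1),
    searchCost (lineLabels lab α l a) (depthPrec lam α l) (depthConf d δ α l)

/-- The last depth `l*` all of whose line searches end within the budget of `n` labels. The labels
that are requested at depth `l* + 1` before the budget is spent are not used. -/
def lastDepth {d : ℕ} (lab : ℕ → ℕ → Point d → ℕ → Bool) (n : ℕ) (δ lam α : ℝ) : ℕ :=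
  sSup {l : ℕ | ∑ j ∈ Finset.Icc 1 l, depthCost lab δ lam α j ≤ (n : ℕ∞)}

/-- The index `q̃` of a cell of side `2^{-l}` that contains `x̃`. -/
def cellIndex {d : ℕ} (l : ℕ) (x : Fin (d - 1) → ℝ) (i : Fin (d - 1)) : ℕ :=
  min ⌊x i * 2 ^ l⌋₊ (2 ^ l - 1)

/-- The boundary estimate `P̂` at depth `l`: on each cell, the tensor-product Lagrange interpolation
of degree `⌊α⌋` of the threshold estimates. For `α ≤ 1` the degree is `0`, and `P̂` is on each cell
the threshold estimate at its lower corner. -/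
def interp {d : ℕ} (T : (Fin (d - 1) → ℕ) → ℝ) (α : ℝ) (l : ℕ) (x : Fin (d - 1) → ℝ) : ℝ :=
  let node : Fin (d - 1) → ℕ → ℕ := fun i j => cellDegree α * cellIndex l x i + j
  ∑ j ∈ Fintype.piFinset fun _ : Fin (d - 1) => Finset.range (strictFloor α + 1),
    T (fun i => node i (j i)) *
      ∏ i, ∏ j' ∈ (Finset.range (strictFloor α + 1)).erase (j i),
        (x i - (node i j' : ℝ) / gridSize α l) /
          ((node i (j i) : ℝ) / gridSize α l - (node i j' : ℝ) / gridSize α l)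

/-- The bias term `b_l = λ ⌈α⌉^{d⌈α⌉} M_l^{-α}`. -/
def biasTerm (d : ℕ) (lam α : ℝ) (l : ℕ) : ℝ :=
  lam * (⌈α⌉₊ : ℝ) ^ (d * ⌈α⌉₊) * (gridSize α l : ℝ) ^ (-α)

/-- The sets `(S⁰, S¹)` that the procedure labels `0` and `1`. If not even the first depth could be
completed, then no point is labeled. -/
def subroutine {d : ℕ} (lab : ℕ → ℕ → Point d → ℕ → Bool) (n : ℕ) (δ lam α : ℝ) :
    Set (Point d) × Set (Point d) :=
  let l := lastDepth lab n δ lam α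
  let Phat := interp (threshold lab δ lam α l) α l
  ({x ∈ cube d | 1 ≤ l ∧ x.2 ≤ Phat x.1 - 4 * biasTerm d lam α l},
    {x ∈ cube d | 1 ≤ l ∧ Phat x.1 + 4 * biasTerm d lam α l ≤ x.2})

/-! ### The adaptive procedure -/

/-- `⌊log n⌋`. -/
def logFloor (n : ℕ) : ℕ := ⌊Real.log n⌋₊

/-- The pair `(S⁰_i, S¹_i)` returned by the `i`-th call of the subroutine, with smoothness
`i / ⌊log n⌋`, confidence `δ / ⌊log n⌋²` and budget `n / ⌊log n⌋²` (rounded down, as a number of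
labels is an integer). -/
def call {d : ℕ} (lab : Request d → Bool) (n : ℕ) (δ lam : ℝ) (i : ℕ) :
    Set (Point d) × Set (Point d) :=
  subroutine (fun l k x s => lab ⟨i, l, k, s, x⟩) (n / logFloor n ^ 2) (δ / (logFloor n : ℝ) ^ 2)
    lam ((i : ℝ) / logFloor n)

/-- The pair `(s⁰_i, s¹_i)` of sets labeled after the first `i` calls. -/
def aggregate {d : ℕ} (lab : Request d → Bool) (n : ℕ) (δ lam : ℝ) :
    ℕ → Set (Point d) × Set (Point d)
  | 0 => (∅, ∅)
  | i + 1 =>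
    let s := aggregate lab n δ lam i
    let S := call lab n δ lam (i + 1)
    (s.1 ∪ (S.1 \ s.2), s.2 ∪ (S.2 \ s.1))

/-- The set `S¹` finally labeled `1`. -/
def labeledOne {d : ℕ} (lab : Request d → Bool) (n : ℕ) (δ lam : ℝ) : Set (Point d) :=
  (aggregate lab n δ lam (logFloor n ^ 2)).2

/-- The estimated boundary `ĝ_n(x̃) = inf {x_d : (x̃, x_d) ∈ S¹}`, the infimum being taken in
`[0,1]` (so it is `1` if no point above `x̃` is in `S¹`). -/
def boundaryEstimate {d : ℕ} (lab : Request d → Bool) (n : ℕ) (δ lam : ℝ)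
    (x : Fin (d - 1) → ℝ) : ℝ :=
  sInf (insert 1 {z : ℝ | (x, z) ∈ labeledOne lab n δ lam})

open Classical in
/-- The plug-in classifier `1{x_d ≥ ĝ_n(x̃)}`. -/
def classifier {d : ℕ} (lab : Request d → Bool) (n : ℕ) (δ lam : ℝ) (x : Point d) : Bool :=
  decide (boundaryEstimate lab n δ lam x.1 ≤ x.2)

open Classical in
/-- The classifier `1{x ∈ S¹}`. It can differ from `1{x_d ≥ ĝ_n(x̃)}` only where `x_d = ĝ_n(x̃)`,
namely where the infimum that defines `ĝ_n` is not attained. -/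
def setClassifier {d : ℕ} (lab : Request d → Bool) (n : ℕ) (δ lam : ℝ) (x : Point d) : Bool :=
  decide (x ∈ labeledOne lab n δ lam)

end ActiveBoundary

end

noncomputable section

namespace ActiveBoundary

/-! ### Tensor-product Lagrange interpolation -/

/-! Randomness enters only through the event `AllGood`: in every call with smoothness parameter at
most α, all empirical means at all dyadic heights that a line search could visit stay within their
confidence radius. These points are fixed in advance, so the adaptivity of the search is harmless.
Hoeffding bounds one failure after t labels by 2(δ/t)^4, and union bounds over rounds, heights,
epochs, lines, depths and calls give total failure probability at most δ (`measure_not_allGood_le`).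

On this event a completed line search never loses the threshold γ (`mem_searchState`). In an
interval of length w, either the midpoint or both quartiles are at distance at least w/8 from γ, so
the noise condition ends the epoch after about log · w^(-2(κ-1)) rounds (`mem_endRounds`). Since κ >
1 these costs form a geometric sum, and precision ε costs about log · ε^(-2(κ-1)) labels
(`searchCost_le_of_log_le`).

Tensor-product interpolation reproduces the Taylor polynomial of g centred at the evaluation point,
whose value there is g itself. Hence the interpolation error is a Lebesgue constant times the sum of
the search error and the Taylor remainder, both of order λ2^(-lα) (`abs_interp_sub_le`). It is at
most 3b, so the margin 4b makes every label of the call correct and leaves only points within 7b of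
the boundary unlabeled. Depth l has about 2^(l(d-1)) lines of cost (λ2^(-lα))^(-2(κ-1)). With D =
2α(κ-1)+d-1, the budget n/log²n therefore reaches a depth with 2^(lD) ≈ λ^(2(κ-1)) n/log³(n/δ), and
λ2^(-lα) becomes λ^((d-1)/D) (log³(n/δ)/n)^(α/D) (`biasTerm_lastDepth_le`).

The classes Σ(λ,α) decrease in α, so every call with parameter at most α labels correctly. The last
of them, with parameter α' within 1/⌊log n⌋ of α, labels everything outside the band; later calls
are uncontrolled but cannot overwrite these labels (`coversBeyond_aggregate`). Passing from α' to α
costs a constant factor for large n (`lam_rpow_le`, `rate_rpow_le`). Both classifiers thus agree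
with the Bayes classifier outside the band, and the excess risk is at most the risk carried by the
band (`Problem.excessRisk_le`), which assumption 3 bounds. -/

theorem sum_pow_mul_lagrange {m : ℕ} {v : ℕ → ℝ} (hv : Set.InjOn v (Finset.range (m + 1)))
    (x : ℝ) {k : ℕ} (hk : k ≤ m) :
    ∑ j ∈ Finset.range (m + 1), (v j - x) ^ k *
      ∏ j' ∈ (Finset.range (m + 1)).erase j, (x - v j') / (v j - v j') = 0 ^ k := by
  classical
  -- (X - x)^k has degree at most m, so it equals its interpolant on the m + 1 nodes; the claim is
  -- this identity evaluated at x.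
  have h := Lagrange.eq_interpolate_of_eval_eq (s := Finset.range (m + 1)) (v := v)
    (r := fun j => (v j - x) ^ k) (f := (Polynomial.X - Polynomial.C x) ^ k) hv
    (by
      rw [Polynomial.degree_pow, Polynomial.degree_X_sub_C]
      simp only [nsmul_eq_mul, mul_one, Finset.card_range]
      exact_mod_cast Nat.lt_succ_of_le hk)
    (by intro i _; simp)
  have h2 := congrArg (Polynomial.eval x) h
  simp only [Polynomial.eval_pow, Polynomial.eval_sub, Polynomial.eval_X, Polynomial.eval_C,
    sub_self, Lagrange.interpolate_apply, Polynomial.eval_finsetSum, Polynomial.eval_mul,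
    Lagrange.basis, Polynomial.eval_prod, Lagrange.basisDivisor] at h2
  rw [h2]
  refine Finset.sum_congr rfl fun j _ => ?_
  congr 1
  refine Finset.prod_congr rfl fun j' _ => ?_
  rw [div_eq_inv_mul]

/-- Expansion in the standard basis turns diagonal values into a polynomial in the coordinates.
Symmetry of `A` plays no role. -/
theorem multilinear_expand {p j : ℕ}
    (A : ContinuousMultilinearMap ℝ (fun _ : Fin j => Fin p → ℝ) ℝ) (u : Fin p → ℝ) :
    A (fun _ => u) =
      ∑ s : Fin j → Fin p, (∏ i, u (s i)) * A (fun i => Pi.single (s i) (1 : ℝ)) := by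
  have hu : u = ∑ c : Fin p, u c • (Pi.single c (1 : ℝ) : Fin p → ℝ) := by
    ext c
    simp [Finset.sum_apply, Pi.single_apply]
  conv_lhs => rw [hu]
  have := A.toMultilinearMap.map_sum (fun (_ : Fin j) (c : Fin p) =>
    u c • (Pi.single c (1 : ℝ) : Fin p → ℝ))
  simp only [ContinuousMultilinearMap.coe_coe] at this
  rw [this]
  refine Finset.sum_congr rfl fun s _ => ?_
  have := A.toMultilinearMap.map_smul_univ (fun i => u (s i))
    (fun i => (Pi.single (s i) (1 : ℝ) : Fin p → ℝ))
  simpa using this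

/-- The weight of the node `j` in the tensor-product Lagrange interpolation at `x` with nodes `v`. -/
def tensorWeight {p : ℕ} (m : ℕ) (v : Fin p → ℕ → ℝ) (x : Fin p → ℝ) (j : Fin p → ℕ) : ℝ :=
  ∏ i, ∏ j' ∈ (Finset.range (m + 1)).erase (j i), (x i - v i j') / (v i (j i) - v i j')

theorem sum_tensorWeight_prod_pow {p m : ℕ} {v : Fin p → ℕ → ℝ}
    (hv : ∀ i, Set.InjOn (v i) (Finset.range (m + 1))) (x : Fin p → ℝ) (k : Fin p → ℕ)
    (hk : ∀ i, k i ≤ m) :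
    ∑ j ∈ Fintype.piFinset fun _ : Fin p => Finset.range (m + 1),
      (∏ i, (v i (j i) - x i) ^ k i) * tensorWeight m v x j = ∏ i, (0 : ℝ) ^ k i := by
  simp_rw [tensorWeight, ← Finset.prod_mul_distrib]
  rw [← Finset.prod_univ_sum (fun _ : Fin p => Finset.range (m + 1)) (fun i n =>
    (v i n - x i) ^ k i * ∏ j' ∈ (Finset.range (m + 1)).erase n, (x i - v i j') / (v i n - v i j'))]
  exact Finset.prod_congr rfl fun i _ => sum_pow_mul_lagrange (hv i) (x i) (hk i)

/-- A monomial of total degree n ≤ m has degree at most m in each single coordinate, which is what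
tensor-product interpolation reproduces. -/
theorem sum_tensorWeight_multilinear {p m n : ℕ} (hn : n ≤ m) {v : Fin p → ℕ → ℝ}
    (hv : ∀ i, Set.InjOn (v i) (Finset.range (m + 1))) (x : Fin p → ℝ)
    (A : ContinuousMultilinearMap ℝ (fun _ : Fin n => Fin p → ℝ) ℝ) :
    ∑ j ∈ Fintype.piFinset fun _ : Fin p => Finset.range (m + 1),
      A (fun _ => (fun i => v i (j i)) - x) * tensorWeight m v x j = A (fun _ => 0) := by
  change _ = A (fun _ => (fun _ => (0 : ℝ)))
  rw [multilinear_expand A (fun _ => 0 : Fin p → ℝ)]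
  simp_rw [fun u : Fin p → ℝ => multilinear_expand A u, Finset.sum_mul]
  rw [Finset.sum_comm]
  refine Finset.sum_congr rfl fun s _ => ?_
  -- Group the factors by coordinate: the exponent of `u c` is the number of slots that `s` sends to
  -- `c`.
  have key : ∀ u : Fin p → ℝ, ∏ i, u (s i) = ∏ c, u c ^ (Finset.univ.filter (s · = c)).card := by
    intro u
    rw [← Finset.prod_fiberwise' Finset.univ s u]
    simp
  have k0 : ∏ _i : Fin n, (0 : ℝ) = ∏ c, (0 : ℝ) ^ (Finset.univ.filter (s · = c)).card :=
    key fun _ => 0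
  rw [k0]
  simp_rw [key]
  rw [← sum_tensorWeight_prod_pow hv x (fun c => (Finset.univ.filter (s · = c)).card)
    (fun c => (Finset.card_le_univ _).trans (by simpa using hn)), Finset.sum_mul]
  refine Finset.sum_congr rfl fun j _ => ?_
  simp only [Pi.sub_apply]
  ring

/-- Centring the polynomial at the evaluation point kills every term but the constant one. Each x
thus uses its own Taylor polynomial, and no expansion about a common point of the cell is needed. -/
theorem sum_taylorPoly_tensorWeight {d m : ℕ} {v : Fin (d - 1) → ℕ → ℝ}
    (hv : ∀ i, Set.InjOn (v i) (Finset.range (m + 1))) (g : (Fin (d - 1) → ℝ) → ℝ)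
    (x : Fin (d - 1) → ℝ) :
    ∑ j ∈ Fintype.piFinset fun _ : Fin (d - 1) => Finset.range (m + 1),
      taylorPoly g m x (fun i => v i (j i)) * tensorWeight m v x j = g x := by
  simp_rw [taylorPoly, Finset.sum_mul]
  rw [Finset.sum_comm]
  have : ∀ n ∈ Finset.range (m + 1),
      ∑ j ∈ Fintype.piFinset fun _ : Fin (d - 1) => Finset.range (m + 1),
        ((n.factorial : ℝ))⁻¹ * iteratedFDerivWithin ℝ n g (baseCube d) x
          (fun _ => (fun i => v i (j i)) - x) * tensorWeight m v x j
        = ((n.factorial : ℝ))⁻¹ * iteratedFDerivWithin ℝ n g (baseCube d) x (fun _ => 0) := by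
    intro n hn
    rw [← sum_tensorWeight_multilinear (Nat.lt_succ_iff.mp (Finset.mem_range.mp hn)) hv x,
      Finset.mul_sum]
    exact Finset.sum_congr rfl fun j _ => by ring
  rw [Finset.sum_congr rfl this, Finset.sum_range_succ']
  rw [Finset.sum_eq_zero]
  · simp
  · intro n _
    rw [(iteratedFDerivWithin ℝ (n + 1) g (baseCube d) x).map_coord_zero 0 rfl, mul_zero]

/-! ### The grid -/

theorem cellDegree_pos (α : ℝ) : 0 < cellDegree α := lt_of_lt_of_le one_pos (le_max_left _ _)

theorem gridSize_pos (α : ℝ) (l : ℕ) : 0 < gridSize α l :=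
  Nat.mul_pos (cellDegree_pos α) (by positivity)

/-- The `j`-th grid coordinate of the cell with index `q`. -/
def gridNode (α : ℝ) (l q j : ℕ) : ℝ := ((cellDegree α * q + j : ℕ) : ℝ) / gridSize α l

theorem gridNode_eq (α : ℝ) (l q j : ℕ) :
    gridNode α l q j = (q : ℝ) / 2 ^ l + (j : ℝ) / gridSize α l := by
  have h : (cellDegree α : ℝ) ≠ 0 := by exact_mod_cast (cellDegree_pos α).ne'
  simp only [gridNode, gridSize]
  push_cast
  field_simp

theorem gridNode_injective (α : ℝ) (l q : ℕ) : Function.Injective (gridNode α l q) := by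
  intro a b h
  have hM : (gridSize α l : ℝ) ≠ 0 := by exact_mod_cast (gridSize_pos α l).ne'
  simp only [gridNode] at h
  rw [div_left_inj' hM] at h
  have := Nat.cast_injective h
  omega

theorem cellIndex_bounds {d : ℕ} (l : ℕ) {x : Fin (d - 1) → ℝ} (hx : x ∈ baseCube d)
    (i : Fin (d - 1)) :
    (cellIndex l x i : ℝ) / 2 ^ l ≤ x i ∧ x i ≤ ((cellIndex l x i : ℝ) + 1) / 2 ^ l ∧
      cellIndex l x i + 1 ≤ 2 ^ l := by
  have h0 : 0 ≤ x i := hx.1 i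
  have h1 : x i ≤ 1 := hx.2 i
  have hp : (0 : ℝ) < 2 ^ l := by positivity
  have hp' : 1 ≤ 2 ^ l := Nat.one_le_two_pow
  have hfl : (⌊x i * 2 ^ l⌋₊ : ℝ) ≤ x i * 2 ^ l := Nat.floor_le (by positivity)
  have hfl2 : x i * 2 ^ l < ⌊x i * 2 ^ l⌋₊ + 1 := Nat.lt_floor_add_one _
  refine ⟨?_, ?_, ?_⟩
  · rw [div_le_iff₀ hp]
    refine le_trans ?_ hfl
    simp only [cellIndex]
    exact_mod_cast min_le_left _ _
  · rw [le_div_iff₀ hp]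
    rcases min_choice ⌊x i * 2 ^ l⌋₊ (2 ^ l - 1) with h | h
    · rw [cellIndex, h]; exact hfl2.le
    -- The truncated index is that of the last cell, whose right end is 1.
    · rw [cellIndex, h]
      have : (((2 ^ l - 1 : ℕ) : ℝ)) + 1 = 2 ^ l := by
        push_cast [Nat.cast_sub hp']; ring
      rw [this]
      nlinarith
  · have := min_le_right ⌊x i * 2 ^ l⌋₊ (2 ^ l - 1)
    simp only [cellIndex]; omega

theorem abs_sub_gridNode_le {d : ℕ} (α : ℝ) (l : ℕ) {x : Fin (d - 1) → ℝ} (hx : x ∈ baseCube d)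
    (i : Fin (d - 1)) {j : ℕ} (hj : j ≤ cellDegree α) :
    |x i - gridNode α l (cellIndex l x i) j| ≤ ((2 : ℝ) ^ l)⁻¹ := by
  obtain ⟨h1, h2, -⟩ := cellIndex_bounds l hx i
  have hj' : (j : ℝ) / gridSize α l ≤ ((2 : ℝ) ^ l)⁻¹ := by
    have h : (0 : ℝ) < cellDegree α := by exact_mod_cast cellDegree_pos α
    rw [gridSize]; push_cast
    rw [div_le_iff₀ (by positivity)]
    field_simp
    exact_mod_cast hj
  have hj0 : 0 ≤ (j : ℝ) / gridSize α l := by positivity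
  rw [gridNode_eq, abs_le]
  rw [add_div, one_div] at h2
  constructor <;> linarith

theorem gridNode_mem {d : ℕ} (α : ℝ) (l : ℕ) {x : Fin (d - 1) → ℝ} (hx : x ∈ baseCube d)
    (i : Fin (d - 1)) {j : ℕ} (hj : j ≤ cellDegree α) :
    cellDegree α * cellIndex l x i + j ≤ gridSize α l := by
  obtain ⟨-, -, h⟩ := cellIndex_bounds l hx i
  calc cellDegree α * cellIndex l x i + j ≤ cellDegree α * cellIndex l x i + cellDegree α := by omega
    _ = cellDegree α * (cellIndex l x i + 1) := by ring
    _ ≤ _ := Nat.mul_le_mul_left _ h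

/-- The point of the cube with grid coordinates `a`. -/
def gridPoint {d : ℕ} (α : ℝ) (l : ℕ) (a : Fin (d - 1) → ℕ) : Fin (d - 1) → ℝ :=
  fun i => (a i : ℝ) / gridSize α l

theorem gridPoint_mem {d : ℕ} (α : ℝ) (l : ℕ) {a : Fin (d - 1) → ℕ} (ha : ∀ i, a i ≤ gridSize α l) :
    gridPoint α l a ∈ baseCube d := by
  have hM : (0 : ℝ) < gridSize α l := by exact_mod_cast gridSize_pos α l
  refine ⟨fun i => ?_, fun i => ?_⟩
  · simp only [gridPoint, Pi.zero_apply]; positivity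
  · simp only [gridPoint, Pi.one_apply]
    rw [div_le_one hM]; exact_mod_cast ha i

theorem strictFloor_add_one {α : ℝ} (hα : 0 < α) : strictFloor α + 1 = ⌈α⌉₊ := by
  have := Nat.ceil_pos.mpr hα
  simp only [strictFloor]; omega

/-- Each factor is a distance inside a cell, at most 2^(-l), over a distance of distinct nodes, at
least 1/M_l; the ratio is at most `cellDegree α`. -/
theorem abs_tensorWeight_le {d : ℕ} (α : ℝ) (l : ℕ) {x : Fin (d - 1) → ℝ}
    (hx : x ∈ baseCube d) {j : Fin (d - 1) → ℕ} (hj : ∀ i, j i ≤ strictFloor α) :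
    |tensorWeight (strictFloor α) (fun i => gridNode α l (cellIndex l x i)) x j| ≤
      ((cellDegree α : ℝ) ^ strictFloor α) ^ (d - 1) := by
  have hD : (0 : ℝ) < cellDegree α := by exact_mod_cast cellDegree_pos α
  have hM : (0 : ℝ) < gridSize α l := by exact_mod_cast gridSize_pos α l
  rw [tensorWeight, Finset.abs_prod]
  have hcard : ((cellDegree α : ℝ) ^ strictFloor α) ^ (d - 1) =
      ∏ _i : Fin (d - 1), (cellDegree α : ℝ) ^ strictFloor α := by simp
  rw [hcard]
  refine Finset.prod_le_prod (fun i _ => abs_nonneg _) fun i _ => ?_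
  rw [Finset.abs_prod]
  have hmem : j i ∈ Finset.range (strictFloor α + 1) := Finset.mem_range.mpr (Nat.lt_succ_of_le (hj i))
  have hcard2 : (cellDegree α : ℝ) ^ strictFloor α =
      ∏ _j ∈ (Finset.range (strictFloor α + 1)).erase (j i), (cellDegree α : ℝ) := by
    rw [Finset.prod_const, Finset.card_erase_of_mem hmem]; simp
  rw [hcard2]
  refine Finset.prod_le_prod (fun i _ => abs_nonneg _) fun j' hj' => ?_
  obtain ⟨hne, hr⟩ := Finset.mem_erase.mp hj'
  have hle : j' ≤ cellDegree α :=
    (Nat.lt_succ_iff.mp (Finset.mem_range.mp hr)).trans (le_max_right _ _)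
  rw [abs_div]
  have h1 := abs_sub_gridNode_le α l hx i hle
  have h2 : (gridSize α l : ℝ)⁻¹ ≤
      |gridNode α l (cellIndex l x i) (j i) - gridNode α l (cellIndex l x i) j'| := by
    rw [gridNode_eq, gridNode_eq, add_sub_add_left_eq_sub, ← sub_div, abs_div, abs_of_pos hM,
      div_eq_mul_inv]
    refine le_mul_of_one_le_left (by positivity) ?_
    have : (1 : ℤ) ≤ |(j i : ℤ) - j'| := Int.one_le_abs (by omega)
    exact_mod_cast this
  rw [div_le_iff₀ (lt_of_lt_of_le (by positivity) h2)]
  refine h1.trans (le_trans (le_of_eq ?_) (mul_le_mul_of_nonneg_left h2 hD.le))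
  rw [gridSize]; push_cast
  field_simp

/-- A bound for the sum of the absolute values of the interpolation weights. -/
def lebesgueBound (d : ℕ) (α : ℝ) : ℝ := ((⌈α⌉₊ : ℝ) ^ ⌈α⌉₊) ^ (d - 1)

theorem cellDegree_le_ceil {α : ℝ} (hα : 0 < α) : cellDegree α ≤ ⌈α⌉₊ := by
  have := strictFloor_add_one hα
  simp only [cellDegree]; omega

/-- There are ⌈α⌉^(d-1) nodes in a cell, each with a weight bounded by `abs_tensorWeight_le`. -/
theorem sum_abs_tensorWeight_le {d : ℕ} {α : ℝ} (hα : 0 < α) (l : ℕ) {x : Fin (d - 1) → ℝ}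
    (hx : x ∈ baseCube d) :
    ∑ j ∈ Fintype.piFinset fun _ : Fin (d - 1) => Finset.range (strictFloor α + 1),
      |tensorWeight (strictFloor α) (fun i => gridNode α l (cellIndex l x i)) x j| ≤
      lebesgueBound d α := by
  have hc := strictFloor_add_one hα
  refine (Finset.sum_le_card_nsmul _ _ _ fun j hj => abs_tensorWeight_le α l hx fun i =>
    Nat.lt_succ_iff.mp (Finset.mem_range.mp (Fintype.mem_piFinset.mp hj i))).trans ?_
  rw [Fintype.card_piFinset]
  simp only [Finset.card_range, Finset.prod_const, Finset.card_univ, Fintype.card_fin, nsmul_eq_mul,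
    Nat.cast_pow]
  rw [← mul_pow, lebesgueBound, Nat.succ_eq_add_one, hc]
  have : (⌈α⌉₊ : ℝ) ^ ⌈α⌉₊ = ⌈α⌉₊ * (⌈α⌉₊ : ℝ) ^ strictFloor α := by
    conv_lhs => rw [← hc, pow_succ', hc]
  rw [this]
  gcongr
  exact_mod_cast cellDegree_le_ceil hα

theorem interp_eq {d : ℕ} (T : (Fin (d - 1) → ℕ) → ℝ) (α : ℝ) (l : ℕ) (x : Fin (d - 1) → ℝ) :
    interp T α l x = ∑ j ∈ Fintype.piFinset fun _ : Fin (d - 1) => Finset.range (strictFloor α + 1),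
      T (fun i => cellDegree α * cellIndex l x i + j i) *
        tensorWeight (strictFloor α) (fun i => gridNode α l (cellIndex l x i)) x j := rfl

/-- By reproduction, g(x) is the weighted sum of the values at the nodes of its Taylor polynomial at
x. Compared node by node, the difference is the threshold error plus a Taylor remainder over a
distance of at most 2^(-l). -/
theorem abs_interp_sub_le {d : ℕ} {lam α e : ℝ} (hα : 0 < α) (hlam : 0 ≤ lam) {l : ℕ}
    {g : (Fin (d - 1) → ℝ) → ℝ} (hg : HolderClass lam α g) {T : (Fin (d - 1) → ℕ) → ℝ}
    (hT : ∀ a : Fin (d - 1) → ℕ, (∀ i, a i ≤ gridSize α l) → |T a - g (gridPoint α l a)| ≤ e)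
    {x : Fin (d - 1) → ℝ} (hx : x ∈ baseCube d) :
    |interp T α l x - g x| ≤ (e + lam * (2 : ℝ) ^ (-((l : ℝ) * α))) * lebesgueBound d α := by
  have hinj : ∀ i, Set.InjOn (gridNode α l (cellIndex l x i)) (Finset.range (strictFloor α + 1)) :=
    fun i => (gridNode_injective α l _).injOn
  conv_lhs => rw [interp_eq, ← sum_taylorPoly_tensorWeight hinj g x, ← Finset.sum_sub_distrib]
  refine (Finset.abs_sum_le_sum_abs _ _).trans ?_
  have he : ∀ j ∈ Fintype.piFinset fun _ : Fin (d - 1) => Finset.range (strictFloor α + 1),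
      |T (fun i => cellDegree α * cellIndex l x i + j i) *
        tensorWeight (strictFloor α) (fun i => gridNode α l (cellIndex l x i)) x j -
        taylorPoly g (strictFloor α) x (fun i => gridNode α l (cellIndex l x i) (j i)) *
        tensorWeight (strictFloor α) (fun i => gridNode α l (cellIndex l x i)) x j| ≤
      (e + lam * (2 : ℝ) ^ (-((l : ℝ) * α))) *
        |tensorWeight (strictFloor α) (fun i => gridNode α l (cellIndex l x i)) x j| := by
    intro j hj
    rw [← sub_mul, abs_mul]
    refine mul_le_mul_of_nonneg_right ?_ (abs_nonneg _)
    have hji : ∀ i, j i ≤ cellDegree α := fun i =>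
      (Nat.lt_succ_iff.mp (Finset.mem_range.mp (Fintype.mem_piFinset.mp hj i))).trans
        (le_max_right _ _)
    have hmem : ∀ i, cellDegree α * cellIndex l x i + j i ≤ gridSize α l := fun i =>
      gridNode_mem α l hx i (hji i)
    have h1 := hT _ hmem
    have hz := gridPoint_mem α l hmem
    have h2 := hg.taylor_bound α hα le_rfl _ hz x hx
    have h3 : ‖gridPoint α l (fun i => cellDegree α * cellIndex l x i + j i) - x‖ ≤
        ((2 : ℝ) ^ l)⁻¹ := by
      rw [pi_norm_le_iff_of_nonneg (by positivity)]
      intro i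
      rw [Real.norm_eq_abs, Pi.sub_apply, abs_sub_comm]
      exact abs_sub_gridNode_le α l hx i (hji i)
    have h4 : ‖gridPoint α l (fun i => cellDegree α * cellIndex l x i + j i) - x‖ ^ α ≤
        (2 : ℝ) ^ (-((l : ℝ) * α)) := by
      refine (Real.rpow_le_rpow (norm_nonneg _) h3 hα.le).trans (le_of_eq ?_)
      rw [← Real.rpow_natCast, ← Real.rpow_neg (by norm_num), ← Real.rpow_mul (by norm_num)]
      ring_nf
    calc _ ≤ _ := abs_sub_le _ (g (gridPoint α l (fun i => cellDegree α * cellIndex l x i + j i))) _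
      _ ≤ _ := add_le_add h1 (h2.trans (mul_le_mul_of_nonneg_left h4 hlam))
  refine (Finset.sum_le_sum he).trans ?_
  rw [← Finset.mul_sum]
  refine mul_le_mul_of_nonneg_left (sum_abs_tensorWeight_le hα l hx) ?_
  have : 0 ≤ e := (abs_nonneg _).trans (hT (fun _ => 0) (fun _ => Nat.zero_le _))
  positivity

theorem gridSize_rpow (α : ℝ) (l : ℕ) :
    (gridSize α l : ℝ) ^ (-α) = (cellDegree α : ℝ) ^ (-α) * (2 : ℝ) ^ (-((l : ℝ) * α)) := by
  rw [gridSize]; push_cast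
  rw [Real.mul_rpow (by positivity) (by positivity), ← Real.rpow_natCast,
    ← Real.rpow_mul (by norm_num)]
  ring_nf

theorem one_le_ceil_cast {α : ℝ} (hα : 0 < α) : (1 : ℝ) ≤ ⌈α⌉₊ := by
  exact_mod_cast Nat.ceil_pos.mpr hα

/-- Of the d factors ⌈α⌉^⌈α⌉ in the bias term, d - 1 pay for the Lebesgue constant and one for the
power of `cellDegree α` hidden in M_l^(-α). -/
theorem lebesgueBound_le_biasTerm {d : ℕ} (hd : 1 ≤ d) {lam α : ℝ} (hα : 0 < α) (hlam : 0 ≤ lam)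
    (l : ℕ) :
    lam * (2 : ℝ) ^ (-((l : ℝ) * α)) * lebesgueBound d α ≤ biasTerm d lam α l := by
  rw [biasTerm, gridSize_rpow, lebesgueBound]
  have hD : (0 : ℝ) < cellDegree α := by exact_mod_cast cellDegree_pos α
  have h1 := one_le_ceil_cast hα
  have hpow : (cellDegree α : ℝ) ^ α ≤ (⌈α⌉₊ : ℝ) ^ ⌈α⌉₊ := by
    calc (cellDegree α : ℝ) ^ α ≤ (⌈α⌉₊ : ℝ) ^ α :=
          Real.rpow_le_rpow hD.le (by exact_mod_cast cellDegree_le_ceil hα) hα.le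
      _ ≤ (⌈α⌉₊ : ℝ) ^ (⌈α⌉₊ : ℝ) := Real.rpow_le_rpow_of_exponent_le h1 (Nat.le_ceil α)
      _ = _ := Real.rpow_natCast _ _
  have hsplit : (⌈α⌉₊ : ℝ) ^ (d * ⌈α⌉₊) = ((⌈α⌉₊ : ℝ) ^ ⌈α⌉₊) ^ (d - 1) * (⌈α⌉₊ : ℝ) ^ ⌈α⌉₊ := by
    rw [← pow_succ, ← pow_mul, mul_comm d, Nat.sub_add_cancel hd]
  rw [hsplit, Real.rpow_neg hD.le]
  have : 1 ≤ (⌈α⌉₊ : ℝ) ^ ⌈α⌉₊ * ((cellDegree α : ℝ) ^ α)⁻¹ := by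
    rw [← div_eq_mul_inv, one_le_div (by positivity)]; exact hpow
  calc lam * (2 : ℝ) ^ (-((l : ℝ) * α)) * ((⌈α⌉₊ : ℝ) ^ ⌈α⌉₊) ^ (d - 1)
      ≤ lam * (2 : ℝ) ^ (-((l : ℝ) * α)) * ((⌈α⌉₊ : ℝ) ^ ⌈α⌉₊) ^ (d - 1) *
        ((⌈α⌉₊ : ℝ) ^ ⌈α⌉₊ * ((cellDegree α : ℝ) ^ α)⁻¹) :=
        le_mul_of_one_le_right (by positivity) this
    _ = _ := by ring

theorem biasTerm_le {d : ℕ} {lam α : ℝ} (hα : 0 < α) (hlam : 0 ≤ lam) (l : ℕ) :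
    biasTerm d lam α l ≤ (⌈α⌉₊ : ℝ) ^ (d * ⌈α⌉₊) * (lam * (2 : ℝ) ^ (-((l : ℝ) * α))) := by
  rw [biasTerm, gridSize_rpow]
  have hD : (1 : ℝ) ≤ cellDegree α := by exact_mod_cast cellDegree_pos α
  have h : (cellDegree α : ℝ) ^ (-α) ≤ 1 := Real.rpow_le_one_of_one_le_of_nonpos hD (by linarith)
  calc _ = (⌈α⌉₊ : ℝ) ^ (d * ⌈α⌉₊) * (lam * (2 : ℝ) ^ (-((l : ℝ) * α))) * (cellDegree α : ℝ) ^ (-α) := by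
        ring
    _ ≤ _ := mul_le_of_le_one_right (by positivity) h

theorem biasTerm_pos {d : ℕ} {lam α : ℝ} (hα : 0 < α) (hlam : 0 < lam) (l : ℕ) :
    0 < biasTerm d lam α l := by
  have := one_le_ceil_cast hα
  have hM : (0 : ℝ) < gridSize α l := by exact_mod_cast gridSize_pos α l
  rw [biasTerm]; positivity

/-! ### Line search -/

/-- The empirical means at all dyadic points that the line search may visit are within the
confidence radius of the true values `h`. -/
def LineGood (lab : ℕ → ℝ → ℕ → Bool) (h : ℝ → ℝ) (ε δ : ℝ) : Prop :=
  ∀ k : ℕ, 1 ≤ k → k < searchDepth ε → ∀ j : ℕ, j ≤ 2 ^ (k + 1) → ∀ t : ℕ, 1 ≤ t →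
    |empMean lab k ((j : ℝ) / 2 ^ (k + 1)) t - h ((j : ℝ) / 2 ^ (k + 1))| <
      confRadius (δ / (searchDepth ε * 2 ^ k)) t

theorem epochNext_cases (lab : ℕ → ℝ → ℕ → Bool) (δk : ℝ) (k : ℕ) (L R : ℝ) :
    epochNext lab δk k L R = (L, (L + R) / 2) ∨ epochNext lab δk k L R = ((L + R) / 2, R) ∨
      epochNext lab δk k L R = (L + (R - L) / 4, (L + R) / 2 + (R - L) / 4) := by
  simp only [epochNext]
  split_ifs <;> simp

/-- The length after k epochs is 2^(-k) on every path, and the left end lies on a dyadic grid. The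
heights used in epoch k + 1 are therefore multiples of 2^(-(k+2)), the finite set over which
`LineGood` quantifies. -/
theorem searchState_dyadic (lab : ℕ → ℝ → ℕ → Bool) (ε δ : ℝ) (k : ℕ) :
    ∃ j : ℕ, (searchState lab ε δ k).1 = ((j : ℝ) / 2 ^ (k + 1), ((j : ℝ) + 2) / 2 ^ (k + 1)) ∧
      j + 2 ≤ 2 ^ (k + 1) := by
  induction k with
  | zero => exact ⟨0, by simp [searchState], by norm_num⟩
  | succ k ih =>
    obtain ⟨j, hj, hle⟩ := ih
    simp only [searchState, hj]
    have h2 : 2 ^ (k + 1 + 1) = 2 * 2 ^ (k + 1) := pow_succ' _ _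
    rcases epochNext_cases lab (δ / (searchDepth ε * 2 ^ (k + 1))) (k + 1)
      ((j : ℝ) / 2 ^ (k + 1)) (((j : ℝ) + 2) / 2 ^ (k + 1)) with h | h | h
    · refine ⟨2 * j, ?_, by omega⟩
      rw [h]; push_cast; ext <;> (simp only []; field_simp; ring)
    · refine ⟨2 * j + 2, ?_, by omega⟩
      rw [h]; push_cast; ext <;> (simp only []; field_simp; ring)
    · refine ⟨2 * j + 1, ?_, by omega⟩
      rw [h]; push_cast; ext <;> (simp only []; field_simp; ring)

section

variable {lab : ℕ → ℝ → ℕ → Bool} {h : ℝ → ℝ} {ε δ γ c κ : ℝ}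

theorem dyadic_mem {j n : ℕ} (hj : j ≤ 2 ^ n) : (j : ℝ) / 2 ^ n ∈ Set.Icc (0 : ℝ) 1 := by
  refine ⟨by positivity, ?_⟩
  rw [div_le_one (by positivity)]; exact_mod_cast hj

/-- At the end of a completed epoch on `[j/2^(k+1), (j+2)/2^(k+1)]` the threshold is still
enclosed. -/
theorem mem_epochNext (hgood : LineGood lab h ε δ)
    (hh : ∀ z ∈ Set.Icc (0 : ℝ) 1, 1 / 2 ≤ h z ↔ γ ≤ z) {k j : ℕ} (hk : k + 1 < searchDepth ε)
    (hj : j + 2 ≤ 2 ^ (k + 1)) {L R : ℝ} (hL : L = (j : ℝ) / 2 ^ (k + 1))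
    (hR : R = ((j : ℝ) + 2) / 2 ^ (k + 1)) (hγ : γ ∈ Set.Icc L R)
    (hne : (endRounds lab (δ / (searchDepth ε * 2 ^ (k + 1))) (k + 1) L R).Nonempty) :
    γ ∈ Set.Icc (epochNext lab (δ / (searchDepth ε * 2 ^ (k + 1))) (k + 1) L R).1
      (epochNext lab (δ / (searchDepth ε * 2 ^ (k + 1))) (k + 1) L R).2 := by
  have hM : (L + R) / 2 = ((2 * j + 2 : ℕ) : ℝ) / 2 ^ (k + 1 + 1) := by
    rw [hL, hR]; push_cast; field_simp; ring
  have hU : L + (R - L) / 4 = ((2 * j + 1 : ℕ) : ℝ) / 2 ^ (k + 1 + 1) := by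
    rw [hL, hR]; push_cast; field_simp; ring
  have hV : (L + R) / 2 + (R - L) / 4 = ((2 * j + 3 : ℕ) : ℝ) / 2 ^ (k + 1 + 1) := by
    rw [hL, hR]; push_cast; field_simp; ring
  have h2 : 2 ^ (k + 1 + 1) = 2 * 2 ^ (k + 1) := pow_succ' _ _
  have hmem := Nat.sInf_mem hne
  simp only [epochNext]
  set t := sInf (endRounds lab (δ / (searchDepth ε * 2 ^ (k + 1))) (k + 1) L R)
  obtain ⟨ht, hdec⟩ := hmem
  have gM := hgood (k + 1) (by omega) hk (2 * j + 2) (by omega) t ht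
  have gU := hgood (k + 1) (by omega) hk (2 * j + 1) (by omega) t ht
  have gV := hgood (k + 1) (by omega) hk (2 * j + 3) (by omega) t ht
  have mM := hh _ (dyadic_mem (show 2 * j + 2 ≤ 2 ^ (k + 1 + 1) by omega))
  have mU := hh _ (dyadic_mem (show 2 * j + 1 ≤ 2 ^ (k + 1 + 1) by omega))
  have mV := hh _ (dyadic_mem (show 2 * j + 3 ≤ 2 ^ (k + 1 + 1) by omega))
  rw [← hM] at gM mM
  rw [← hU] at gU mU
  rw [← hV] at gV mV
  rw [abs_lt] at gM gU gV
  -- A decision needs a gap of at least the radius while the deviation is strictly smaller, so the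
  -- true value lies strictly on the same side of 1/2 as the empirical mean.
  split_ifs with h1 h3
  · refine ⟨hγ.1, mM.mp ?_⟩
    simp only [midDecided] at h1
    rw [abs_of_pos (by linarith)] at h1
    linarith
  · refine ⟨?_, hγ.2⟩
    simp only [midDecided] at h1
    rw [abs_of_nonpos (by linarith)] at h1
    by_contra hcon
    have := mM.mpr (le_of_lt (not_le.mp hcon))
    linarith
  · have hq := hdec.resolve_left h1
    simp only [quartilesDecided] at hq
    refine ⟨?_, mV.mp (by linarith)⟩
    by_contra hcon
    have := mU.mpr (le_of_lt (not_le.mp hcon))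
    linarith

theorem endRounds_nonempty_of_epochCost {δk : ℝ} {k : ℕ} {L R : ℝ}
    (hc : epochCost lab δk k L R ≠ ⊤) : (endRounds lab δk k L R).Nonempty := by
  by_contra hne
  rw [Set.not_nonempty_iff_eq_empty] at hne
  apply hc
  simp [epochCost, hne]

theorem mem_searchState (hgood : LineGood lab h ε δ)
    (hh : ∀ z ∈ Set.Icc (0 : ℝ) 1, 1 / 2 ≤ h z ↔ γ ≤ z) (hγ : γ ∈ Set.Icc (0 : ℝ) 1) (k : ℕ)
    (hk : k ≤ searchDepth ε - 1) (hfin : (searchState lab ε δ k).2 ≠ ⊤) :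
    γ ∈ Set.Icc (searchState lab ε δ k).1.1 (searchState lab ε δ k).1.2 := by
  induction k with
  | zero => simpa [searchState] using hγ
  | succ k ih =>
    simp only [searchState, ne_eq, ENat.add_eq_top, not_or] at hfin
    have ih' := ih (by omega) hfin.1
    obtain ⟨j, hj, hle⟩ := searchState_dyadic lab ε δ k
    have h1 : (searchState lab ε δ k).1.1 = (j : ℝ) / 2 ^ (k + 1) := by rw [hj]
    have h2 : (searchState lab ε δ k).1.2 = ((j : ℝ) + 2) / 2 ^ (k + 1) := by rw [hj]
    exact mem_epochNext hgood hh (by omega) hle h1 h2 ih'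
      (endRounds_nonempty_of_epochCost hfin.2)

theorem two_pow_neg_searchDepth_le (hε : 0 < ε) : (1 / 2 : ℝ) ^ searchDepth ε ≤ 2 * ε := by
  have h1 : Real.logb 2 (1 / (2 * ε)) ≤ searchDepth ε := Nat.le_ceil _
  rw [Real.logb_le_iff_le_rpow (by norm_num) (by positivity), Real.rpow_natCast,
    div_le_iff₀ (by positivity)] at h1
  rw [one_div, inv_pow, inv_le_iff_one_le_mul₀ (by positivity)]
  linarith

/-- For K ≥ 1 the last interval has half-length 2^(-K), which the choice of K makes at most 2ε. -/
theorem abs_searchThreshold_sub_le (hε : 0 < ε) (hgood : LineGood lab h ε δ)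
    (hh : ∀ z ∈ Set.Icc (0 : ℝ) 1, 1 / 2 ≤ h z ↔ γ ≤ z) (hγ : γ ∈ Set.Icc (0 : ℝ) 1)
    (hfin : searchCost lab ε δ ≠ ⊤) : |searchThreshold lab ε δ - γ| ≤ 2 * ε := by
  have hm := mem_searchState hgood hh hγ (searchDepth ε - 1) le_rfl hfin
  obtain ⟨j, hj, -⟩ := searchState_dyadic lab ε δ (searchDepth ε - 1)
  have hK := two_pow_neg_searchDepth_le hε
  have hle : (1 : ℝ) / 2 ^ (searchDepth ε - 1 + 1) ≤ 2 * ε := by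
    -- If K = 0, truncated subtraction leaves the interval [0,1] with half-length 1/2, but then
    -- already 2ε ≥ 1.
    rcases Nat.eq_zero_or_pos (searchDepth ε) with h0 | h0
    · rw [h0] at hK ⊢
      norm_num at hK ⊢
      linarith
    · rw [Nat.sub_add_cancel h0, ← one_div_pow]; exact hK
  simp only [searchThreshold]
  rw [hj] at hm ⊢
  simp only [Set.mem_Icc, add_div] at hm ⊢
  have e2 : (2 : ℝ) / 2 ^ (searchDepth ε - 1 + 1) = 2 * (1 / 2 ^ (searchDepth ε - 1 + 1)) := by ring
  rw [abs_le]
  constructor <;> linarith [hm.1, hm.2]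

/-- Near γ the noise condition gives nothing at the midpoint; the quartile test covers this case.
With w = R - L, if the midpoint is within w/8 of γ, then the quartiles lie on opposite sides of γ at
distance more than w/8. Of the two radii in `hr`, one absorbs the deviation and the other is the
decision threshold. -/
theorem mem_endRounds (hκ : 1 ≤ κ) (hc : 0 ≤ c) (hgood : LineGood lab h ε δ)
    (hh : ∀ z ∈ Set.Icc (0 : ℝ) 1, 1 / 2 ≤ h z ↔ γ ≤ z)
    (hnoise : ∀ z ∈ Set.Icc (0 : ℝ) 1, c * |z - γ| ^ (κ - 1) ≤ |h z - 1 / 2|)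
    {k j : ℕ} (hk : k + 1 < searchDepth ε)
    (hj : j + 2 ≤ 2 ^ (k + 1)) {L R : ℝ} (hL : L = (j : ℝ) / 2 ^ (k + 1))
    (hR : R = ((j : ℝ) + 2) / 2 ^ (k + 1)) {t : ℕ} (ht : 1 ≤ t)
    (hr : 2 * confRadius (δ / (searchDepth ε * 2 ^ (k + 1))) t ≤ c * ((R - L) / 8) ^ (κ - 1)) :
    t ∈ endRounds lab (δ / (searchDepth ε * 2 ^ (k + 1))) (k + 1) L R := by
  have hM : (L + R) / 2 = ((2 * j + 2 : ℕ) : ℝ) / 2 ^ (k + 1 + 1) := by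
    rw [hL, hR]; push_cast; field_simp; ring
  have hU : L + (R - L) / 4 = ((2 * j + 1 : ℕ) : ℝ) / 2 ^ (k + 1 + 1) := by
    rw [hL, hR]; push_cast; field_simp; ring
  have hV : (L + R) / 2 + (R - L) / 4 = ((2 * j + 3 : ℕ) : ℝ) / 2 ^ (k + 1 + 1) := by
    rw [hL, hR]; push_cast; field_simp; ring
  have hw : 0 < R - L := by
    have : R - L = 2 / 2 ^ (k + 1) := by rw [hL, hR]; ring
    rw [this]; positivity
  have h2 : 2 ^ (k + 1 + 1) = 2 * 2 ^ (k + 1) := pow_succ' _ _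
  have gM := hgood (k + 1) (by omega) hk (2 * j + 2) (by omega) t ht
  have gU := hgood (k + 1) (by omega) hk (2 * j + 1) (by omega) t ht
  have gV := hgood (k + 1) (by omega) hk (2 * j + 3) (by omega) t ht
  have dM := dyadic_mem (show 2 * j + 2 ≤ 2 ^ (k + 1 + 1) by omega)
  have dU := dyadic_mem (show 2 * j + 1 ≤ 2 ^ (k + 1 + 1) by omega)
  have dV := dyadic_mem (show 2 * j + 3 ≤ 2 ^ (k + 1 + 1) by omega)
  rw [← hM] at gM dM
  rw [← hU] at gU dU
  rw [← hV] at gV dV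
  have far : ∀ z ∈ Set.Icc (0 : ℝ) 1, (R - L) / 8 ≤ |z - γ| →
      2 * confRadius (δ / (searchDepth ε * 2 ^ (k + 1))) t ≤ |h z - 1 / 2| := by
    intro z hz hd
    refine hr.trans (le_trans ?_ (hnoise z hz))
    gcongr
  refine ⟨ht, ?_⟩
  by_cases hd : (R - L) / 8 ≤ |(L + R) / 2 - γ|
  · left
    have := far _ dM hd
    simp only [midDecided]
    have h3 := abs_sub_abs_le_abs_sub (h ((L + R) / 2) - 1 / 2)
      (empMean lab (k + 1) ((L + R) / 2) t - 1 / 2)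
    rw [sub_sub_sub_cancel_right, abs_sub_comm (h _) (empMean _ _ _ _)] at h3
    linarith
  · right
    rw [not_le, abs_lt] at hd
    have fV := far _ dV (by rw [abs_of_pos] <;> linarith)
    have fU := far _ dU (by rw [abs_of_neg] <;> linarith)
    have sV := (hh _ dV).mpr (by linarith)
    have sU : h (L + (R - L) / 4) < 1 / 2 := by
      by_contra hcon
      have := (hh _ dU).mp (not_lt.mp hcon)
      linarith
    rw [abs_of_nonneg (by linarith)] at fV
    rw [abs_of_neg (by linarith)] at fU
    rw [abs_lt] at gU gV
    simp only [quartilesDecided]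
    constructor <;> linarith

/-- Epoch k + 1 starts with length 2^(-k) whatever happened before, so a sufficient round `τ k` can
be prescribed in advance, and the epoch ends no later than this. -/
theorem searchState_cost_le (hκ : 1 ≤ κ) (hc : 0 ≤ c) (hgood : LineGood lab h ε δ)
    (hh : ∀ z ∈ Set.Icc (0 : ℝ) 1, 1 / 2 ≤ h z ↔ γ ≤ z) (hγ : γ ∈ Set.Icc (0 : ℝ) 1)
    (hnoise : ∀ z ∈ Set.Icc (0 : ℝ) 1, c * |z - γ| ^ (κ - 1) ≤ |h z - 1 / 2|)
    {τ : ℕ → ℕ} (hτ : ∀ k, k + 1 < searchDepth ε → 1 ≤ τ k ∧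
      2 * confRadius (δ / (searchDepth ε * 2 ^ (k + 1))) (τ k) ≤
        c * (((2 : ℝ) ^ k)⁻¹ / 8) ^ (κ - 1)) (k : ℕ) (hk : k ≤ searchDepth ε - 1) :
    (searchState lab ε δ k).2 ≤ ((∑ i ∈ Finset.range k, 3 * τ i : ℕ) : ℕ∞) := by
  induction k with
  | zero => simp [searchState]
  | succ k ih =>
    have ih' := ih (by omega)
    have hm := mem_searchState hgood hh hγ k (by omega)
      (ne_top_of_le_ne_top (ENat.natCast_ne_top _) ih')
    obtain ⟨j, hj, hle⟩ := searchState_dyadic lab ε δ k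
    have h1 : (searchState lab ε δ k).1.1 = (j : ℝ) / 2 ^ (k + 1) := by rw [hj]
    have h2 : (searchState lab ε δ k).1.2 = ((j : ℝ) + 2) / 2 ^ (k + 1) := by rw [hj]
    obtain ⟨ht, hr⟩ := hτ k (by omega)
    have hend := mem_endRounds hκ hc hgood hh hnoise (k := k) (by omega) hle h1 h2 ht (by
      have : (searchState lab ε δ k).1.2 - (searchState lab ε δ k).1.1 = ((2 : ℝ) ^ k)⁻¹ := by
        rw [h1, h2]; field_simp; ring
      rw [this]; exact hr)
    rw [Finset.sum_range_succ, Nat.cast_add]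
    simp only [searchState]
    refine add_le_add ih' ?_
    rw [Nat.cast_mul]
    exact mul_le_mul_right (iInf₂_le (τ k) hend) _

theorem searchCost_le (hκ : 1 ≤ κ) (hc : 0 ≤ c) (hgood : LineGood lab h ε δ)
    (hh : ∀ z ∈ Set.Icc (0 : ℝ) 1, 1 / 2 ≤ h z ↔ γ ≤ z) (hγ : γ ∈ Set.Icc (0 : ℝ) 1)
    (hnoise : ∀ z ∈ Set.Icc (0 : ℝ) 1, c * |z - γ| ^ (κ - 1) ≤ |h z - 1 / 2|)
    {τ : ℕ → ℕ} (hτ : ∀ k, k + 1 < searchDepth ε → 1 ≤ τ k ∧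
      2 * confRadius (δ / (searchDepth ε * 2 ^ (k + 1))) (τ k) ≤
        c * (((2 : ℝ) ^ k)⁻¹ / 8) ^ (κ - 1)) :
    searchCost lab ε δ ≤ ((∑ i ∈ Finset.range (searchDepth ε - 1), 3 * τ i : ℕ) : ℕ∞) :=
  searchState_cost_le hκ hc hgood hh hγ hnoise hτ _ le_rfl

/-- A line search that has at least one epoch requests at least one label. -/
theorem one_le_searchCost (hK : 2 ≤ searchDepth ε) : 1 ≤ searchCost lab ε δ := by
  obtain ⟨n, hn⟩ : ∃ n, searchDepth ε - 1 = n + 1 := ⟨searchDepth ε - 2, by omega⟩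
  rw [searchCost, hn]
  simp only [searchState]
  refine le_add_left ?_
  rw [epochCost]
  have : (1 : ℕ∞) ≤ ⨅ t ∈ endRounds lab (δ / (searchDepth ε * 2 ^ (n + 1))) (n + 1)
      (searchState lab ε δ n).1.1 (searchState lab ε δ n).1.2, (t : ℕ∞) :=
    le_iInf₂ fun t ht => by exact_mod_cast ht.1
  calc (1 : ℕ∞) ≤ 3 * 1 := by norm_num
    _ ≤ _ := mul_le_mul_right this 3

end

/-! ### Concentration -/

section

variable {Ω : Type*} [MeasurableSpace Ω] {μ : Measure Ω}

theorem measure_iUnion_le_ofReal {s : ℕ → Set Ω} {b : ℕ → ℝ} {B : ℝ} (hb : ∀ n, 0 ≤ b n)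
    (hB : HasSum b B) (h : ∀ n, μ (s n) ≤ ENNReal.ofReal (b n)) :
    μ (⋃ n, s n) ≤ ENNReal.ofReal B := by
  refine (measure_iUnion_le s).trans ((ENNReal.tsum_le_tsum h).trans ?_)
  rw [← ENNReal.ofReal_tsum_of_nonneg hb hB.summable, hB.tsum_eq]

theorem measure_biUnion_finset_le_ofReal {ι : Type*} {I : Finset ι} {s : ι → Set Ω} {b : ℝ}
    (h : ∀ i ∈ I, μ (s i) ≤ ENNReal.ofReal b) :
    μ (⋃ i ∈ I, s i) ≤ ENNReal.ofReal (I.card * b) := by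
  refine (measure_biUnion_finset_le I s).trans ((Finset.sum_le_card_nsmul I _ _ h).trans ?_)
  rw [ENNReal.ofReal_mul (by positivity), ENNReal.ofReal_natCast, nsmul_eq_mul]

variable [IsProbabilityMeasure μ]

/-- This is the Hoeffding bound exp(-2 t r²) for t labels with variance proxy 1/4 each, where t r² =
2 log(t/δ). The conditions δ ≤ 1 ≤ t keep the logarithm nonnegative, so the square root is not
truncated. -/
theorem mul_confRadius_sq {δ : ℝ} (hδ : 0 < δ) (hδ1 : δ ≤ 1) {t : ℕ} (ht : 1 ≤ t) :
    Real.exp (-(t * confRadius δ t) ^ 2 / (2 * (t * (1 / 2) ^ 2))) = (δ / t) ^ 4 := by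
  have ht0 : (0 : ℝ) < t := by exact_mod_cast ht
  have ht1 : (1 : ℝ) ≤ t := by exact_mod_cast ht
  have hlog : 0 ≤ Real.log (t / δ) := Real.log_nonneg (by rw [le_div_iff₀ hδ]; linarith)
  have hsq : confRadius δ t ^ 2 = 4 * (Real.log (t / δ) / (2 * t)) := by
    rw [confRadius, mul_pow, Real.sq_sqrt (by positivity)]; norm_num
  have : -(t * confRadius δ t) ^ 2 / (2 * (t * (1 / 2) ^ 2)) = ((4 : ℕ) : ℝ) * Real.log (δ / t) := by
    rw [mul_pow, hsq, Real.log_div hδ.ne' ht0.ne', Real.log_div ht0.ne' hδ.ne']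
    push_cast; field_simp; ring
  rw [this, Real.exp_nat_mul, Real.exp_log (by positivity)]

theorem confRadius_nonneg (δ : ℝ) (t : ℕ) : 0 ≤ confRadius δ t := by
  rw [confRadius]; positivity

theorem measure_mean_deviation_le {B : ℕ → Ω → Bool} (hm : ∀ s, Measurable (B s))
    (hind : iIndepFun B μ) {p : ℝ} (hp : p ∈ Set.Icc (0 : ℝ) 1)
    (hlaw : ∀ s, μ {ω | B s ω = true} = ENNReal.ofReal p) {δ : ℝ} (hδ : 0 < δ) (hδ1 : δ ≤ 1)
    {t : ℕ} (ht : 1 ≤ t) :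
    μ {ω | ¬ |(∑ s ∈ Finset.Icc 1 t, if B s ω then (1 : ℝ) else 0) / t - p| < confRadius δ t} ≤
      ENNReal.ofReal (2 * (δ / t) ^ 4) := by
  have ht0 : (0 : ℝ) < t := by exact_mod_cast ht
  set φ : Bool → ℝ := fun b => if b then 1 else 0 with hφ
  have hXm : ∀ s, Measurable fun ω => φ (B s ω) := fun s =>
    (measurable_from_top (f := φ)).comp (hm s)
  have hmean : ∀ s, μ[fun ω => φ (B s ω)] = p := by
    intro s
    have : (fun ω => φ (B s ω)) = Set.indicator {ω | B s ω = true} (fun _ => (1 : ℝ)) := by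
      ext ω; simp [hφ, Set.indicator_apply]
    have hms : MeasurableSet {ω | B s ω = true} := hm s (measurableSet_singleton true)
    rw [this, integral_indicator_const _ hms, measureReal_def, hlaw,
      ENNReal.toReal_ofReal hp.1, smul_eq_mul, mul_one]
  have hsub : ∀ s, HasSubgaussianMGF (fun ω => φ (B s ω) - p) ((‖(1 : ℝ) - 0‖₊ / 2) ^ 2) μ := by
    intro s
    have := hasSubgaussianMGF_of_mem_Icc (μ := μ) (X := fun ω => φ (B s ω)) (a := 0) (b := 1)
      (hXm s).aemeasurable (Filter.Eventually.of_forall fun ω => by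
        by_cases h : B s ω <;> simp [hφ, h])
    rwa [hmean] at this
  have hi1 : iIndepFun (fun s ω => φ (B s ω) - p) μ :=
    hind.comp (fun _ b => φ b - p) fun _ => measurable_from_top
  have hi2 : iIndepFun (fun s => -fun ω => φ (B s ω) - p) μ :=
    hind.comp (fun _ b => -(φ b - p)) fun _ => measurable_from_top
  have hr : 0 ≤ t * confRadius δ t := mul_nonneg ht0.le (confRadius_nonneg _ _)
  have e1 := HasSubgaussianMGF.measure_sum_ge_le_of_iIndepFun hi1 (s := Finset.Icc 1 t) (fun s _ => hsub s) hr
  have e2 := HasSubgaussianMGF.measure_sum_ge_le_of_iIndepFun hi2 (s := Finset.Icc 1 t) (fun s _ => (hsub s).neg) hr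
  have hc : (2 * ((∑ _s ∈ Finset.Icc 1 t, (‖(1 : ℝ) - 0‖₊ / 2) ^ 2 : NNReal) : ℝ)) =
      2 * (t * (1 / 2) ^ 2) := by
    simp
  rw [hc, mul_confRadius_sq hδ hδ1 ht] at e1 e2
  have hss : {ω | ¬ |(∑ s ∈ Finset.Icc 1 t, if B s ω then (1 : ℝ) else 0) / t - p| <
      confRadius δ t} ⊆
      {ω | t * confRadius δ t ≤ ∑ s ∈ Finset.Icc 1 t, (φ (B s ω) - p)} ∪
        {ω | t * confRadius δ t ≤ ∑ s ∈ Finset.Icc 1 t, (-fun ω => φ (B s ω) - p) ω} := by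
    intro ω hω
    simp only [Set.mem_ofPred_eq, not_lt, Set.mem_union, Pi.neg_apply] at hω ⊢
    have hsum : ∑ s ∈ Finset.Icc 1 t, (φ (B s ω) - p) =
        t * ((∑ s ∈ Finset.Icc 1 t, if B s ω then (1 : ℝ) else 0) / t - p) := by
      rw [Finset.sum_sub_distrib, mul_sub, mul_div_cancel₀ _ ht0.ne']
      simp [hφ]
    rw [Finset.sum_neg_distrib, hsum]
    rcases le_abs.mp hω with h | h
    · left; exact mul_le_mul_of_nonneg_left h ht0.le
    · right; rw [← mul_neg]; exact mul_le_mul_of_nonneg_left h ht0.le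
  refine (measure_mono hss).trans ((measure_union_le _ _).trans ?_)
  rw [← ofReal_measureReal, ← ofReal_measureReal, ← ENNReal.ofReal_add (by positivity) (by positivity)]
  exact ENNReal.ofReal_le_ofReal (by linarith)

/-- The sum of 2/t^4 is π^4/45 < 4. Uniformity in t is what permits a stopping round that depends on
the labels. -/
theorem measure_exists_deviation_le {B : ℕ → Ω → Bool} (hm : ∀ s, Measurable (B s))
    (hind : iIndepFun B μ) {p : ℝ} (hp : p ∈ Set.Icc (0 : ℝ) 1)
    (hlaw : ∀ s, μ {ω | B s ω = true} = ENNReal.ofReal p) {δ : ℝ} (hδ : 0 < δ) (hδ1 : δ ≤ 1) :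
    μ {ω | ∃ t : ℕ, 1 ≤ t ∧
      ¬ |(∑ s ∈ Finset.Icc 1 t, if B s ω then (1 : ℝ) else 0) / t - p| < confRadius δ t} ≤
      ENNReal.ofReal (4 * δ ^ 4) := by
  have hset : {ω | ∃ t : ℕ, 1 ≤ t ∧
      ¬ |(∑ s ∈ Finset.Icc 1 t, if B s ω then (1 : ℝ) else 0) / t - p| < confRadius δ t} =
      ⋃ t : ℕ, {ω | 1 ≤ t ∧
      ¬ |(∑ s ∈ Finset.Icc 1 t, if B s ω then (1 : ℝ) else 0) / t - p| < confRadius δ t} := by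
    ext ω; simp
  rw [hset]
  -- At t = 0 the summand is 0 because 1/0 = 0, in accordance with the empty event.
  refine (measure_iUnion_le_ofReal (b := fun t : ℕ => 2 * δ ^ 4 * (1 / (t : ℝ) ^ 4))
    (fun t => by positivity) (hasSum_zeta_four.mul_left (2 * δ ^ 4)) fun t => ?_).trans ?_
  · by_cases ht : 1 ≤ t
    · simp only [ht, true_and]
      refine (measure_mean_deviation_le hm hind hp hlaw hδ hδ1 ht).trans
        (ENNReal.ofReal_le_ofReal (le_of_eq ?_))
      rw [div_pow]; ring
    · simp [ht]
  · refine ENNReal.ofReal_le_ofReal ?_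
    have hpi : Real.pi ^ 4 ≤ 180 := by
      have h1 := Real.pi_lt_d2.le
      calc Real.pi ^ 4 ≤ 3.15 ^ 4 := by gcongr
        _ ≤ 180 := by norm_num
    have : 0 < δ ^ 4 := by positivity
    nlinarith

/-- Epoch k has 2^(k+1) + 1 candidate heights, each failing with probability at most 4(δ/2^k)^4, so
the fourth power outweighs their number. Independence is used only among the labels at one height in
one epoch. -/
theorem measure_not_lineGood_le {B : ℕ → ℝ → ℕ → Ω → Bool} {h : ℝ → ℝ}
    (hm : ∀ k z s, Measurable (B k z s)) (hind : ∀ k z, iIndepFun (B k z) μ)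
    (hp : ∀ z ∈ Set.Icc (0 : ℝ) 1, h z ∈ Set.Icc (0 : ℝ) 1)
    (hlaw : ∀ k, ∀ z ∈ Set.Icc (0 : ℝ) 1, ∀ s, μ {ω | B k z s ω = true} = ENNReal.ofReal (h z))
    {ε δ : ℝ} (hδ : 0 < δ) (hδ1 : δ ≤ 1) :
    μ {ω | ¬ LineGood (fun k z s => B k z s ω) h ε δ} ≤ ENNReal.ofReal (32 * δ ^ 4) := by
  have hss : {ω | ¬ LineGood (fun k z s => B k z s ω) h ε δ} ⊆
      ⋃ k : ℕ, ⋃ j ∈ Finset.range (2 ^ (k + 1) + 1), {ω | (1 ≤ k ∧ k < searchDepth ε) ∧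
        ∃ t : ℕ, 1 ≤ t ∧ ¬ |(∑ s ∈ Finset.Icc 1 t,
          if B k ((j : ℝ) / 2 ^ (k + 1)) s ω then (1 : ℝ) else 0) / t - h ((j : ℝ) / 2 ^ (k + 1))| <
            confRadius (δ / (searchDepth ε * 2 ^ k)) t} := by
    intro ω hω
    simp only [LineGood, Set.mem_ofPred_eq, not_forall] at hω
    obtain ⟨k, h1, h2, j, hj, t, ht, hne⟩ := hω
    simp only [Set.mem_iUnion]
    exact ⟨k, j, Finset.mem_range.mpr (Nat.lt_succ_of_le hj), ⟨h1, h2⟩, t, ht, hne⟩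
  refine (measure_mono hss).trans ?_
  refine (measure_iUnion_le_ofReal (b := fun k : ℕ => 16 * δ ^ 4 * (1 / 2) ^ k)
    (fun k => by positivity) (hasSum_geometric_two.mul_left (16 * δ ^ 4)) fun k => ?_).trans
    (ENNReal.ofReal_le_ofReal (by linarith))
  by_cases hk : 1 ≤ k ∧ k < searchDepth ε
  · simp only [hk, and_self, true_and]
    have hK : (1 : ℝ) ≤ searchDepth ε := by exact_mod_cast hk.1.trans hk.2.le
    have h2k : (1 : ℝ) ≤ 2 ^ k := one_le_pow₀ (by norm_num)
    have hden : (2 : ℝ) ^ k ≤ searchDepth ε * 2 ^ k := le_mul_of_one_le_left (by positivity) hK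
    have hb : δ / (searchDepth ε * 2 ^ k) ≤ δ / 2 ^ k := by gcongr
    have hb1 : δ / (searchDepth ε * 2 ^ k) ≤ 1 :=
      hb.trans (by rw [div_le_one (by positivity)]; linarith)
    refine (measure_biUnion_finset_le_ofReal (b := 4 * (δ / 2 ^ k) ^ 4) fun j hj => ?_).trans
      (ENNReal.ofReal_le_ofReal ?_)
    · have hz := dyadic_mem (Nat.lt_succ_iff.mp (Finset.mem_range.mp hj))
      refine (measure_exists_deviation_le (hm k _) (hind k _) (hp _ hz) (hlaw k _ hz)
        (by positivity) hb1).trans (ENNReal.ofReal_le_ofReal ?_)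
      gcongr
    · rw [Finset.card_range, div_pow]
      push_cast
      have e : (2 : ℝ) ^ (k + 1) + 1 ≤ 4 * 2 ^ k := by rw [pow_succ]; linarith
      have e3 : ((2 : ℝ) ^ k) * (4 * (δ ^ 4 / (2 ^ k) ^ 4)) ≤ 4 * δ ^ 4 * (1 / 2) ^ k := by
        rw [one_div, inv_pow]
        have : (2 : ℝ) ^ k * (4 * (δ ^ 4 / (2 ^ k) ^ 4)) = 4 * δ ^ 4 * ((2 ^ k) ^ 3)⁻¹ := by
          field_simp
        rw [this]
        gcongr
        exact le_self_pow₀ h2k (by norm_num)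
      calc ((2 : ℝ) ^ (k + 1) + 1) * (4 * (δ ^ 4 / (2 ^ k) ^ 4))
          ≤ (4 * 2 ^ k) * (4 * (δ ^ 4 / (2 ^ k) ^ 4)) := by gcongr
        _ = 4 * (2 ^ k * (4 * (δ ^ 4 / (2 ^ k) ^ 4))) := by ring
        _ ≤ 4 * (4 * δ ^ 4 * (1 / 2) ^ k) := by gcongr
        _ = _ := by ring
  · simp [hk]

/-- All line searches of one call of the subroutine are run with accurate labels. -/
def CallGood {d : ℕ} (P : Problem d) (lab : ℕ → ℕ → Point d → ℕ → Bool) (δ lam α : ℝ) : Prop :=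
  ∀ l : ℕ, ∀ a : Fin (d - 1) → ℕ, (∀ i, a i ≤ gridSize α l) →
    LineGood (lineLabels lab α l a) (fun z => P.eta (gridPoint α l a, z)) (depthPrec lam α l)
      (depthConf d δ α l)

theorem gridPoint_prod_mem {d : ℕ} {α : ℝ} {l : ℕ} {a : Fin (d - 1) → ℕ}
    (ha : ∀ i, a i ≤ gridSize α l) {z : ℝ} (hz : z ∈ Set.Icc (0 : ℝ) 1) :
    (gridPoint α l a, z) ∈ cube d := ⟨gridPoint_mem α l ha, hz⟩

theorem depthConf_pos {d : ℕ} {δ : ℝ} (hδ : 0 < δ) (α : ℝ) (l : ℕ) : 0 < depthConf d δ α l := by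
  have : (0 : ℝ) < cellDegree α := by exact_mod_cast cellDegree_pos α
  rw [depthConf]; positivity

theorem depthConf_le {d : ℕ} {δ : ℝ} (hδ : 0 < δ) (α : ℝ) (l : ℕ) :
    depthConf d δ α l ≤ δ / 2 ^ (l * (d + 1)) := by
  have : (1 : ℝ) ≤ cellDegree α := by exact_mod_cast cellDegree_pos α
  rw [depthConf]
  gcongr
  exact le_mul_of_one_le_left (by positivity) this

/-- Depth l has at most (2 · `cellDegree α` · 2^l)^(d-1) lines, and δ_l^4 ≤ δ^4 2^(-4l(d+1)) makes
the sum over l converge. The power of `cellDegree α` remains and is later absorbed by ⌊log n⌋. -/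
theorem measure_not_callGood_le {d : ℕ} {P : Problem d} {Y : Request d → Ω → Bool}
    (hY : IsLabelOracle P μ Y) (i : ℕ) {δ lam α : ℝ} (hδ : 0 < δ) (hδ1 : δ ≤ 1) :
    μ {ω | ¬ CallGood P (fun l k x s => Y ⟨i, l, k, s, x⟩ ω) δ lam α} ≤
      ENNReal.ofReal (64 * (2 * cellDegree α : ℝ) ^ (d - 1) * δ ^ 4) := by
  have hD : (1 : ℝ) ≤ cellDegree α := by exact_mod_cast cellDegree_pos α
  have hss : {ω | ¬ CallGood P (fun l k x s => Y ⟨i, l, k, s, x⟩ ω) δ lam α} ⊆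
      ⋃ l : ℕ, ⋃ a ∈ Fintype.piFinset fun _ : Fin (d - 1) => Finset.range (gridSize α l + 1),
        {ω | ¬ LineGood (fun k z s => Y ⟨i, l, k, s, (gridPoint α l a, z)⟩ ω)
          (fun z => P.eta (gridPoint α l a, z)) (depthPrec lam α l) (depthConf d δ α l)} := by
    intro ω hω
    simp only [CallGood, Set.mem_ofPred_eq, not_forall] at hω
    obtain ⟨l, a, ha, hne⟩ := hω
    simp only [Set.mem_iUnion]
    exact ⟨l, a, Fintype.mem_piFinset.mpr fun i => Finset.mem_range.mpr (Nat.lt_succ_of_le (ha i)),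
      hne⟩
  refine (measure_mono hss).trans ?_
  refine (measure_iUnion_le_ofReal
    (b := fun l : ℕ => 32 * (2 * cellDegree α : ℝ) ^ (d - 1) * δ ^ 4 * (1 / 2) ^ l)
    (fun l => by positivity) (hasSum_geometric_two.mul_left _) fun l => ?_).trans
    (ENNReal.ofReal_le_ofReal (by linarith))
  have hconf := depthConf_le (d := d) hδ α l
  have hp : (1 : ℝ) ≤ 2 ^ (l * (d + 1)) := one_le_pow₀ (by norm_num)
  refine (measure_biUnion_finset_le_ofReal (b := 32 * (depthConf d δ α l) ^ 4)
    fun a ha => ?_).trans (ENNReal.ofReal_le_ofReal ?_)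
  · have ha' : ∀ i, a i ≤ gridSize α l := fun i =>
      Nat.lt_succ_iff.mp (Finset.mem_range.mp (Fintype.mem_piFinset.mp ha i))
    refine measure_not_lineGood_le (fun k z s => hY.measurable _) (fun k z => ?_)
      (fun z hz => P.eta_mem _ (gridPoint_prod_mem ha' hz))
      (fun k z hz s => hY.law _ (gridPoint_prod_mem ha' hz)) (depthConf_pos hδ α l) ?_
    · exact hY.indep.precomp (g := fun s : ℕ => (⟨i, l, k, s, (gridPoint α l a, z)⟩ : Request d))
        fun s s' h => by simpa using h
    · exact hconf.trans (by rw [div_le_one (by positivity)]; linarith)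
  · rw [Fintype.card_piFinset]
    simp only [Finset.card_range, Finset.prod_const, Finset.card_univ, Fintype.card_fin, Nat.cast_pow]
    have h1 : ((gridSize α l + 1 : ℕ) : ℝ) ≤ 2 * cellDegree α * 2 ^ l := by
      have : 1 ≤ gridSize α l := gridSize_pos α l
      have h2 : gridSize α l + 1 ≤ 2 * (cellDegree α * 2 ^ l) := by
        have : gridSize α l = cellDegree α * 2 ^ l := rfl
        omega
      rw [mul_assoc]
      exact_mod_cast h2
    have h3 : ((2 : ℝ) ^ l) ^ (d - 1) * (δ / 2 ^ (l * (d + 1))) ^ 4 ≤ δ ^ 4 * (1 / 2) ^ l := by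
      rw [div_pow, one_div, inv_pow, ← pow_mul, mul_div_assoc', mul_comm ((2 : ℝ) ^ (l * (d - 1))),
        mul_div_assoc]
      gcongr
      rw [div_le_iff₀ (by positivity), inv_mul_eq_div, le_div_iff₀ (by positivity), ← pow_add,
        ← pow_mul]
      refine pow_le_pow_right₀ (by norm_num) ?_
      have : d - 1 ≤ d := Nat.sub_le _ _
      nlinarith [Nat.mul_le_mul_left l this]
    calc ((gridSize α l + 1 : ℕ) : ℝ) ^ (d - 1) * (32 * depthConf d δ α l ^ 4)
        ≤ (2 * cellDegree α * 2 ^ l) ^ (d - 1) * (32 * (δ / 2 ^ (l * (d + 1))) ^ 4) := by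
          have := depthConf_pos (d := d) hδ α l
          gcongr
      _ = 32 * (2 * cellDegree α) ^ (d - 1) * ((2 ^ l) ^ (d - 1) * (δ / 2 ^ (l * (d + 1))) ^ 4) := by
          rw [mul_pow]; ring
      _ ≤ 32 * (2 * cellDegree α) ^ (d - 1) * (δ ^ 4 * (1 / 2) ^ l) := by gcongr
      _ = _ := by ring

theorem cellDegree_mono {α α' : ℝ} (h : α' ≤ α) : cellDegree α' ≤ cellDegree α := by
  have := Nat.ceil_mono h
  simp only [cellDegree, strictFloor]
  omega

/-- All calls of the subroutine whose smoothness parameter is at most `α` are run with accurate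
labels. -/
def AllGood {d : ℕ} (P : Problem d) (lab : Request d → Bool) (n : ℕ) (δ lam α : ℝ) : Prop :=
  ∀ i : ℕ, 1 ≤ i → i ≤ logFloor n ^ 2 → (i : ℝ) / logFloor n ≤ α →
    CallGood P (fun l k x s => lab ⟨i, l, k, s, x⟩) (δ / (logFloor n : ℝ) ^ 2) lam
      ((i : ℝ) / logFloor n)

/-- The restriction to parameters at most α bounds `cellDegree` by a quantity independent of n,
which `hn` compares with L = ⌊log n⌋. At most L² calls then contribute L² · L · (δ/L²)^4 = δ^4/L^5.
-/
theorem measure_not_allGood_le {d : ℕ} {P : Problem d} {Y : Request d → Ω → Bool}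
    (hY : IsLabelOracle P μ Y) {n : ℕ} {δ lam α : ℝ} (hδ : 0 < δ) (hδ1 : δ ≤ 1)
    (hn : 64 * (2 * cellDegree α : ℝ) ^ (d - 1) ≤ logFloor n) :
    μ {ω | ¬ AllGood P (fun r => Y r ω) n δ lam α} ≤ ENNReal.ofReal δ := by
  have hD : (1 : ℝ) ≤ cellDegree α := by exact_mod_cast cellDegree_pos α
  have hL : (1 : ℝ) ≤ logFloor n := by
    refine le_trans ?_ hn
    have : (1 : ℝ) ≤ (2 * cellDegree α : ℝ) ^ (d - 1) := one_le_pow₀ (by linarith)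
    linarith
  have hL2 : (1 : ℝ) ≤ (logFloor n : ℝ) ^ 2 := one_le_pow₀ hL
  have hss : {ω | ¬ AllGood P (fun r => Y r ω) n δ lam α} ⊆
      ⋃ i ∈ (Finset.Icc 1 (logFloor n ^ 2)).filter fun i : ℕ => (i : ℝ) / logFloor n ≤ α,
        {ω | ¬ CallGood P (fun l k x s => Y ⟨i, l, k, s, x⟩ ω) (δ / (logFloor n : ℝ) ^ 2) lam
          ((i : ℝ) / logFloor n)} := by
    intro ω hω
    simp only [AllGood, Set.mem_ofPred_eq, not_forall] at hω
    obtain ⟨i, h1, h2, h3, hne⟩ := hω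
    simp only [Set.mem_iUnion]
    exact ⟨i, Finset.mem_filter.mpr ⟨Finset.mem_Icc.mpr ⟨h1, h2⟩, h3⟩, hne⟩
  refine (measure_mono hss).trans ((measure_biUnion_finset_le_ofReal
    (b := 64 * (2 * cellDegree α : ℝ) ^ (d - 1) * (δ / (logFloor n : ℝ) ^ 2) ^ 4)
    fun i hi => ?_).trans (ENNReal.ofReal_le_ofReal ?_))
  · refine (measure_not_callGood_le hY i (by positivity) ?_).trans (ENNReal.ofReal_le_ofReal ?_)
    · rw [div_le_one (by positivity)]; linarith
    · have : (cellDegree ((i : ℝ) / logFloor n) : ℝ) ≤ cellDegree α := by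
        exact_mod_cast cellDegree_mono (Finset.mem_filter.mp hi).2
      gcongr
  · have hcard : ((Finset.Icc 1 (logFloor n ^ 2)).filter
        fun i : ℕ => (i : ℝ) / logFloor n ≤ α).card ≤ logFloor n ^ 2 := by
      refine (Finset.card_filter_le _ _).trans ?_
      simp
    have hcard' : (((Finset.Icc 1 (logFloor n ^ 2)).filter
        fun i : ℕ => (i : ℝ) / logFloor n ≤ α).card : ℝ) ≤ (logFloor n : ℝ) ^ 2 := by
      exact_mod_cast hcard
    have hδ4 : δ ^ 4 ≤ δ := by
      calc δ ^ 4 ≤ δ ^ 1 := pow_le_pow_of_le_one hδ.le hδ1 (by norm_num)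
        _ = δ := pow_one δ
    calc _ ≤ (logFloor n : ℝ) ^ 2 * (logFloor n * (δ / (logFloor n : ℝ) ^ 2) ^ 4) := by gcongr
      _ = δ ^ 4 / (logFloor n : ℝ) ^ 5 := by
        have : (logFloor n : ℝ) ≠ 0 := by linarith
        field_simp
      _ ≤ δ ^ 4 := div_le_self (by positivity) (one_le_pow₀ hL)
      _ ≤ δ := hδ4

end

/-! ### Excess risk -/

section

variable {d : ℕ} (P : Problem d)

theorem Problem.ae_mem_cube : ∀ᵐ x ∂P.PX, x ∈ cube d := by
  rw [ae_iff]; exact P.supported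

/-- The conditional risk of the classifier `f`. -/
def Problem.loss (f : Point d → Bool) (x : Point d) : ℝ := if f x then 1 - P.eta x else P.eta x

theorem Problem.measurable_loss {f : Point d → Bool} (hf : Measurable f) :
    Measurable (P.loss f) := by
  refine Measurable.ite (hf (measurableSet_singleton true)) ?_ P.eta_measurable
  exact measurable_const.sub P.eta_measurable

theorem Problem.loss_mem {f : Point d → Bool} {x : Point d} (hx : x ∈ cube d) :
    P.loss f x ∈ Set.Icc (0 : ℝ) 1 := by
  have := P.eta_mem x hx
  rw [Problem.loss]
  split_ifs <;> constructor <;> linarith [this.1, this.2]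

theorem Problem.integrable_loss {f : Point d → Bool} (hf : Measurable f) :
    Integrable (P.loss f) P.PX := by
  have := P.isProb
  exact Integrable.of_mem_Icc 0 1 (P.measurable_loss hf).aemeasurable
    (P.ae_mem_cube.mono fun x hx => P.loss_mem hx)

/-- The label 1 is an error exactly where f = 0 and the label 0 exactly where f = 1, so the two
parts of the joint law contribute η and 1 - η on complementary sets. -/
theorem Problem.risk_eq {f : Point d → Bool} (hf : Measurable f) :
    P.risk f = ∫ x, P.loss f x ∂P.PX := by
  have h1 : MeasurableSet {p : Point d × Bool | p.2 ≠ f p.1} :=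
    (measurableSet_eq_fun measurable_snd (hf.comp measurable_fst)).compl
  have ht : MeasurableSet {x | f x = true} := hf (measurableSet_singleton true)
  have hmt : Measurable fun x : Point d => (x, true) := measurable_id.prodMk measurable_const
  have hmf : Measurable fun x : Point d => (x, false) := measurable_id.prodMk measurable_const
  have e1 : (fun x : Point d => (x, true)) ⁻¹' {p | p.2 ≠ f p.1} = {x | f x = true}ᶜ := by
    ext x; cases h : f x <;> simp [h]
  have e2 : (fun x : Point d => (x, false)) ⁻¹' {p | p.2 ≠ f p.1} = {x | f x = true} := by
    ext x; cases h : f x <;> simp [h]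
  rw [integral_eq_lintegral_of_nonneg_ae
    (P.ae_mem_cube.mono fun x hx => (P.loss_mem hx).1)
    (P.measurable_loss hf).aestronglyMeasurable, Problem.risk, Problem.joint]
  congr 1
  rw [Measure.add_apply, Measure.map_apply hmt h1, Measure.map_apply hmf h1, e1, e2,
    withDensity_apply _ ht.compl, withDensity_apply _ ht, add_comm,
    ← lintegral_add_compl (fun x => ENNReal.ofReal (P.loss f x)) ht]
  congr 1
  · refine setLIntegral_congr_fun ht fun x hx => ?_
    have hx' : f x = true := hx
    simp [Problem.loss, hx']
  · refine setLIntegral_congr_fun ht.compl fun x hx => ?_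
    have hx' : ¬ f x = true := hx
    simp [Problem.loss, hx']

theorem Problem.measurable_bayes : Measurable P.bayes := by
  refine measurable_to_bool ?_
  have : P.bayes ⁻¹' {true} = {x | 1 / 2 ≤ P.eta x} := by
    ext x; simp [Problem.bayes]
  rw [this]
  exact measurableSet_le measurable_const P.eta_measurable

theorem Problem.integrable_margin : Integrable (fun x => |1 - 2 * P.eta x|) P.PX := by
  have := P.isProb
  refine Integrable.of_mem_Icc 0 1 ?_ (P.ae_mem_cube.mono fun x hx => ⟨abs_nonneg _, ?_⟩)
  · exact (continuous_abs.measurable.comp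
      (measurable_const.sub (P.eta_measurable.const_mul 2))).aemeasurable
  · have := P.eta_mem x hx
    rw [abs_le]; constructor <;> linarith [this.1, this.2]

/-- Pointwise, the loss exceeds the Bayes loss by |1 - 2η| where the classifiers disagree and by 0
elsewhere. Only the inclusion into S matters, so S needs no measurability. -/
theorem Problem.excessRisk_le {f : Point d → Bool} (hf : Measurable f) {S : Set (Point d)}
    (hS : ∀ x ∈ cube d, f x ≠ P.bayes x → x ∈ S) :
    P.excessRisk f ≤ ∫ x in S, |1 - 2 * P.eta x| ∂P.PX := by
  have hD : MeasurableSet {x | f x ≠ P.bayes x} :=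
    (measurableSet_eq_fun hf P.measurable_bayes).compl
  rw [Problem.excessRisk, P.risk_eq hf, P.risk_eq P.measurable_bayes,
    ← integral_sub (P.integrable_loss hf) (P.integrable_loss P.measurable_bayes)]
  have : (fun x => P.loss f x - P.loss P.bayes x) =
      Set.indicator {x | f x ≠ P.bayes x} fun x => |1 - 2 * P.eta x| := by
    ext x
    by_cases h : 1 / 2 ≤ P.eta x
    · have hb : P.bayes x = true := decide_eq_true h
      cases hfx : f x
      · simp [Problem.loss, hb, hfx]
        rw [abs_of_nonpos (by linarith)]; ring
      · simp [Problem.loss, hb, hfx]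
    · have hb : P.bayes x = false := decide_eq_false h
      cases hfx : f x
      · simp [Problem.loss, hb, hfx]
      · simp [Problem.loss, hb, hfx]
        rw [abs_of_nonneg (by linarith)]; ring
  rw [this, integral_indicator hD]
  refine setIntegral_mono_set P.integrable_margin.integrableOn
    (Filter.Eventually.of_forall fun x => abs_nonneg _) ?_
  exact P.ae_mem_cube.mono fun x hx h => hS x hx h

end

/-! ### Measurability of the labeled sets -/

section

variable {X : Type*} [MeasurableSpace X]

/-- A measurable set whose slices have their frontiers on the graphs of countably many measurable
functions. -/
def RegularSlices (A : Set (X × ℝ)) : Prop :=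
  MeasurableSet A ∧ ∃ F : Set (X → ℝ), F.Countable ∧ (∀ τ ∈ F, Measurable τ) ∧
    ∀ x, ∀ z ∈ frontier {z | (x, z) ∈ A}, ∃ τ ∈ F, τ x = z

namespace RegularSlices

variable {A B : Set (X × ℝ)}

theorem compl (hA : RegularSlices A) : RegularSlices Aᶜ := by
  obtain ⟨hm, F, hF, hFm, h⟩ := hA
  refine ⟨hm.compl, F, hF, hFm, fun x z hz => h x z ?_⟩
  rw [← frontier_compl]
  exact hz

theorem inter (hA : RegularSlices A) (hB : RegularSlices B) : RegularSlices (A ∩ B) := by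
  obtain ⟨hm, F, hF, hFm, h⟩ := hA
  obtain ⟨hm', F', hF', hFm', h'⟩ := hB
  refine ⟨hm.inter hm', F ∪ F', hF.union hF', fun τ hτ => hτ.elim (hFm τ) (hFm' τ),
    fun x z hz => ?_⟩
  rcases frontier_inter_subset {z | (x, z) ∈ A} {z | (x, z) ∈ B} hz with h1 | h1
  · obtain ⟨τ, hτ, e⟩ := h x z h1.1
    exact ⟨τ, Or.inl hτ, e⟩
  · obtain ⟨τ, hτ, e⟩ := h' x z h1.2
    exact ⟨τ, Or.inr hτ, e⟩

theorem union (hA : RegularSlices A) (hB : RegularSlices B) : RegularSlices (A ∪ B) := by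
  have := (hA.compl.inter hB.compl).compl
  rwa [← Set.compl_union, compl_compl] at this

theorem diff (hA : RegularSlices A) (hB : RegularSlices B) : RegularSlices (A \ B) :=
  hA.inter hB.compl

theorem of_fst {S : Set X} (hS : MeasurableSet S) : RegularSlices {p : X × ℝ | p.1 ∈ S} := by
  refine ⟨measurable_fst hS, ∅, Set.countable_empty, by simp, fun x z hz => ?_⟩
  by_cases h : x ∈ S <;> simp [h] at hz

theorem empty : RegularSlices (∅ : Set (X × ℝ)) := by
  simpa using of_fst (MeasurableSet.empty (α := X))

theorem le_snd {a : X → ℝ} (ha : Measurable a) : RegularSlices {p : X × ℝ | a p.1 ≤ p.2} := by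
  refine ⟨measurableSet_le (ha.comp measurable_fst) measurable_snd, {a}, Set.countable_singleton a,
    by simpa using ha, fun x z hz => ⟨a, rfl, ?_⟩⟩
  have : {z | (x, z) ∈ {p : X × ℝ | a p.1 ≤ p.2}} = Set.Ici (a x) := rfl
  rw [this, frontier_Ici] at hz
  exact hz.symm

theorem snd_le {a : X → ℝ} (ha : Measurable a) : RegularSlices {p : X × ℝ | p.2 ≤ a p.1} := by
  refine ⟨measurableSet_le measurable_snd (ha.comp measurable_fst), {a}, Set.countable_singleton a,
    by simpa using ha, fun x z hz => ⟨a, rfl, ?_⟩⟩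
  have : {z | (x, z) ∈ {p : X × ℝ | p.2 ≤ a p.1}} = Set.Iic (a x) := rfl
  rw [this, frontier_Iic] at hz
  exact hz.symm

/-- A projection of a measurable set need not be measurable. Here a witness z interior to its slice
can be replaced by a rational, and a witness on the frontier lies on one of countably many
measurable graphs, so a countable union of measurable sets suffices. -/
theorem measurableSet_exists_lt (hA : RegularSlices A) (q : ℝ) :
    MeasurableSet {x | ∃ z, (x, z) ∈ A ∧ z < q} := by
  obtain ⟨hm, F, hF, hFm, h⟩ := hA
  have : {x | ∃ z, (x, z) ∈ A ∧ z < q} =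
      (⋃ r : ℚ, {x | (x, (r : ℝ)) ∈ A ∧ (r : ℝ) < q}) ∪ ⋃ τ ∈ F, {x | (x, τ x) ∈ A ∧ τ x < q} := by
    ext x
    simp only [Set.mem_ofPred_eq, Set.mem_union, Set.mem_iUnion]
    constructor
    · rintro ⟨z, hz, hzq⟩
      by_cases hfr : z ∈ frontier {z | (x, z) ∈ A}
      · obtain ⟨τ, hτ, e⟩ := h x z hfr
        exact Or.inr ⟨τ, hτ, by rwa [e], by rwa [e]⟩
      · left
        have hint : z ∈ interior {z | (x, z) ∈ A} := by
          by_contra hcon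
          exact hfr ⟨subset_closure hz, hcon⟩
        have hopen : IsOpen (interior {z | (x, z) ∈ A} ∩ Set.Iio q) :=
          isOpen_interior.inter isOpen_Iio
        obtain ⟨y, ⟨hy1, hy2⟩, r, rfl⟩ :=
          Rat.denseRange_cast.inter_open_nonempty _ hopen ⟨z, hint, hzq⟩
        exact ⟨r, interior_subset (s := {z | (x, z) ∈ A}) hy1, hy2⟩
    · rintro (⟨r, h1, h2⟩ | ⟨τ, -, h1, h2⟩)
      · exact ⟨r, h1, h2⟩
      · exact ⟨τ x, h1, h2⟩
  rw [this]
  refine (MeasurableSet.iUnion fun r => ?_).union (MeasurableSet.biUnion hF fun τ hτ => ?_)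
  · exact ((measurable_id.prodMk measurable_const) hm).inter (MeasurableSet.const _)
  · exact ((measurable_id.prodMk (hFm τ hτ)) hm).inter
      (measurableSet_lt (hFm τ hτ) measurable_const)

theorem measurable_sInf_insert (hA : RegularSlices A) {b : ℝ} (hb : ∀ x z, (x, z) ∈ A → b ≤ z)
    (c : ℝ) : Measurable fun x => sInf (insert c {z : ℝ | (x, z) ∈ A}) := by
  refine measurable_of_Iio fun q => ?_
  have : (fun x => sInf (insert c {z : ℝ | (x, z) ∈ A})) ⁻¹' Set.Iio q =
      {_x | c < q} ∪ {x | ∃ z, (x, z) ∈ A ∧ z < q} := by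
    ext x
    simp only [Set.mem_preimage, Set.mem_Iio, Set.mem_union, Set.mem_ofPred_eq]
    have hbd : BddBelow {z : ℝ | (x, z) ∈ A} := ⟨b, fun z hz => hb x z hz⟩
    rw [csInf_lt_iff (hbd.insert c) (Set.insert_nonempty _ _)]
    simp
  rw [this]
  exact (MeasurableSet.const _).union (hA.measurableSet_exists_lt q)

end RegularSlices

end

section

variable {d : ℕ}

theorem measurableSet_baseCube : MeasurableSet (baseCube d) := measurableSet_Icc

theorem regularSlices_cube : RegularSlices (cube d) := by
  have h := ((RegularSlices.of_fst (measurableSet_baseCube (d := d))).inter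
    (RegularSlices.le_snd (measurable_const (a := (0 : ℝ))))).inter
    (RegularSlices.snd_le (measurable_const (a := (1 : ℝ))))
  convert h using 1
  ext x
  simp [cube, and_assoc]

theorem measurable_interp (T : (Fin (d - 1) → ℕ) → ℝ) (α : ℝ) (l : ℕ) :
    Measurable (interp T α l) := by
  have hcell : ∀ i : Fin (d - 1), Measurable fun x : Fin (d - 1) → ℝ => cellIndex l x i := by
    intro i
    exact (Nat.measurable_floor.comp ((measurable_pi_apply i).mul_const _)).min measurable_const
  have hnode : ∀ (i : Fin (d - 1)) (j : ℕ), Measurable fun x : Fin (d - 1) → ℝ =>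
      cellDegree α * cellIndex l x i + j := fun i j =>
    (measurable_from_top (f := fun q : ℕ => cellDegree α * q + j)).comp (hcell i)
  have hcast : ∀ (i : Fin (d - 1)) (j : ℕ), Measurable fun x : Fin (d - 1) → ℝ =>
      ((cellDegree α * cellIndex l x i + j : ℕ) : ℝ) / gridSize α l := fun i j =>
    ((measurable_from_top (f := fun q : ℕ => (q : ℝ))).comp (hnode i j)).div_const _
  unfold interp
  refine Finset.measurable_sum _ fun j _ => Measurable.mul ?_ ?_
  · exact (Measurable.of_discrete (f := T)).comp (measurable_pi_lambda _ fun i => hnode i (j i))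
  · refine Finset.measurable_prod _ fun i _ => Finset.measurable_prod _ fun j' _ => ?_
    exact ((measurable_pi_apply i).sub (hcast i j')).div ((hcast i (j i)).sub (hcast i j'))

theorem regularSlices_subroutine (lab : ℕ → ℕ → Point d → ℕ → Bool) (n : ℕ) (δ lam α : ℝ) :
    RegularSlices (subroutine lab n δ lam α).1 ∧ RegularSlices (subroutine lab n δ lam α).2 := by
  have hP := measurable_interp (d := d) (threshold lab δ lam α (lastDepth lab n δ lam α)) α
    (lastDepth lab n δ lam α)
  simp only [subroutine]
  by_cases hl : 1 ≤ lastDepth lab n δ lam α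
  · simp only [hl, true_and]
    exact ⟨regularSlices_cube.inter (RegularSlices.snd_le (hP.sub_const _)),
      regularSlices_cube.inter (RegularSlices.le_snd (hP.add_const _))⟩
  · simp only [hl, false_and, and_false, Set.ofPred_false]
    exact ⟨RegularSlices.empty, RegularSlices.empty⟩

variable (lab : Request d → Bool) (n : ℕ) (δ lam : ℝ)

theorem regularSlices_aggregate (i : ℕ) :
    RegularSlices (aggregate lab n δ lam i).1 ∧ RegularSlices (aggregate lab n δ lam i).2 := by
  induction i with
  | zero => exact ⟨RegularSlices.empty, RegularSlices.empty⟩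
  | succ i ih =>
    have hS : RegularSlices (call lab n δ lam (i + 1)).1 ∧
      RegularSlices (call lab n δ lam (i + 1)).2 := regularSlices_subroutine _ _ _ _ _
    exact ⟨ih.1.union (hS.1.diff ih.2), ih.2.union (hS.2.diff ih.1)⟩

theorem call_subset_cube (i : ℕ) :
    (call lab n δ lam i).1 ⊆ cube d ∧ (call lab n δ lam i).2 ⊆ cube d :=
  ⟨fun _ hx => hx.1, fun _ hx => hx.1⟩

theorem aggregate_subset_cube (i : ℕ) : (aggregate lab n δ lam i).2 ⊆ cube d := by
  induction i with
  | zero => exact Set.empty_subset _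
  | succ i ih =>
    exact Set.union_subset ih (Set.sdiff_subset.trans (call_subset_cube lab n δ lam (i + 1)).2)

theorem labeledOne_subset_cube : labeledOne lab n δ lam ⊆ cube d := aggregate_subset_cube _ _ _ _ _

theorem measurable_classifier : Measurable (classifier lab n δ lam) := by
  refine measurable_to_bool ?_
  have hg : Measurable (boundaryEstimate lab n δ lam) :=
    (regularSlices_aggregate lab n δ lam (logFloor n ^ 2)).2.measurable_sInf_insert (b := 0)
      (fun x z h => (labeledOne_subset_cube lab n δ lam h).2.1) 1
  have : classifier lab n δ lam ⁻¹' {true} = {x | boundaryEstimate lab n δ lam x.1 ≤ x.2} := by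
    ext x; simp [classifier]
  rw [this]
  exact measurableSet_le (hg.comp measurable_fst) measurable_snd

theorem measurable_setClassifier : Measurable (setClassifier lab n δ lam) := by
  refine measurable_to_bool ?_
  have : setClassifier lab n δ lam ⁻¹' {true} = labeledOne lab n δ lam := by
    ext x; simp [setClassifier]
  rw [this]
  exact (regularSlices_aggregate lab n δ lam (logFloor n ^ 2)).2.1

/-! ### Aggregation -/

/-- Both labels assigned by a call are correct, relative to the boundary `g`. -/
def CorrectLabels (g : (Fin (d - 1) → ℝ) → ℝ) (S : Set (Point d) × Set (Point d)) : Prop :=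
  (∀ x ∈ S.1, x.2 < g x.1) ∧ ∀ x ∈ S.2, g x.1 ≤ x.2

/-- Every point of the cube at distance at least `B` from the boundary gets the correct label. -/
def CoversBeyond (g : (Fin (d - 1) → ℝ) → ℝ) (B : ℝ) (S : Set (Point d) × Set (Point d)) : Prop :=
  (∀ x ∈ cube d, x.2 ≤ g x.1 - B → x ∈ S.1) ∧ ∀ x ∈ cube d, g x.1 + B ≤ x.2 → x ∈ S.2

variable {lab n δ lam} {g : (Fin (d - 1) → ℝ) → ℝ} {B : ℝ}

theorem correctLabels_aggregate {i₀ : ℕ}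
    (h : ∀ i, 1 ≤ i → i ≤ i₀ → CorrectLabels g (call lab n δ lam i)) (i : ℕ) (hi : i ≤ i₀) :
    CorrectLabels g (aggregate lab n δ lam i) := by
  induction i with
  | zero => exact ⟨fun x hx => hx.elim, fun x hx => hx.elim⟩
  | succ i ih =>
    have h1 := ih (by omega)
    have h2 := h (i + 1) (by omega) hi
    exact ⟨fun x hx => hx.elim (h1.1 x) fun hx => h2.1 x hx.1,
      fun x hx => hx.elim (h1.2 x) fun hx => h2.2 x hx.1⟩

/-- A far point cannot carry a wrong label before call i₀, since all calls so far are correct, so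
call i₀ gives it the right one. Afterwards the set difference in the update blocks the opposite
label, however wrong the later calls are. -/
theorem coversBeyond_aggregate (hB : 0 < B) {i₀ : ℕ} (hi₀ : 1 ≤ i₀)
    (h : ∀ i, 1 ≤ i → i ≤ i₀ → CorrectLabels g (call lab n δ lam i))
    (hc : CoversBeyond g B (call lab n δ lam i₀)) (i : ℕ) (hi : i₀ ≤ i) :
    CoversBeyond g B (aggregate lab n δ lam i) ∧
      ∀ x ∈ cube d, x.2 ≤ g x.1 - B → x ∉ (aggregate lab n δ lam i).2 := by
  induction i, hi using Nat.le_induction with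
  | base =>
    have hcor := correctLabels_aggregate h i₀ le_rfl
    refine ⟨?_, fun x hx hlow hx2 => by linarith [hcor.2 x hx2]⟩
    obtain ⟨j, rfl⟩ : ∃ j, i₀ = j + 1 := ⟨i₀ - 1, by omega⟩
    have hprev := correctLabels_aggregate h j (by omega)
    refine ⟨fun x hx hlow => ?_, fun x hx hhigh => ?_⟩
    · exact Or.inr ⟨hc.1 x hx hlow, fun hx2 => by linarith [hprev.2 x hx2]⟩
    · exact Or.inr ⟨hc.2 x hx hhigh, fun hx2 => by linarith [hprev.1 x hx2]⟩
  | succ i hi ih =>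
    refine ⟨⟨fun x hx hlow => Or.inl (ih.1.1 x hx hlow),
      fun x hx hhigh => Or.inl (ih.1.2 x hx hhigh)⟩, fun x hx hlow hx2 => ?_⟩
    rcases hx2 with hx2 | hx2
    · exact ih.2 x hx hlow hx2
    · exact hx2.2 (ih.1.1 x hx hlow)

/-- Above the band, x ∈ S¹ bounds the infimum from above. Below it, no point of the line at height g
- B or less is in S¹, so ĝ ≥ g - B > x_d. -/
theorem classifier_eq_bayes {P : Problem d} (hg : Set.MapsTo g (baseCube d) (Set.Icc 0 1))
    (hη : {x ∈ cube d | 1 / 2 ≤ P.eta x} = epi g) (hB : 0 < B) {i₀ : ℕ}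
    (hi₀ : 1 ≤ i₀) (hi₁ : i₀ ≤ logFloor n ^ 2)
    (h : ∀ i, 1 ≤ i → i ≤ i₀ → CorrectLabels g (call lab n δ lam i))
    (hc : CoversBeyond g B (call lab n δ lam i₀)) {x : Point d} (hx : x ∈ cube d)
    (hfar : B < |x.2 - g x.1|) :
    classifier lab n δ lam x = P.bayes x ∧ setClassifier lab n δ lam x = P.bayes x := by
  obtain ⟨hcov, hnot⟩ := coversBeyond_aggregate hB hi₀ h hc _ hi₁
  have hbd : BddBelow (insert 1 {z : ℝ | (x.1, z) ∈ labeledOne lab n δ lam}) :=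
    BddBelow.insert 1 ⟨0, fun z hz => (labeledOne_subset_cube lab n δ lam hz).2.1⟩
  have hbayes : 1 / 2 ≤ P.eta x ↔ g x.1 ≤ x.2 := by
    have := Set.ext_iff.mp hη x
    simpa [epi, hx] using this
  simp only [classifier, setClassifier, Problem.bayes, decide_eq_decide, hbayes]
  rcases lt_abs.mp hfar with hf | hf
  · have hmem : x ∈ labeledOne lab n δ lam := hcov.2 x hx (by linarith)
    have hle : boundaryEstimate lab n δ lam x.1 ≤ x.2 := csInf_le hbd (Or.inr hmem)
    have : g x.1 ≤ x.2 := by linarith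
    simp [hmem, hle, this]
  · have hnmem : x ∉ labeledOne lab n δ lam := hnot x hx (by linarith)
    have hge : g x.1 - B ≤ boundaryEstimate lab n δ lam x.1 := by
      refine le_csInf (Set.insert_nonempty _ _) fun z hz => ?_
      -- The inserted value 1 respects the lower bound because g ≤ 1.
      rcases hz with rfl | hz
      · linarith [(hg hx.1).2]
      · by_contra hcon
        exact hnot (x.1, z) (labeledOne_subset_cube lab n δ lam hz) (le_of_lt (not_le.mp hcon)) hz
    have hlt : ¬ boundaryEstimate lab n δ lam x.1 ≤ x.2 := by rw [not_le]; linarith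
    have : ¬ g x.1 ≤ x.2 := by rw [not_le]; linarith
    simp [hnmem, hlt, this]

end

/-! ### The subroutine: correctness -/

theorem HolderClass.mono {d : ℕ} {lam α α' : ℝ} {g : (Fin (d - 1) → ℝ) → ℝ}
    (hg : HolderClass lam α g) (h : α' ≤ α) : HolderClass lam α' g where
  mapsTo := hg.mapsTo
  contDiffOn := hg.contDiffOn.of_le (by
    have := Nat.sub_le_sub_right (Nat.ceil_mono h) 1
    exact_mod_cast this)
  taylor_bound β h0 h1 := hg.taylor_bound β h0 (h1.trans h)

theorem one_half_le_eta_iff {d : ℕ} {P : Problem d} {g : (Fin (d - 1) → ℝ) → ℝ}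
    (hη : {x ∈ cube d | 1 / 2 ≤ P.eta x} = epi g) {x : Point d} (hx : x ∈ cube d) :
    1 / 2 ≤ P.eta x ↔ g x.1 ≤ x.2 := by
  have := Set.ext_iff.mp hη x
  simpa [epi, hx] using this

theorem depthPrec_pos {lam : ℝ} (hlam : 0 < lam) (α : ℝ) (l : ℕ) : 0 < depthPrec lam α l := by
  rw [depthPrec]; positivity

section

variable {d : ℕ} {P : Problem d} {g : (Fin (d - 1) → ℝ) → ℝ}
  {lab : ℕ → ℕ → Point d → ℕ → Bool} {n : ℕ} {δ lam α : ℝ}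

/-- Searches with K ≤ 1 have no epoch and request no label; K ≥ 2 holds as soon as ε_l < 1/4. -/
theorem eventually_two_le_searchDepth (hlam : 0 < lam) (hα : 0 < α) :
    ∃ l₀ : ℕ, ∀ l, l₀ ≤ l → 2 ≤ searchDepth (depthPrec lam α l) := by
  have hr : (2 : ℝ) ^ (-α) < 1 := Real.rpow_lt_one_of_one_lt_of_neg (by norm_num) (by linarith)
  have hr0 : (0 : ℝ) < 2 ^ (-α) := by positivity
  obtain ⟨l₀, hl₀⟩ := exists_pow_lt_of_lt_one (show 0 < 1 / (4 * lam) by positivity) hr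
  refine ⟨l₀, fun l hl => ?_⟩
  have h1 : ((2 : ℝ) ^ (-α)) ^ l < 1 / (4 * lam) :=
    (pow_le_pow_of_le_one hr0.le hr.le hl).trans_lt hl₀
  have h2 : depthPrec lam α l = lam * ((2 : ℝ) ^ (-α)) ^ l := by
    rw [depthPrec, ← Real.rpow_natCast, ← Real.rpow_mul (by norm_num)]
    ring_nf
  have hε : depthPrec lam α l < 1 / 4 := by
    rw [h2]
    rw [lt_div_iff₀ (by positivity)] at h1
    linarith
  have hε0 := depthPrec_pos hlam α l
  rw [searchDepth]
  refine Nat.succ_le_of_lt (Nat.lt_ceil.mpr ?_)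
  rw [Real.lt_logb_iff_rpow_lt (by norm_num) (by positivity), lt_div_iff₀ (by positivity)]
  norm_num
  linarith

theorem one_le_depthCost {l : ℕ} (hl : 2 ≤ searchDepth (depthPrec lam α l)) :
    1 ≤ depthCost lab δ lam α l := by
  have hmem : (fun _ => 0) ∈ Fintype.piFinset fun _ : Fin (d - 1) =>
      Finset.range (gridSize α l + 1) := Fintype.mem_piFinset.mpr fun _ => by simp
  rw [depthCost]
  exact (one_le_searchCost (lab := lineLabels lab α l fun _ => 0) hl).trans
    (Finset.single_le_sum (f := fun a => searchCost (lineLabels lab α l a) (depthPrec lam α l)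
      (depthConf d δ α l)) (fun _ _ => zero_le) hmem)

/-- The supremum that defines l* is meaningful only for a bounded set. From some depth l₀ on every
depth costs at least one label, so at most about n further depths can be completed. -/
theorem bddAbove_completedDepths (hlam : 0 < lam) (hα : 0 < α) :
    BddAbove {l : ℕ | ∑ j ∈ Finset.Icc 1 l, depthCost lab δ lam α j ≤ (n : ℕ∞)} := by
  obtain ⟨l₀, hl₀⟩ := eventually_two_le_searchDepth hlam hα
  refine ⟨l₀ + n, fun l hl => ?_⟩
  have hl : ∑ j ∈ Finset.Icc 1 l, depthCost lab δ lam α j ≤ (n : ℕ∞) := hl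
  have h1 : ∑ j ∈ Finset.Icc (l₀ + 1) l, (1 : ℕ∞) ≤ ∑ j ∈ Finset.Icc 1 l, depthCost lab δ lam α j :=
    (Finset.sum_le_sum fun j hj => one_le_depthCost (hl₀ j (by
      have := (Finset.mem_Icc.mp hj).1; omega))).trans
      (Finset.sum_le_sum_of_subset (Finset.Icc_subset_Icc_left (by omega)))
  have h2 := h1.trans hl
  simp only [Finset.sum_const, Nat.card_Icc, nsmul_eq_mul, mul_one] at h2
  have h3 : l + 1 - (l₀ + 1) ≤ n := by exact_mod_cast h2
  omega

theorem lastDepth_mem (hlam : 0 < lam) (hα : 0 < α) :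
    ∑ j ∈ Finset.Icc 1 (lastDepth lab n δ lam α), depthCost lab δ lam α j ≤ (n : ℕ∞) :=
  Nat.sSup_mem (s := {l : ℕ | ∑ j ∈ Finset.Icc 1 l, depthCost lab δ lam α j ≤ (n : ℕ∞)})
    ⟨0, by simp⟩ (bddAbove_completedDepths hlam hα)

theorem le_lastDepth (hlam : 0 < lam) (hα : 0 < α) {l : ℕ}
    (hl : ∑ j ∈ Finset.Icc 1 l, depthCost lab δ lam α j ≤ (n : ℕ∞)) :
    l ≤ lastDepth lab n δ lam α :=
  le_csSup (bddAbove_completedDepths hlam hα) hl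

theorem searchCost_lastDepth_ne_top (hlam : 0 < lam) (hα : 0 < α)
    (hl : 1 ≤ lastDepth lab n δ lam α) {a : Fin (d - 1) → ℕ}
    (ha : ∀ i, a i ≤ gridSize α (lastDepth lab n δ lam α)) :
    searchCost (lineLabels lab α (lastDepth lab n δ lam α) a)
      (depthPrec lam α (lastDepth lab n δ lam α))
      (depthConf d δ α (lastDepth lab n δ lam α)) ≠ ⊤ := by
  have h := lastDepth_mem (lab := lab) (n := n) (δ := δ) hlam hα
  set l := lastDepth lab n δ lam α
  have hmem : a ∈ Fintype.piFinset fun _ : Fin (d - 1) => Finset.range (gridSize α l + 1) :=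
    Fintype.mem_piFinset.mpr fun i => Finset.mem_range.mpr (Nat.lt_succ_of_le (ha i))
  have h1 : depthCost lab δ lam α l ≤ (n : ℕ∞) :=
    (Finset.single_le_sum (f := fun j => depthCost lab δ lam α j) (fun _ _ => zero_le)
      (Finset.mem_Icc.mpr ⟨hl, le_rfl⟩)).trans h
  have h2 := (Finset.single_le_sum (f := fun a => searchCost (lineLabels lab α l a)
    (depthPrec lam α l) (depthConf d δ α l)) (fun _ _ => zero_le) hmem).trans h1
  exact ne_top_of_le_ne_top (ENat.natCast_ne_top n) h2

/-- The factor 3 collects 2ε_l from the line searches and ε_l from the Taylor remainder. -/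
theorem abs_interp_threshold_sub_le (hd : 1 ≤ d) (hlam : 0 < lam) (hα : 0 < α)
    (hg : HolderClass lam α g) (hη : {x ∈ cube d | 1 / 2 ≤ P.eta x} = epi g)
    (hgood : CallGood P lab δ lam α) (hl : 1 ≤ lastDepth lab n δ lam α)
    {x : Fin (d - 1) → ℝ} (hx : x ∈ baseCube d) :
    |interp (threshold lab δ lam α (lastDepth lab n δ lam α)) α (lastDepth lab n δ lam α) x - g x| ≤
      3 * biasTerm d lam α (lastDepth lab n δ lam α) := by
  have hcost := fun a ha => searchCost_lastDepth_ne_top (lab := lab) (n := n) (δ := δ) hlam hα hl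
    (a := a) ha
  set l := lastDepth lab n δ lam α
  have h1 := abs_interp_sub_le (l := l) (T := threshold lab δ lam α l) (e := 2 * depthPrec lam α l)
    hα hlam.le hg (fun a ha => abs_searchThreshold_sub_le (depthPrec_pos hlam α l) (hgood l a ha)
      (fun z hz => one_half_le_eta_iff hη (gridPoint_prod_mem ha hz))
      (hg.mapsTo (gridPoint_mem α l ha)) (hcost a ha)) hx
  refine h1.trans ?_
  have h2 := lebesgueBound_le_biasTerm hd hα hlam.le l
  rw [depthPrec]
  linarith

theorem correctLabels_subroutine (hd : 1 ≤ d) (hlam : 0 < lam) (hα : 0 < α)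
    (hg : HolderClass lam α g) (hη : {x ∈ cube d | 1 / 2 ≤ P.eta x} = epi g)
    (hgood : CallGood P lab δ lam α) : CorrectLabels g (subroutine lab n δ lam α) := by
  have hb := biasTerm_pos (d := d) hα hlam (lastDepth lab n δ lam α)
  refine ⟨fun x hx => ?_, fun x hx => ?_⟩
  · obtain ⟨hxc, hl, hxx⟩ := hx
    have := abs_le.mp (abs_interp_threshold_sub_le hd hlam hα hg hη hgood hl hxc.1)
    linarith [this.2]
  · obtain ⟨hxc, hl, hxx⟩ := hx
    have := abs_le.mp (abs_interp_threshold_sub_le hd hlam hα hg hη hgood hl hxc.1)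
    linarith [this.1]

/-- The 7 is the margin 4 of the labeled sets plus the error 3 of the interpolation. -/
theorem coversBeyond_subroutine (hd : 1 ≤ d) (hlam : 0 < lam) (hα : 0 < α)
    (hg : HolderClass lam α g) (hη : {x ∈ cube d | 1 / 2 ≤ P.eta x} = epi g)
    (hgood : CallGood P lab δ lam α) (hl : 1 ≤ lastDepth lab n δ lam α) {B : ℝ}
    (hB : 7 * biasTerm d lam α (lastDepth lab n δ lam α) ≤ B) :
    CoversBeyond g B (subroutine lab n δ lam α) := by
  refine ⟨fun x hx hlow => ⟨hx, hl, ?_⟩, fun x hx hhigh => ⟨hx, hl, ?_⟩⟩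
  · have := abs_le.mp (abs_interp_threshold_sub_le hd hlam hα hg hη hgood hl hx.1)
    linarith [this.1]
  · have := abs_le.mp (abs_interp_threshold_sub_le hd hlam hα hg hη hgood hl hx.1)
    linarith [this.2]

end

/-! ### The subroutine: number of labels -/

/-- The number of rounds of an epoch is at most this constant times a logarithm, relative to the
interval length. -/
def roundConst (c κ : ℝ) : ℝ := 8 * (c ^ 2)⁻¹ * 8 ^ (2 * (κ - 1)) + 1

/-- The number of labels of a line search is at most this constant times a logarithm, relative to
the precision. -/
def searchConst (c κ : ℝ) : ℝ := 3 * roundConst c κ / ((2 : ℝ) ^ (2 * (κ - 1)) - 1)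

section

variable {c κ : ℝ}

theorem one_le_roundConst : 1 ≤ roundConst c κ := by
  rw [roundConst]
  have : 0 ≤ 8 * (c ^ 2)⁻¹ * (8 : ℝ) ^ (2 * (κ - 1)) := by positivity
  linarith

theorem one_lt_two_rpow (hκ : 1 < κ) : 1 < (2 : ℝ) ^ (2 * (κ - 1)) :=
  Real.one_lt_rpow (by norm_num) (by linarith)

theorem searchConst_pos (hκ : 1 < κ) : 0 < searchConst c κ := by
  have := one_lt_two_rpow hκ
  have := one_le_roundConst (c := c) (κ := κ)
  exact div_pos (by linarith) (by linarith)

/-- The condition 4√(Λ/(2t)) ≤ A amounts to t ≥ 8Λ/A². Splitting off the bound Λ for the logarithm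
avoids an implicit inequality in t. -/
theorem two_mul_confRadius_le {δ A Λ : ℝ} {t : ℕ} (hA : 0 < A) (ht : 1 ≤ t)
    (hlog : Real.log (t / δ) ≤ Λ) (hΛ : 8 * Λ / A ^ 2 ≤ t) : 2 * confRadius δ t ≤ A := by
  have ht0 : (0 : ℝ) < t := by exact_mod_cast ht
  have h1 : Real.sqrt (Real.log (t / δ) / (2 * t)) ≤ A / 4 := by
    rw [Real.sqrt_le_left (by positivity), div_le_iff₀ (by positivity)]
    rw [div_le_iff₀ (by positivity)] at hΛ
    nlinarith
  rw [confRadius]; linarith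

/-- The number of rounds that suffice in the epoch `k + 1`. -/
def roundBound (c κ Λ : ℝ) (k : ℕ) : ℕ := ⌈8 * Λ / (c * (((2 : ℝ) ^ k)⁻¹ / 8) ^ (κ - 1)) ^ 2⌉₊

theorem roundBound_le (hc : 0 < c) {Λ : ℝ} (hκ : 1 < κ) (hΛ : 1 ≤ Λ) (k : ℕ) :
    (roundBound c κ Λ k : ℝ) ≤ Λ * roundConst c κ * ((2 : ℝ) ^ (2 * (κ - 1))) ^ k := by
  have hρ : 1 ≤ ((2 : ℝ) ^ (2 * (κ - 1))) ^ k := one_le_pow₀ (one_lt_two_rpow hκ).le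
  have h1 : 8 * Λ / (c * (((2 : ℝ) ^ k)⁻¹ / 8) ^ (κ - 1)) ^ 2 =
      Λ * (8 * (c ^ 2)⁻¹ * 8 ^ (2 * (κ - 1))) * ((2 : ℝ) ^ (2 * (κ - 1))) ^ k := by
    have e1 : ((((2 : ℝ) ^ k)⁻¹ / 8) ^ (κ - 1)) ^ 2 =
        (8 ^ (2 * (κ - 1)) * ((2 : ℝ) ^ (2 * (κ - 1))) ^ k)⁻¹ := by
      have e0 : ((2 : ℝ) ^ k)⁻¹ / 8 = (8 * 2 ^ k)⁻¹ := by rw [mul_inv]; ring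
      have e2 : ((8 * (2 : ℝ) ^ k) ^ (κ - 1)) ^ 2 = (8 * (2 : ℝ) ^ k) ^ (2 * (κ - 1)) := by
        rw [← Real.rpow_natCast, ← Real.rpow_mul (by positivity)]
        push_cast; ring_nf
      rw [e0, Real.inv_rpow (by positivity), inv_pow, e2, Real.rpow_pow_comm (by norm_num),
        Real.mul_rpow (by norm_num) (by positivity)]
    rw [mul_pow, e1]
    field_simp
  refine (Nat.ceil_lt_add_one (by positivity)).le.trans ?_
  rw [h1, roundConst]
  -- The 1 lost by rounding up is at most Λ times the geometric factor; it is the summand 1 in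
  -- `roundConst`.
  nlinarith [mul_le_mul hΛ hρ zero_le_one (by linarith)]

theorem two_pow_searchDepth_le {ε : ℝ} (hε : 0 < ε) (hK : 2 ≤ searchDepth ε) :
    (2 : ℝ) ^ searchDepth ε ≤ ε⁻¹ := by
  have h1 : ((searchDepth ε - 1 : ℕ) : ℝ) < Real.logb 2 (1 / (2 * ε)) := by
    apply Nat.lt_ceil.mp
    change searchDepth ε - 1 < searchDepth ε
    omega
  rw [Real.lt_logb_iff_rpow_lt (by norm_num) (by positivity), Real.rpow_natCast,
    lt_div_iff₀ (by positivity)] at h1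
  have h2 : (2 : ℝ) ^ searchDepth ε = 2 ^ (searchDepth ε - 1) * 2 := by
    rw [← pow_succ]; congr 1; omega
  rw [← one_div, le_div_iff₀ hε, h2]
  linarith

/-- Inside the logarithm, ε^(-2κ) splits into ε^(-2(κ-1)) for the number of rounds and ε^(-2) for
the factor K 2^(k+1) in 1/δ_(k+1). The last epochs dominate the geometric sum, so the total has the
order of one epoch at scale ε. -/
theorem searchCost_le_of_log_le {lab : ℕ → ℝ → ℕ → Bool} {h : ℝ → ℝ} {ε δ γ Λ : ℝ}
    (hκ : 1 < κ) (hc : 0 < c) (hε : 0 < ε) (hδ : 0 < δ) (hgood : LineGood lab h ε δ)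
    (hh : ∀ z ∈ Set.Icc (0 : ℝ) 1, 1 / 2 ≤ h z ↔ γ ≤ z) (hγ : γ ∈ Set.Icc (0 : ℝ) 1)
    (hnoise : ∀ z ∈ Set.Icc (0 : ℝ) 1, c * |z - γ| ^ (κ - 1) ≤ |h z - 1 / 2|) (hΛ : 1 ≤ Λ)
    (hlog : Real.log (Λ * roundConst c κ * ε⁻¹ ^ (2 * κ) / δ) ≤ Λ) :
    ∃ m : ℕ, searchCost lab ε δ ≤ (m : ℕ∞) ∧ (m : ℝ) ≤ searchConst c κ * Λ * ε⁻¹ ^ (2 * (κ - 1)) := by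
  have hA := one_le_roundConst (c := c) (κ := κ)
  have hρ := one_lt_two_rpow hκ
  have hpw : ∀ k, k ≤ searchDepth ε → 2 ≤ searchDepth ε →
      ((2 : ℝ) ^ (2 * (κ - 1))) ^ k ≤ ε⁻¹ ^ (2 * (κ - 1)) := by
    intro k hk hK
    rw [← Real.rpow_natCast, ← Real.rpow_mul (by norm_num), mul_comm, Real.rpow_mul (by norm_num),
      Real.rpow_natCast]
    refine Real.rpow_le_rpow (by positivity) ?_ (by linarith)
    exact (pow_le_pow_right₀ (by norm_num) hk).trans (two_pow_searchDepth_le hε hK)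
  refine ⟨∑ i ∈ Finset.range (searchDepth ε - 1), 3 * roundBound c κ Λ i,
    searchCost_le hκ.le hc.le hgood hh hγ hnoise fun k hk => ?_, ?_⟩
  · have hK2 := two_pow_searchDepth_le hε (by omega)
    have hK : (1 : ℝ) ≤ searchDepth ε := by exact_mod_cast (by omega : 1 ≤ searchDepth ε)
    have hApos : 0 < c * (((2 : ℝ) ^ k)⁻¹ / 8) ^ (κ - 1) := by positivity
    have ht : 1 ≤ roundBound c κ Λ k := Nat.ceil_pos.mpr (by positivity)
    have ht0 : (0 : ℝ) < roundBound c κ Λ k := by exact_mod_cast ht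
    refine ⟨ht, two_mul_confRadius_le hApos ht (le_trans (Real.log_le_log (by positivity) ?_) hlog)
      (Nat.le_ceil _)⟩
    have h1 : (roundBound c κ Λ k : ℝ) ≤ Λ * roundConst c κ * ε⁻¹ ^ (2 * (κ - 1)) :=
      (roundBound_le hc hκ hΛ k).trans (by
        have := hpw k (by omega) (by omega)
        gcongr)
    have h2 : (searchDepth ε : ℝ) * 2 ^ (k + 1) ≤ ε⁻¹ ^ (2 : ℝ) := by
      have e1 : (searchDepth ε : ℝ) ≤ 2 ^ searchDepth ε := by
        exact_mod_cast Nat.lt_two_pow_self.le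
      have e2 : (2 : ℝ) ^ (k + 1) ≤ 2 ^ searchDepth ε := pow_le_pow_right₀ (by norm_num) hk.le
      have e3 : ε⁻¹ ^ (2 : ℝ) = ε⁻¹ * ε⁻¹ := by
        rw [show (2 : ℝ) = ((2 : ℕ) : ℝ) by norm_num, Real.rpow_natCast, sq]
      rw [e3]
      exact mul_le_mul (e1.trans hK2) (e2.trans hK2) (by positivity) (by positivity)
    have h3 : ε⁻¹ ^ (2 * κ) = ε⁻¹ ^ (2 * (κ - 1)) * ε⁻¹ ^ (2 : ℝ) := by
      rw [← Real.rpow_add (by positivity)]; ring_nf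
    rw [div_div_eq_mul_div, h3, ← mul_assoc (Λ * roundConst c κ)]
    exact div_le_div_of_nonneg_right (mul_le_mul h1 h2 (by positivity) (by positivity)) hδ.le
  · push_cast
    rcases lt_or_ge (searchDepth ε) 2 with hK | hK
    · have : searchDepth ε - 1 = 0 := by omega
      rw [this, Finset.range_zero, Finset.sum_empty]
      have := searchConst_pos (c := c) hκ
      positivity
    · have h1 : ∀ i ∈ Finset.range (searchDepth ε - 1), 3 * (roundBound c κ Λ i : ℝ) ≤
          3 * (Λ * roundConst c κ) * ((2 : ℝ) ^ (2 * (κ - 1))) ^ i := fun i _ => by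
        have := roundBound_le (κ := κ) hc hκ hΛ i
        linarith
      refine (Finset.sum_le_sum h1).trans ?_
      rw [← Finset.mul_sum, geom_sum_eq hρ.ne', searchConst, mul_div_assoc', div_mul_eq_mul_div,
        div_mul_eq_mul_div]
      have h2 := hpw (searchDepth ε - 1) (by omega) hK
      refine div_le_div_of_nonneg_right ?_ (by linarith)
      have h3 : 0 ≤ 3 * (Λ * roundConst c κ) := by positivity
      nlinarith

end

section

variable {d : ℕ} {P : Problem d} {g : (Fin (d - 1) → ℝ) → ℝ}
  {lab : ℕ → ℕ → Point d → ℕ → Bool} {δ lam α c κ Λ : ℝ}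

/-- The constant in the bound for the number of labels requested up to some depth. -/
def depthConst (d : ℕ) (c κ α : ℝ) : ℝ := (2 * cellDegree α : ℝ) ^ (d - 1) * searchConst c κ

theorem depthConst_pos (hκ : 1 < κ) : 0 < depthConst d c κ α := by
  have h := searchConst_pos (c := c) hκ
  have : (0 : ℝ) < cellDegree α := by exact_mod_cast cellDegree_pos α
  rw [depthConst]; positivity

theorem inv_depthPrec (l : ℕ) :
    (depthPrec lam α l)⁻¹ = lam⁻¹ * (2 : ℝ) ^ ((l : ℝ) * α) := by
  rw [depthPrec, mul_inv, ← Real.rpow_neg (by norm_num), neg_neg]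

theorem inv_depthPrec_le (hlam : 1 ≤ lam) (l : ℕ) :
    (depthPrec lam α l)⁻¹ ≤ (2 : ℝ) ^ ((l : ℝ) * α) := by
  rw [inv_depthPrec]
  exact mul_le_of_le_one_left (by positivity) (inv_le_one_of_one_le₀ hlam)

/-- The number of lines gives 2^(l(d-1)) and each line ε_l^(-2(κ-1)). The saving λ^(-2(κ-1)) in ε_l
is kept, as it determines the power of λ in the final rate. -/
theorem depthCost_le (hd : 1 ≤ d) (hlam : 1 ≤ lam) (hκ : 1 < κ) (hc : 0 < c) (hδ : 0 < δ)
    (hg : HolderClass lam α g) (hη : {x ∈ cube d | 1 / 2 ≤ P.eta x} = epi g)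
    (hnoise : GeometricNoise P c κ g) (hgood : CallGood P lab δ lam α) (hΛ : 1 ≤ Λ) (l : ℕ)
    (hlog : Real.log (Λ * roundConst c κ * (depthPrec lam α l)⁻¹ ^ (2 * κ) / depthConf d δ α l) ≤ Λ) :
    ∃ m : ℕ, depthCost lab δ lam α l ≤ (m : ℕ∞) ∧ (m : ℝ) ≤ depthConst d c κ α * Λ *
      lam⁻¹ ^ (2 * (κ - 1)) * ((2 : ℝ) ^ (2 * α * (κ - 1) + d - 1)) ^ l := by
  have hlam0 : 0 < lam := by linarith
  have hline : ∀ a : Fin (d - 1) → ℕ, (∀ i, a i ≤ gridSize α l) → ∃ m : ℕ,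
      searchCost (lineLabels lab α l a) (depthPrec lam α l) (depthConf d δ α l) ≤ (m : ℕ∞) ∧
      (m : ℝ) ≤ searchConst c κ * Λ * (depthPrec lam α l)⁻¹ ^ (2 * (κ - 1)) := fun a ha =>
    searchCost_le_of_log_le hκ hc (depthPrec_pos hlam0 α l) (depthConf_pos hδ α l) (hgood l a ha)
      (fun z hz => one_half_le_eta_iff hη (gridPoint_prod_mem ha hz))
      (hg.mapsTo (gridPoint_mem α l ha)) (fun z hz => hnoise _ (gridPoint_prod_mem ha hz)) hΛ hlog
  set E := searchConst c κ * Λ * (depthPrec lam α l)⁻¹ ^ (2 * (κ - 1)) with hE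
  have hE0 : 0 ≤ E := by
    have := searchConst_pos (c := c) hκ
    have := depthPrec_pos hlam0 α l
    positivity
  refine ⟨(gridSize α l + 1) ^ (d - 1) * ⌊E⌋₊, ?_, ?_⟩
  · rw [depthCost]
    refine (Finset.sum_le_card_nsmul _ _ (⌊E⌋₊ : ℕ∞) fun a ha => ?_).trans (le_of_eq ?_)
    · obtain ⟨m, hm, hmE⟩ := hline a fun i =>
        Nat.lt_succ_iff.mp (Finset.mem_range.mp (Fintype.mem_piFinset.mp ha i))
      exact hm.trans (by exact_mod_cast Nat.le_floor hmE)
    · rw [Fintype.card_piFinset]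
      simp
  · have h1 : ((gridSize α l + 1 : ℕ) : ℝ) ≤ 2 * cellDegree α * 2 ^ l := by
      have : 1 ≤ gridSize α l := gridSize_pos α l
      have h2 : gridSize α l + 1 ≤ 2 * (cellDegree α * 2 ^ l) := by
        have : gridSize α l = cellDegree α * 2 ^ l := rfl
        omega
      rw [mul_assoc]
      exact_mod_cast h2
    have h2 : ((2 : ℝ) ^ (2 * α * (κ - 1) + d - 1)) ^ l =
        (2 ^ l) ^ (d - 1) * ((2 : ℝ) ^ ((l : ℝ) * α)) ^ (2 * (κ - 1)) := by
      rw [← Real.rpow_mul (by norm_num), ← pow_mul, ← Real.rpow_natCast, ← Real.rpow_natCast,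
        ← Real.rpow_mul (by norm_num), ← Real.rpow_add (by norm_num)]
      congr 1
      push_cast [Nat.cast_sub hd]
      ring
    calc (((gridSize α l + 1) ^ (d - 1) * ⌊E⌋₊ : ℕ) : ℝ)
        = ((gridSize α l + 1 : ℕ) : ℝ) ^ (d - 1) * (⌊E⌋₊ : ℝ) := by push_cast; ring
      _ ≤ (2 * cellDegree α * 2 ^ l) ^ (d - 1) * E := by
        gcongr
        exact Nat.floor_le hE0
      _ = _ := by
        rw [hE, inv_depthPrec, Real.mul_rpow (by positivity) (by positivity), h2, depthConst,
          mul_pow]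
        ring

theorem sum_pow_le_two_mul_pow {r : ℝ} (hr : 2 ≤ r) (l : ℕ) :
    ∑ j ∈ Finset.Icc 1 l, r ^ j ≤ 2 * r ^ l := by
  induction l with
  | zero => simp
  | succ l ih =>
    rw [Finset.sum_Icc_succ_top (by omega), pow_succ]
    have : 0 ≤ r ^ l := by positivity
    nlinarith

theorem two_le_two_rpow {D : ℝ} (hD : 1 ≤ D) : (2 : ℝ) ≤ 2 ^ D := by
  simpa using Real.rpow_le_rpow_of_exponent_le (by norm_num : (1 : ℝ) ≤ 2) hD

theorem one_le_rateDenom {d : ℕ} (hd : 2 ≤ d) {α κ : ℝ} (hα : 0 ≤ α) (hκ : 1 ≤ κ) :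
    1 ≤ 2 * α * (κ - 1) + d - 1 := by
  have : (2 : ℝ) ≤ d := by exact_mod_cast hd
  have : 0 ≤ 2 * α * (κ - 1) := mul_nonneg (by linarith) (by linarith)
  linarith

/-- As d ≥ 2, the cost bounds grow at least by a factor 2 per depth, so all depths up to l together
cost at most twice the bound for depth l. -/
theorem le_lastDepth_of_budget (hd : 2 ≤ d) (hlam : 1 ≤ lam) (hα : 0 < α) (hκ : 1 < κ) (hc : 0 < c)
    (hδ : 0 < δ) (hg : HolderClass lam α g) (hη : {x ∈ cube d | 1 / 2 ≤ P.eta x} = epi g)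
    (hnoise : GeometricNoise P c κ g) (hgood : CallGood P lab δ lam α) (hΛ : 1 ≤ Λ) {l n : ℕ}
    (hlog : Real.log (Λ * roundConst c κ * cellDegree α *
      ((2 : ℝ) ^ (2 * κ * α + d + 1)) ^ l / δ) ≤ Λ)
    (hn : 2 * depthConst d c κ α * Λ * lam⁻¹ ^ (2 * (κ - 1)) *
      ((2 : ℝ) ^ (2 * α * (κ - 1) + d - 1)) ^ l ≤ n) :
    l ≤ lastDepth lab n δ lam α := by
  have hlam0 : 0 < lam := by linarith
  have hA := one_le_roundConst (c := c) (κ := κ)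
  have hD : (0 : ℝ) < cellDegree α := by exact_mod_cast cellDegree_pos α
  refine le_lastDepth hlam0 hα ?_
  have hex : ∀ j ∈ Finset.Icc 1 l, ∃ m : ℕ, depthCost lab δ lam α j ≤ (m : ℕ∞) ∧
      (m : ℝ) ≤ depthConst d c κ α * Λ *
      lam⁻¹ ^ (2 * (κ - 1)) * ((2 : ℝ) ^ (2 * α * (κ - 1) + d - 1)) ^ j := by
    intro j hj
    have hjl := (Finset.mem_Icc.mp hj).2
    refine depthCost_le (by omega) hlam hκ hc hδ hg hη hnoise hgood hΛ j
      (le_trans (Real.log_le_log ?_ ?_) hlog)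
    · have := depthPrec_pos hlam0 α j
      have := depthConf_pos (d := d) hδ α j
      positivity
    · have h0 := depthPrec_pos hlam0 α j
      have h1 : (depthPrec lam α j)⁻¹ ^ (2 * κ) ≤ ((2 : ℝ) ^ ((j : ℝ) * α)) ^ (2 * κ) :=
        Real.rpow_le_rpow (by positivity) (inv_depthPrec_le hlam j) (by linarith)
      have h2 : ((2 : ℝ) ^ (2 * κ * α + d + 1)) ^ j =
          ((2 : ℝ) ^ ((j : ℝ) * α)) ^ (2 * κ) * 2 ^ (j * (d + 1)) := by
        rw [← Real.rpow_mul (by norm_num), ← Real.rpow_natCast, ← Real.rpow_natCast,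
          ← Real.rpow_mul (by norm_num), ← Real.rpow_add (by norm_num)]
        congr 1
        push_cast
        ring
      have h3 : ((2 : ℝ) ^ (2 * κ * α + d + 1)) ^ j ≤ ((2 : ℝ) ^ (2 * κ * α + d + 1)) ^ l := by
        refine pow_le_pow_right₀ (Real.one_le_rpow (by norm_num) ?_) hjl
        positivity
      rw [depthConf, div_div_eq_mul_div]
      refine div_le_div_of_nonneg_right ?_ hδ.le
      calc Λ * roundConst c κ * (depthPrec lam α j)⁻¹ ^ (2 * κ) * (cellDegree α * 2 ^ (j * (d + 1)))
          ≤ Λ * roundConst c κ * ((2 : ℝ) ^ ((j : ℝ) * α)) ^ (2 * κ) *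
            (cellDegree α * 2 ^ (j * (d + 1))) := by gcongr
        _ = Λ * roundConst c κ * cellDegree α * ((2 : ℝ) ^ (2 * κ * α + d + 1)) ^ j := by
            rw [h2]; ring
        _ ≤ _ := by gcongr
  choose! m hm hmle using hex
  have hsum : (∑ j ∈ Finset.Icc 1 l, m j) ≤ n := by
    have : ((∑ j ∈ Finset.Icc 1 l, m j : ℕ) : ℝ) ≤ n := by
      push_cast
      refine (Finset.sum_le_sum hmle).trans ?_
      rw [← Finset.mul_sum]
      have hr := two_le_two_rpow (one_le_rateDenom hd hα.le hκ.le)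
      have hC := depthConst_pos (d := d) (c := c) (α := α) hκ
      calc _ ≤ depthConst d c κ α * Λ * lam⁻¹ ^ (2 * (κ - 1)) *
            (2 * ((2 : ℝ) ^ (2 * α * (κ - 1) + d - 1)) ^ l) := by
            have := sum_pow_le_two_mul_pow hr l
            gcongr
        _ = _ := by ring
        _ ≤ _ := hn
    exact_mod_cast this
  refine (Finset.sum_le_sum hm).trans ?_
  exact_mod_cast hsum

end

/-! ### The rate -/

section

variable {d : ℕ} {α α' κ lam L x n : ℝ}

/-- Passing from smoothness `α` to `α' ≥ α - 1/L` changes the power of `λ` by a constant factor. -/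
theorem lam_rpow_le (hd : 2 ≤ d) (hα' : 0 < α') (hαα' : α' ≤ α) (hκ : 1 < κ) (hL : 0 < L)
    (hgap : α - α' ≤ 1 / L) (hlam : 1 ≤ lam) (hlog : Real.log lam ≤ L) :
    lam ^ (((d : ℝ) - 1) / (2 * α' * (κ - 1) + d - 1)) ≤
      lam ^ (((d : ℝ) - 1) / (2 * α * (κ - 1) + d - 1)) * Real.exp (2 * (κ - 1)) := by
  have hα : 0 < α := hα'.trans_le hαα'
  have hD := one_le_rateDenom hd hα.le hκ.le
  have hD' := one_le_rateDenom hd hα'.le hκ.le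
  have hd1 : (1 : ℝ) ≤ (d : ℝ) - 1 := by
    have : (2 : ℝ) ≤ d := by exact_mod_cast hd
    linarith
  have hprod : 0 ≤ 2 * α * (κ - 1) := mul_nonneg (by linarith) (by linarith)
  have hlam0 : 0 < lam := by linarith
  -- The new exponent is the old one plus an increment proportional to α - α'. The increment is at
  -- most 2(κ-1)/L, which log λ ≤ L turns into a constant factor.
  have hs : ((d : ℝ) - 1) / (2 * α' * (κ - 1) + d - 1) =
      ((d : ℝ) - 1) / (2 * α * (κ - 1) + d - 1) +
        (((d : ℝ) - 1) / (2 * α * (κ - 1) + d - 1)) * (2 * (κ - 1) * (α - α')) /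
          (2 * α' * (κ - 1) + d - 1) := by
    have h1 : (2 * α * (κ - 1) + d - 1 : ℝ) ≠ 0 := by linarith
    have h2 : (2 * α' * (κ - 1) + d - 1 : ℝ) ≠ 0 := by linarith
    rw [div_mul_eq_mul_div, div_add_div _ _ h1 h2, div_eq_div_iff h2 (mul_ne_zero h1 h2)]
    rw [mul_comm ((2 * α * (κ - 1) + d - 1 : ℝ)) (_ / _), div_mul_cancel₀ _ h1]
    ring
  have hgap0 : 0 ≤ 2 * (κ - 1) * (α - α') := mul_nonneg (by linarith) (by linarith)
  have he : (((d : ℝ) - 1) / (2 * α * (κ - 1) + d - 1)) * (2 * (κ - 1) * (α - α')) /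
      (2 * α' * (κ - 1) + d - 1) ≤ 2 * (κ - 1) * (1 / L) := by
    refine (div_le_self (mul_nonneg (div_nonneg (by linarith) (by linarith)) hgap0) hD').trans ?_
    refine (mul_le_of_le_one_left hgap0 ?_).trans (mul_le_mul_of_nonneg_left hgap (by linarith))
    rw [div_le_one (by linarith)]
    linarith
  rw [hs, Real.rpow_add hlam0]
  refine mul_le_mul_of_nonneg_left ?_ (by positivity)
  rw [Real.rpow_def_of_pos hlam0, Real.exp_le_exp]
  have hlog0 := Real.log_nonneg hlam
  calc _ ≤ L * (2 * (κ - 1) * (1 / L)) := by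
        refine mul_le_mul hlog he ?_ hL.le
        exact div_nonneg (mul_nonneg (div_nonneg (by linarith) (by linarith)) hgap0) (by linarith)
    _ = _ := by field_simp

/-- Passing from smoothness `α` to `α' ≥ α - 1/L` changes the power of `x` by a constant factor. -/
theorem rate_rpow_le (hd : 2 ≤ d) (hα' : 0 < α') (hαα' : α' ≤ α) (hκ : 1 < κ) (hL : 0 < L)
    (hgap : α - α' ≤ 1 / L) (hx : 0 < x) (hlog : -Real.log x ≤ 2 * L) :
    x ^ (α' / (2 * α' * (κ - 1) + d - 1)) ≤
      x ^ (α / (2 * α * (κ - 1) + d - 1)) * Real.exp 2 := by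
  have hα : 0 < α := hα'.trans_le hαα'
  have hD := one_le_rateDenom hd hα.le hκ.le
  have hD' := one_le_rateDenom hd hα'.le hκ.le
  have hd1 : (1 : ℝ) ≤ (d : ℝ) - 1 := by
    have : (2 : ℝ) ≤ d := by exact_mod_cast hd
    linarith
  have hprod : 0 ≤ 2 * α * (κ - 1) := mul_nonneg (by linarith) (by linarith)
  -- The loss in the exponent is at most 1/L, and x is not smaller than exp(-2L), whence the factor
  -- e².
  have hs : α' / (2 * α' * (κ - 1) + d - 1) = α / (2 * α * (κ - 1) + d - 1) -
        (((d : ℝ) - 1) / (2 * α * (κ - 1) + d - 1)) * (α - α') /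
          (2 * α' * (κ - 1) + d - 1) := by
    have h1 : (2 * α * (κ - 1) + d - 1 : ℝ) ≠ 0 := by linarith
    have h2 : (2 * α' * (κ - 1) + d - 1 : ℝ) ≠ 0 := by linarith
    rw [div_mul_eq_mul_div, div_sub_div _ _ h1 h2, div_eq_div_iff h2 (mul_ne_zero h1 h2)]
    rw [mul_comm ((2 * α * (κ - 1) + d - 1 : ℝ)) (_ / _), div_mul_cancel₀ _ h1]
    ring
  have hgap0 : 0 ≤ α - α' := by linarith
  set e := (((d : ℝ) - 1) / (2 * α * (κ - 1) + d - 1)) * (α - α') / (2 * α' * (κ - 1) + d - 1)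
    with hedef
  have he0 : 0 ≤ e :=
    div_nonneg (mul_nonneg (div_nonneg (by linarith) (by linarith)) hgap0) (by linarith)
  have he : e ≤ 1 / L := by
    refine (div_le_self (mul_nonneg (div_nonneg (by linarith) (by linarith)) hgap0) hD').trans ?_
    refine (mul_le_of_le_one_left hgap0 ?_).trans hgap
    rw [div_le_one (by linarith)]
    linarith
  rw [hs, sub_eq_add_neg, Real.rpow_add hx]
  refine mul_le_mul_of_nonneg_left ?_ (by positivity)
  rw [Real.rpow_def_of_pos hx, Real.exp_le_exp]
  calc Real.log x * -e = -Real.log x * e := by ring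
    _ ≤ 2 * L * e := mul_le_mul_of_nonneg_right hlog he0
    _ ≤ 2 * L * (1 / L) := mul_le_mul_of_nonneg_left he (by linarith)
    _ = 2 := by field_simp

end

/-! ### From the label budget to the width of the unlabeled band -/

/-- The factor by which the confidence logarithms exceed `log (n/δ)`. -/
def logConst (d : ℕ) (α κ : ℝ) : ℝ := 5 + 2 * κ * (2 * κ * α + d + 1)

/-- The factor in the relation between the budget and the reached depth. -/
def budgetConst (d : ℕ) (c κ α : ℝ) : ℝ := 4 * depthConst d c κ α * logConst d α κ + 1

/-- The constant in the bound for the width of the unlabeled band. -/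
def bandConst (d : ℕ) (c κ α : ℝ) : ℝ :=
  7 * (⌈α⌉₊ : ℝ) ^ (d * ⌈α⌉₊) * 2 ^ α * budgetConst d c κ α ^ α * Real.exp (2 * (κ - 1) + 2)

/-- The bound for the width of the unlabeled band. -/
def bandWidth (d : ℕ) (c κ α lam x : ℝ) : ℝ :=
  bandConst d c κ α * (lam ^ (((d : ℝ) - 1) / (2 * α * (κ - 1) + d - 1)) *
    x ^ (α / (2 * α * (κ - 1) + d - 1)))

/-- The sample size is large enough, relative to `λ` and `δ`. -/
structure LargeSample (d : ℕ) (c κ α lam δ : ℝ) (n : ℕ) : Prop where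
  conf_le : 64 * (2 * cellDegree α : ℝ) ^ (d - 1) ≤ logFloor n
  log_lam_le : Real.log lam ≤ logFloor n
  lam_le : lam ≤ n
  const_le : logConst d α κ * roundConst c κ * cellDegree α ≤ n
  logFloor_sq_le : 2 * (logFloor n : ℝ) ^ 2 ≤ n
  rate_le : Real.log (n / δ) ^ 3 / n * (budgetConst d c κ α * 2 ^ (2 * α * (κ - 1) + d - 1)) ≤ 1

section

variable {d : ℕ} {α κ c : ℝ}

theorem five_le_logConst (hα : 0 < α) (hκ : 1 < κ) : 5 ≤ logConst d α κ := by
  rw [logConst]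
  have : 0 ≤ 2 * κ * (2 * κ * α + d + 1) := by positivity
  linarith

theorem one_le_budgetConst (hα : 0 < α) (hκ : 1 < κ) : 1 ≤ budgetConst d c κ α := by
  have h1 := five_le_logConst (d := d) hα hκ
  have h2 := depthConst_pos (d := d) (c := c) (α := α) hκ
  rw [budgetConst]
  have : 0 ≤ 4 * depthConst d c κ α * logConst d α κ := by positivity
  linarith

theorem bandConst_pos (hα : 0 < α) (hκ : 1 < κ) : 0 < bandConst d c κ α := by
  have h1 := one_le_budgetConst (d := d) (c := c) hα hκ
  have h2 := one_le_ceil_cast hα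
  rw [bandConst]
  positivity

theorem depthConst_mono {α' : ℝ} (hκ : 1 < κ) (h : α' ≤ α) :
    depthConst d c κ α' ≤ depthConst d c κ α := by
  have : (cellDegree α' : ℝ) ≤ cellDegree α := by exact_mod_cast cellDegree_mono h
  have h2 := searchConst_pos (c := c) hκ
  rw [depthConst, depthConst]
  gcongr

variable {lam δ : ℝ} {n : ℕ}

theorem one_le_logFloor (h : 64 * (2 * cellDegree α : ℝ) ^ (d - 1) ≤ logFloor n) :
    (1 : ℝ) ≤ logFloor n := by
  have hD : (1 : ℝ) ≤ cellDegree α := by exact_mod_cast cellDegree_pos α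
  have : (1 : ℝ) ≤ (2 * cellDegree α : ℝ) ^ (d - 1) := one_le_pow₀ (by linarith)
  linarith

theorem logFloor_bounds (hL : (1 : ℝ) ≤ logFloor n) :
    (logFloor n : ℝ) ≤ Real.log n ∧ Real.log n ≤ 2 * logFloor n ∧ (0 : ℝ) < n := by
  have h0 : 0 ≤ Real.log n := by
    by_contra hcon
    have : logFloor n = 0 := Nat.floor_of_nonpos (le_of_lt (not_le.mp hcon))
    rw [this] at hL
    norm_num at hL
  have h1 : (logFloor n : ℝ) ≤ Real.log n := Nat.floor_le h0
  have h2 : Real.log n < logFloor n + 1 := Nat.lt_floor_add_one _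
  refine ⟨h1, by linarith, ?_⟩
  rcases Nat.eq_zero_or_pos n with rfl | h
  · simp at h1; rw [h1] at hL; norm_num at hL
  · exact_mod_cast h

theorem bandWidth_pos (hα : 0 < α) (hκ : 1 < κ) (hlam : 0 < lam) {x : ℝ} (hx : 0 < x) :
    0 < bandWidth d c κ α lam x := by
  have := bandConst_pos (d := d) (c := c) hα hκ
  rw [bandWidth]
  positivity

theorem log_div_ge (hδ : 0 < δ) (hδ1 : δ ≤ 1) (hn : (0 : ℝ) < n) :
    Real.log n ≤ Real.log (n / δ) ∧ Real.log (1 / δ) ≤ Real.log (n / δ) - Real.log n := by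
  rw [Real.log_div hn.ne' hδ.ne', one_div, Real.log_inv]
  have := Real.log_nonpos hδ.le hδ1
  constructor <;> linarith

variable {α' : ℝ} {l : ℕ}

/-- This verifies the logarithmic hypothesis of the cost bounds with Λ = `logConst` · log(n/δ). The
summand 5 in `logConst` counts one log(n/δ) each for the constants, for the factor log(n/δ) and for
1/δ, and two for ⌊log n⌋². -/
theorem log_requests_le (hd : 2 ≤ d) (hκ : 1 < κ) (hα' : 0 < α') (hαα' : α' ≤ α)
    (hlam : 1 ≤ lam) (hδ : 0 < δ) (hδ1 : δ ≤ 1) (hn : LargeSample d c κ α lam δ n)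
    (hl : ((2 : ℝ) ^ (2 * α' * (κ - 1) + d - 1)) ^ l ≤ lam ^ (2 * (κ - 1)) * n) :
    Real.log (logConst d α κ * Real.log (n / δ) * roundConst c κ * cellDegree α' *
      ((2 : ℝ) ^ (2 * κ * α' + d + 1)) ^ l / (δ / (logFloor n : ℝ) ^ 2)) ≤
      logConst d α κ * Real.log (n / δ) := by
  have hα : 0 < α := hα'.trans_le hαα'
  have hL := one_le_logFloor hn.conf_le
  obtain ⟨hL1, -, hn0⟩ := logFloor_bounds hL
  obtain ⟨hℓ1, hℓ2⟩ := log_div_ge hδ hδ1 hn0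
  have hD' := one_le_rateDenom hd hα'.le hκ.le
  have hp := five_le_logConst (d := d) hα hκ
  have hA := one_le_roundConst (c := c) (κ := κ)
  have hcd : (0 : ℝ) < cellDegree α' := by exact_mod_cast cellDegree_pos α'
  have hcd' : (cellDegree α' : ℝ) ≤ cellDegree α := by exact_mod_cast cellDegree_mono hαα'
  set ℓ := Real.log (n / δ) with hℓ
  have hlogn : 1 ≤ Real.log n := hL.trans hL1
  have hℓ0 : 0 < ℓ := by linarith
  have e1 : logConst d α κ * ℓ * roundConst c κ * cellDegree α' *
      ((2 : ℝ) ^ (2 * κ * α' + d + 1)) ^ l / (δ / (logFloor n : ℝ) ^ 2) =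
      (logConst d α κ * roundConst c κ * cellDegree α') * ℓ *
        ((2 : ℝ) ^ (2 * κ * α' + d + 1)) ^ l * (logFloor n : ℝ) ^ 2 * (1 / δ) := by
    field_simp
  have hn1 : (1 : ℝ) ≤ n := by
    have h := hn.logFloor_sq_le
    nlinarith
  rw [e1, Real.log_mul (by positivity) (by positivity), Real.log_mul (by positivity) (by positivity),
    Real.log_mul (by positivity) (by positivity), Real.log_mul (by positivity) (by positivity)]
  have b1 : Real.log (logConst d α κ * roundConst c κ * cellDegree α') ≤ ℓ := by
    refine (Real.log_le_log (by positivity) ?_).trans hℓ1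
    refine le_trans ?_ hn.const_le
    gcongr
  have b2 : Real.log ℓ ≤ ℓ := (Real.log_le_sub_one_of_pos hℓ0).trans (by linarith)
  have b4 : Real.log ((logFloor n : ℝ) ^ 2) ≤ 2 * ℓ := by
    rw [Real.log_pow]
    have h1 : Real.log (logFloor n) ≤ Real.log n := by
      refine Real.log_le_log (by linarith) (hL1.trans ?_)
      exact (Real.log_le_sub_one_of_pos hn0).trans (by linarith)
    push_cast
    linarith
  have b3 : Real.log (((2 : ℝ) ^ (2 * κ * α' + d + 1)) ^ l) ≤ 2 * κ * (2 * κ * α + d + 1) * ℓ := by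
    have h1 := Real.log_le_log (by positivity) hl
    rw [Real.log_mul (by positivity) hn0.ne', Real.log_pow, Real.log_rpow (by norm_num),
      Real.log_rpow (by linarith)] at h1
    have h2 : Real.log lam ≤ Real.log n := Real.log_le_log (by linarith) hn.lam_le
    rw [Real.log_pow, Real.log_rpow (by norm_num)]
    have h3 : 0 ≤ (l : ℝ) * Real.log 2 := mul_nonneg (by positivity) (Real.log_nonneg (by norm_num))
    -- The base in `hl` is at least 2 and λ ≤ n, so l log 2 is at most 2(κ-1) log λ + log n, hence
    -- at most 2κ log(n/δ).
    have h4 : (l : ℝ) * Real.log 2 ≤ 2 * κ * ℓ := by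
      have h5 : (l : ℝ) * Real.log 2 ≤ l * ((2 * α' * (κ - 1) + d - 1) * Real.log 2) := by
        nlinarith
      have h6 : 2 * (κ - 1) * Real.log lam ≤ 2 * (κ - 1) * ℓ :=
        mul_le_mul_of_nonneg_left (h2.trans hℓ1) (by linarith)
      nlinarith
    have h5 : 2 * κ * α' + d + 1 ≤ 2 * κ * α + d + 1 := by
      have : 2 * κ * α' ≤ 2 * κ * α := mul_le_mul_of_nonneg_left hαα' (by linarith)
      linarith
    calc (l : ℝ) * ((2 * κ * α' + d + 1) * Real.log 2)
        = (2 * κ * α' + d + 1) * (l * Real.log 2) := by ring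
      _ ≤ (2 * κ * α + d + 1) * (2 * κ * ℓ) := by
        refine mul_le_mul h5 h4 h3 ?_
        positivity
      _ = _ := by ring
  have b5 : Real.log (1 / δ) ≤ ℓ := by linarith
  have : logConst d α κ * ℓ = 5 * ℓ + 2 * κ * (2 * κ * α + d + 1) * ℓ := by
    rw [logConst]; ring
  linarith

/-- Rounding down a quotient that is at least 2 loses at most half of it. -/
theorem half_le_budget (hn0 : 2 * (logFloor n : ℝ) ^ 2 ≤ n) (hL : (1 : ℝ) ≤ logFloor n) :
    (n : ℝ) / (2 * (logFloor n : ℝ) ^ 2) ≤ ((n / logFloor n ^ 2 : ℕ) : ℝ) := by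
  have h1 : (n : ℝ) / ((logFloor n ^ 2 : ℕ) : ℝ) < ((n / logFloor n ^ 2 : ℕ) : ℝ) + 1 := by
    rw [← Nat.floor_div_eq_div (K := ℝ)]
    exact Nat.lt_floor_add_one _
  push_cast at h1
  have hL2 : (0 : ℝ) < (logFloor n : ℝ) ^ 2 := by positivity
  have h2 : (n : ℝ) / (2 * (logFloor n : ℝ) ^ 2) = (n : ℝ) / (logFloor n : ℝ) ^ 2 / 2 := by
    field_simp
  have h3 : 2 ≤ (n : ℝ) / (logFloor n : ℝ) ^ 2 := by rwa [le_div_iff₀ hL2]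
  rw [h2]
  linarith

theorem two_rpow_neg_le {D G : ℝ} (hD : 0 < D) (hα' : 0 < α') (hG : 0 < G)
    (hl : G ≤ ((2 : ℝ) ^ D) ^ (l + 1)) :
    (2 : ℝ) ^ (-((l : ℝ) * α')) ≤ 2 ^ α' * G⁻¹ ^ (α' / D) := by
  have h1 : G ^ (α' / D) ≤ (((2 : ℝ) ^ D) ^ (l + 1)) ^ (α' / D) :=
    Real.rpow_le_rpow hG.le hl (by positivity)
  have h2 : (((2 : ℝ) ^ D) ^ (l + 1)) ^ (α' / D) = 2 ^ α' * 2 ^ ((l : ℝ) * α') := by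
    rw [← Real.rpow_natCast, ← Real.rpow_mul (by positivity), ← Real.rpow_mul (by norm_num),
      ← Real.rpow_add (by norm_num)]
    congr 1
    push_cast
    field_simp
    ring
  rw [h2] at h1
  rw [Real.inv_rpow hG.le, Real.rpow_neg (by norm_num), ← div_eq_mul_inv, le_div_iff₀ (by positivity),
    inv_mul_le_iff₀ (by positivity)]
  linarith

theorem biasTerm_lastDepth_le {P : Problem d} {g : (Fin (d - 1) → ℝ) → ℝ}
    {lab : ℕ → ℕ → Point d → ℕ → Bool} (hd : 2 ≤ d) (hκ : 1 < κ) (hc : 0 < c) (hα' : 0 < α')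
    (hαα' : α' ≤ α) (hgap : α - α' ≤ 1 / (logFloor n : ℝ))
    (hlam : 1 ≤ lam) (hδ : 0 < δ) (hδ1 : δ ≤ 1) (hn : LargeSample d c κ α lam δ n)
    (hg : HolderClass lam α' g) (hη : {x ∈ cube d | 1 / 2 ≤ P.eta x} = epi g)
    (hnoise : GeometricNoise P c κ g) (hgood : CallGood P lab (δ / (logFloor n : ℝ) ^ 2) lam α') :
    1 ≤ lastDepth lab (n / logFloor n ^ 2) (δ / (logFloor n : ℝ) ^ 2) lam α' ∧
      7 * biasTerm d lam α' (lastDepth lab (n / logFloor n ^ 2) (δ / (logFloor n : ℝ) ^ 2) lam α') ≤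
        bandWidth d c κ α lam (Real.log (n / δ) ^ 3 / n) := by
  have hα : 0 < α := hα'.trans_le hαα'
  have hL := one_le_logFloor hn.conf_le
  obtain ⟨hL1, hL2, hn0⟩ := logFloor_bounds hL
  obtain ⟨hℓ1, -⟩ := log_div_ge hδ hδ1 hn0
  have hD := one_le_rateDenom hd hα.le hκ.le
  have hD' := one_le_rateDenom hd hα'.le hκ.le
  have hp := five_le_logConst (d := d) hα hκ
  have hE := one_le_budgetConst (d := d) (c := c) hα hκ
  have hA2 := depthConst_pos (d := d) (c := c) (α := α) hκ
  have hlam0 : 0 < lam := by linarith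
  have hlamp : 1 ≤ lam ^ (2 * (κ - 1)) := Real.one_le_rpow hlam (by linarith)
  have hlog := fun l hl => log_requests_le (l := l) hd hκ hα' hαα' hlam hδ hδ1 hn hl
  have hrate := hn.rate_le
  set ℓ := Real.log (n / δ) with hℓ
  have hℓ0 : 1 ≤ ℓ := by linarith
  set x := ℓ ^ 3 / n with hx
  have hx0 : 0 < x := by positivity
  set E := budgetConst d c κ α with hEdef
  -- G is the value of 2^(lD') that the budget affords. One logarithm in x pays for the rounds, and
  -- two pay for sharing n among ⌊log n⌋² calls.
  set G := lam ^ (2 * (κ - 1)) / (E * x) with hG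
  have hG0 : 0 < G := by positivity
  have hr2 := two_le_two_rpow hD'
  set r := (2 : ℝ) ^ (2 * α' * (κ - 1) + d - 1) with hr
  have hrG : r ≤ G := by
    have h1 : r ≤ 2 ^ (2 * α * (κ - 1) + d - 1) := by
      refine Real.rpow_le_rpow_of_exponent_le (by norm_num) ?_
      have : 2 * α' * (κ - 1) ≤ 2 * α * (κ - 1) :=
        mul_le_mul_of_nonneg_right (by linarith) (by linarith)
      linarith
    rw [hG, le_div_iff₀ (by positivity)]
    calc r * (E * x) ≤ 2 ^ (2 * α * (κ - 1) + d - 1) * (E * x) := by gcongr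
      _ = x * (E * 2 ^ (2 * α * (κ - 1) + d - 1)) := by ring
      _ ≤ 1 := hrate
      _ ≤ _ := hlamp
  -- l is the largest depth with r^l ≤ G: the lower inequality keeps it within budget, the upper one
  -- bounds 2^(-lα'). That r ≤ G guarantees l ≥ 1.
  obtain ⟨l, hl1, hl2⟩ := exists_nat_pow_near (le_trans (by linarith) hrG) (by linarith : 1 < r)
  have hl : 1 ≤ l := by
    by_contra hcon
    have : l = 0 := by omega
    rw [this, zero_add, pow_one] at hl2
    linarith
  have hGn : G ≤ lam ^ (2 * (κ - 1)) * n := by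
    rw [hG, div_le_iff₀ (by positivity)]
    have h1 : 1 ≤ n * (E * x) := by
      have : n * (E * x) = E * ℓ ^ 3 := by rw [hx]; field_simp
      rw [this]
      exact one_le_mul_of_one_le_of_one_le hE (one_le_pow₀ hℓ0)
    rw [mul_assoc]
    exact le_mul_of_one_le_right (by positivity) h1
  have hbudget : 2 * depthConst d c κ α' * (logConst d α κ * ℓ) * lam⁻¹ ^ (2 * (κ - 1)) * r ^ l ≤
      ((n / logFloor n ^ 2 : ℕ) : ℝ) := by
    refine le_trans ?_ (half_le_budget hn.logFloor_sq_le hL)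
    have hA2' := depthConst_mono (d := d) (c := c) hκ hαα'
    have hA2'' := depthConst_pos (d := d) (c := c) (α := α') hκ
    calc _ ≤ 2 * depthConst d c κ α * (logConst d α κ * ℓ) * lam⁻¹ ^ (2 * (κ - 1)) * G := by gcongr
      _ = (4 * depthConst d c κ α * logConst d α κ) / E * (n / (2 * ℓ ^ 2)) := by
        rw [hG, hx, Real.inv_rpow hlam0.le]
        field_simp
        norm_num
      _ ≤ 1 * (n / (2 * ℓ ^ 2)) := by
        refine mul_le_mul_of_nonneg_right ?_ (by positivity)
        rw [div_le_one (by linarith), hEdef, budgetConst]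
        linarith
      _ ≤ n / (2 * (logFloor n : ℝ) ^ 2) := by
        rw [one_mul]
        have : (logFloor n : ℝ) ≤ ℓ := hL1.trans hℓ1
        gcongr
  have hΛ : 1 ≤ logConst d α κ * ℓ := one_le_mul_of_one_le_of_one_le (by linarith) hℓ0
  have hlast := le_lastDepth_of_budget hd hlam hα' hκ hc (by positivity) hg hη hnoise hgood hΛ
    (hlog l (hl1.trans hGn)) hbudget
  refine ⟨hl.trans hlast, ?_⟩
  set ls := lastDepth lab (n / logFloor n ^ 2) (δ / (logFloor n : ℝ) ^ 2) lam α'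
  have s1 : biasTerm d lam α' ls ≤ (⌈α⌉₊ : ℝ) ^ (d * ⌈α⌉₊) * (lam * (2 : ℝ) ^ (-((l : ℝ) * α'))) := by
    refine (biasTerm_le hα' hlam0.le ls).trans ?_
    have h1 : (2 : ℝ) ^ (-((ls : ℝ) * α')) ≤ 2 ^ (-((l : ℝ) * α')) := by
      refine Real.rpow_le_rpow_of_exponent_le (by norm_num) ?_
      have : (l : ℝ) ≤ ls := by exact_mod_cast hlast
      nlinarith
    have h2 : (⌈α'⌉₊ : ℝ) ^ (d * ⌈α'⌉₊) ≤ (⌈α⌉₊ : ℝ) ^ (d * ⌈α⌉₊) := by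
      have hle : ⌈α'⌉₊ ≤ ⌈α⌉₊ := Nat.ceil_mono hαα'
      calc (⌈α'⌉₊ : ℝ) ^ (d * ⌈α'⌉₊) ≤ (⌈α⌉₊ : ℝ) ^ (d * ⌈α'⌉₊) := by gcongr
        _ ≤ _ := pow_le_pow_right₀ (one_le_ceil_cast hα) (Nat.mul_le_mul_left d hle)
    gcongr
  have s2 := two_rpow_neg_le (l := l) (by linarith) hα' hG0 hl2.le
  set D' := 2 * α' * (κ - 1) + d - 1 with hD'def
  -- The powers of λ combine by 1 - 2(κ-1)α'/D' = (d-1)/D'.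
  have s3 : lam * G⁻¹ ^ (α' / D') = E ^ (α' / D') * (lam ^ (((d : ℝ) - 1) / D') * x ^ (α' / D')) := by
    have h1 : G⁻¹ = E * x * (lam ^ (-(2 * (κ - 1)))) := by
      rw [hG, inv_div, Real.rpow_neg hlam0.le, div_eq_mul_inv]
    have h2 : ((d : ℝ) - 1) / D' = 1 + -(2 * (κ - 1)) * (α' / D') := by
      have : D' ≠ 0 := by linarith
      field_simp
      rw [hD'def]; ring
    rw [h1, Real.mul_rpow (by positivity) (by positivity), Real.mul_rpow (by positivity) hx0.le,
      ← Real.rpow_mul hlam0.le, h2, Real.rpow_add hlam0, Real.rpow_one]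
    ring
  have s4 : E ^ (α' / D') ≤ E ^ α :=
    Real.rpow_le_rpow_of_exponent_le hE ((div_le_self hα'.le hD').trans hαα')
  have s5 := lam_rpow_le hd hα' hαα' hκ (by linarith) hgap hlam hn.log_lam_le
  have hlogx : -Real.log x ≤ 2 * logFloor n := by
    rw [hx, Real.log_div (by positivity) hn0.ne', Real.log_pow]
    have := Real.log_nonneg hℓ0
    push_cast
    linarith
  have s6 := rate_rpow_le hd hα' hαα' hκ (by linarith) hgap hx0 hlogx
  have s7 : (2 : ℝ) ^ α' ≤ 2 ^ α := Real.rpow_le_rpow_of_exponent_le (by norm_num) hαα'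
  calc 7 * biasTerm d lam α' ls
      ≤ 7 * ((⌈α⌉₊ : ℝ) ^ (d * ⌈α⌉₊) * (lam * (2 ^ α' * G⁻¹ ^ (α' / D')))) := by
        refine mul_le_mul_of_nonneg_left (s1.trans ?_) (by norm_num)
        gcongr
    _ = 7 * (⌈α⌉₊ : ℝ) ^ (d * ⌈α⌉₊) * 2 ^ α' *
        (E ^ (α' / D') * (lam ^ (((d : ℝ) - 1) / D') * x ^ (α' / D'))) := by
        rw [← s3]; ring
    _ ≤ 7 * (⌈α⌉₊ : ℝ) ^ (d * ⌈α⌉₊) * 2 ^ α * (E ^ α *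
        ((lam ^ (((d : ℝ) - 1) / (2 * α * (κ - 1) + d - 1)) * Real.exp (2 * (κ - 1))) *
          (x ^ (α / (2 * α * (κ - 1) + d - 1)) * Real.exp 2))) := by gcongr
    _ = _ := by
        rw [bandWidth, bandConst, Real.exp_add]
        ring

end

/-! ### Large samples -/

section

open Filter Topology

theorem tendsto_logFloor : Tendsto (fun n : ℕ => (logFloor n : ℝ)) atTop atTop :=
  tendsto_natCast_atTop_atTop.comp (tendsto_nat_floor_atTop.comp
    (Real.tendsto_log_atTop.comp tendsto_natCast_atTop_atTop))

theorem tendsto_log_pow_div (k : ℕ) :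
    Tendsto (fun y : ℝ => Real.log y ^ k / y) atTop (𝓝 0) := by
  simpa using (Real.isLittleO_pow_log_id_atTop (n := k)).tendsto_div_nhds_zero

theorem tendsto_rate {δ : ℝ} (hδ : 0 < δ) :
    Tendsto (fun n : ℕ => Real.log ((n : ℝ) / δ) ^ 3 / n) atTop (𝓝 0) := by
  have h1 : Tendsto (fun n : ℕ => (n : ℝ) / δ) atTop atTop :=
    tendsto_natCast_atTop_atTop.atTop_div_const hδ
  have h2 := ((tendsto_log_pow_div 3).comp h1).div_const δ
  rw [zero_div] at h2
  refine h2.congr fun n => ?_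
  simp only [Function.comp]
  field_simp

/-- The band must shrink below Δ₀ because the mass condition is available only there. Neither κ' nor
C_M enters, so the resulting threshold on n is independent of both. -/
theorem eventually_largeSample {d : ℕ} (hd : 2 ≤ d) {c κ α Δ₀ : ℝ} (hα : 0 < α) (hκ : 1 < κ)
    (hΔ₀ : 0 < Δ₀) (lam : ℝ) {δ : ℝ} (hδ : 0 < δ) :
    ∀ᶠ n : ℕ in atTop, LargeSample d c κ α lam δ n ∧
      bandWidth d c κ α lam (Real.log ((n : ℝ) / δ) ^ 3 / n) ≤ Δ₀ := by
  have hnat : Tendsto (fun n : ℕ => (n : ℝ)) atTop atTop := tendsto_natCast_atTop_atTop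
  have hD := one_le_rateDenom hd hα.le hκ.le
  have e1 := tendsto_logFloor.eventually_ge_atTop (64 * (2 * cellDegree α : ℝ) ^ (d - 1))
  have e2 := tendsto_logFloor.eventually_ge_atTop (Real.log lam)
  have e3 := hnat.eventually_ge_atTop lam
  have e4 := hnat.eventually_ge_atTop (logConst d α κ * roundConst c κ * cellDegree α)
  have e5 := ((tendsto_log_pow_div 2).comp hnat).eventually_le_const
    (show (0 : ℝ) < 1 / 2 by norm_num)
  have t6 := (tendsto_rate hδ).mul_const (budgetConst d c κ α * 2 ^ (2 * α * (κ - 1) + d - 1))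
  rw [zero_mul] at t6
  have e6 := t6.eventually_le_const zero_lt_one
  have hs : 0 < α / (2 * α * (κ - 1) + d - 1) := div_pos hα (by linarith)
  have t7 : Tendsto (fun n : ℕ => bandWidth d c κ α lam (Real.log ((n : ℝ) / δ) ^ 3 / n)) atTop
      (𝓝 0) := by
    have h1 := (((tendsto_rate hδ).rpow_const (Or.inr hs.le)).const_mul
      (lam ^ (((d : ℝ) - 1) / (2 * α * (κ - 1) + d - 1)))).const_mul (bandConst d c κ α)
    simp only [Real.zero_rpow hs.ne', mul_zero] at h1
    exact h1
  have e7 := t7.eventually_le_const hΔ₀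
  filter_upwards [e1, e2, e3, e4, e5, e6, e7] with n h1 h2 h3 h4 h5 h6 h7
  refine ⟨⟨h1, h2, h3, h4, ?_, h6⟩, h7⟩
  have hL := one_le_logFloor h1
  obtain ⟨hL1, -, hn0⟩ := logFloor_bounds hL
  simp only [Function.comp] at h5
  rw [div_le_iff₀ hn0] at h5
  have : (logFloor n : ℝ) ^ 2 ≤ Real.log n ^ 2 := by gcongr
  linarith

section

variable {d : ℕ} {P : Problem d} {g : (Fin (d - 1) → ℝ) → ℝ} {c κ α lam δ : ℝ} {n : ℕ}

/-- With accurate labels, both classifiers agree with the Bayes classifier outside the band. -/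
theorem classifier_eq_bayes_of_allGood {lab : Request d → Bool} (hd : 2 ≤ d) (hκ : 1 < κ)
    (hc : 0 < c) (hα : 1 / (logFloor n : ℝ) ≤ α) (hα' : α ≤ logFloor n) (hlam : 1 ≤ lam)
    (hδ : 0 < δ) (hδ1 : δ ≤ 1) (hn : LargeSample d c κ α lam δ n)
    (hg : SmoothBoundary P lam α g) (hnoise : GeometricNoise P c κ g)
    (hgood : AllGood P lab n δ lam α) {x : Point d} (hx : x ∈ cube d)
    (hfar : bandWidth d c κ α lam (Real.log ((n : ℝ) / δ) ^ 3 / n) < |x.2 - g x.1|) :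
    classifier lab n δ lam x = P.bayes x ∧ setClassifier lab n δ lam x = P.bayes x := by
  have hL := one_le_logFloor hn.conf_le
  have hL0 : (0 : ℝ) < logFloor n := by linarith
  have hα0 : 0 < α := lt_of_lt_of_le (by positivity) hα
  have hlam0 : 0 < lam := by linarith
  have hn0 := (logFloor_bounds hL).2.2
  have hfl : (⌊α * logFloor n⌋₊ : ℝ) ≤ α * logFloor n := Nat.floor_le (by positivity)
  have hfl2 : α * logFloor n < ⌊α * logFloor n⌋₊ + 1 := Nat.lt_floor_add_one _
  -- ⌊αL⌋ with L = ⌊log n⌋ is the last call with parameter at most α. The assumption 1/L ≤ α ≤ L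
  -- places it among the calls 1, …, L².
  have hi1 : 1 ≤ ⌊α * logFloor n⌋₊ := by
    rw [Nat.one_le_floor_iff]
    rwa [div_le_iff₀ hL0] at hα
  have hi2 : ⌊α * logFloor n⌋₊ ≤ logFloor n ^ 2 := by
    have : (⌊α * logFloor n⌋₊ : ℝ) ≤ (logFloor n : ℝ) ^ 2 := by nlinarith
    exact_mod_cast this
  set i₀ := ⌊α * logFloor n⌋₊
  have hle : ∀ i : ℕ, i ≤ i₀ → (i : ℝ) / logFloor n ≤ α := fun i hi => by
    rw [div_le_iff₀ hL0]
    exact le_trans (by exact_mod_cast hi) hfl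
  have hpos : ∀ i : ℕ, 1 ≤ i → 0 < (i : ℝ) / logFloor n := fun i hi =>
    div_pos (by exact_mod_cast hi) hL0
  have hcall := fun i (h1 : 1 ≤ i) (hi : i ≤ i₀) => hgood i h1 (hi.trans hi2) (hle i hi)
  have hgap : α - (i₀ : ℝ) / logFloor n ≤ 1 / (logFloor n : ℝ) := by
    rw [sub_le_iff_le_add, ← add_div, le_div_iff₀ hL0]
    linarith
  have hℓ := (log_div_ge hδ hδ1 hn0).1
  have hlogn := (logFloor_bounds hL).1
  obtain ⟨hl, hb⟩ := biasTerm_lastDepth_le hd hκ hc (hpos i₀ hi1) (hle i₀ le_rfl) hgap hlam hδ hδ1 hn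
    (hg.1.mono (hle i₀ le_rfl)) hg.2 hnoise (hcall i₀ hi1 le_rfl)
  have hℓ0 : 0 < Real.log ((n : ℝ) / δ) := by linarith
  refine classifier_eq_bayes hg.1.mapsTo hg.2 (bandWidth_pos hα0 hκ hlam0 (by positivity)) hi1 hi2
    (fun i h1 hi => ?_) ?_ hx hfar
  · exact correctLabels_subroutine (by omega) hlam0 (hpos i h1) (hg.1.mono (hle i hi)) hg.2
      (hcall i h1 hi)
  · exact coversBeyond_subroutine (by omega) hlam0 (hpos i₀ hi1) (hg.1.mono (hle i₀ le_rfl)) hg.2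
      (hcall i₀ hi1 le_rfl) hl hb

end

end

end ActiveBoundary

end

/-! ### Assembly of the risk bound -/

theorem corollary1 (d : ℕ) (hd : 2 ≤ d) (c : ℝ) (hc : 0 < c) (α : ℝ) (hα : 0 < α)
    (κ : ℝ) (hκ : 1 < κ) (Δ₀ : ℝ) (hΔ₀ : 0 < Δ₀) :
    -- the sample size threshold depends on `λ` and `δ` (and on `d`, `c`, `α`, `κ`, `Δ₀`) only
    ∃ N : ℝ → ℝ → ℕ,
      ∀ κ' CM : ℝ, 0 < κ' → 0 < CM →
        -- the constant `C` does not depend on `λ`, `n`, `δ`, nor on the problem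
        ∃ C : ℝ, 0 < C ∧
          ∀ lam δ : ℝ, 1 ≤ lam → 0 < δ →
          ∀ n : ℕ, N lam δ ≤ n →
            1 / (ActiveBoundary.logFloor n : ℝ) ≤ α → α ≤ (ActiveBoundary.logFloor n : ℝ) →
          ∀ (P : ActiveBoundary.Problem d) (g : (Fin (d - 1) → ℝ) → ℝ),
            ActiveBoundary.SmoothBoundary P lam α g →
            ActiveBoundary.GeometricNoise P c κ g →
            ActiveBoundary.BoundaryMass P CM Δ₀ κ' g →
          ∀ (Ω : Type*) [MeasurableSpace Ω] (μ : MeasureTheory.Measure Ω)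
            [MeasureTheory.IsProbabilityMeasure μ] (Y : ActiveBoundary.Request d → Ω → Bool),
            ActiveBoundary.IsLabelOracle P μ Y →
            let bound : ℝ :=
              C * lam ^ (κ' * ((d : ℝ) - 1) / (2 * α * (κ - 1) + (d : ℝ) - 1)) *
                (Real.log ((n : ℝ) / δ) ^ 3 / (n : ℝ)) ^
                  (α * κ' / (2 * α * (κ - 1) + (d : ℝ) - 1))
            ENNReal.ofReal (1 - 2 * δ) ≤
              μ {ω | P.excessRisk
                        (ActiveBoundary.classifier (fun r => Y r ω) n δ lam) ≤ bound ∧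
                     P.excessRisk
                        (ActiveBoundary.setClassifier (fun r => Y r ω) n δ lam) ≤ bound} := by
  have hN : ∀ lam δ : ℝ, ∃ N : ℕ, 0 < δ → ∀ n : ℕ, N ≤ n →
      ActiveBoundary.LargeSample d c κ α lam δ n ∧
        ActiveBoundary.bandWidth d c κ α lam (Real.log ((n : ℝ) / δ) ^ 3 / n) ≤ Δ₀ := by
    intro lam δ
    by_cases hδ : 0 < δ
    · obtain ⟨N, h⟩ := Filter.eventually_atTop.mp
        (ActiveBoundary.eventually_largeSample (c := c) hd hα hκ hΔ₀ lam hδ)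
      exact ⟨N, fun _ => h⟩
    · exact ⟨0, fun h => absurd h hδ⟩
  choose N hN using hN
  have hband := ActiveBoundary.bandConst_pos (d := d) (c := c) hα hκ
  -- C is C_M times the κ'-th power of the constant in the band width, since the bound is C_M ·
  -- (band width)^κ'.
  refine ⟨N, fun κ' CM hκ' hCM => ⟨CM * ActiveBoundary.bandConst d c κ α ^ κ', by positivity, ?_⟩⟩
  intro lam δ hlam hδ n hn hαL hαL' P g hg hnoise hmass Ω _ μ _ Y hY bound
  -- For δ ≥ 1/2 the asserted probability is at most 0; otherwise δ ≤ 1, as the concentration bounds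
  -- require.
  rcases le_or_gt (1 / 2) δ with hδ2 | hδ2
  · rw [ENNReal.ofReal_of_nonpos (by linarith)]
    exact zero_le
  have hδ1 : δ ≤ 1 := by linarith
  obtain ⟨hlarge, hΔ⟩ := hN lam δ hδ n hn
  have hL := ActiveBoundary.one_le_logFloor hlarge.conf_le
  obtain ⟨hL1, -, hn0⟩ := ActiveBoundary.logFloor_bounds hL
  have hℓ : 0 < Real.log ((n : ℝ) / δ) := by
    have := (ActiveBoundary.log_div_ge hδ hδ1 hn0).1
    linarith
  have hlam0 : 0 < lam := by linarith
  set x := Real.log ((n : ℝ) / δ) ^ 3 / (n : ℝ) with hx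
  have hx0 : 0 < x := by positivity
  have hw := ActiveBoundary.bandWidth_pos (d := d) (c := c) hα hκ hlam0 hx0
  have hbound : CM * ActiveBoundary.bandWidth d c κ α lam x ^ κ' = bound := by
    simp only [bound, ActiveBoundary.bandWidth]
    rw [Real.mul_rpow (by positivity) (by positivity), Real.mul_rpow (by positivity) (by positivity),
      ← Real.rpow_mul hlam0.le, ← Real.rpow_mul hx0.le, div_mul_eq_mul_div, div_mul_eq_mul_div,
      mul_comm ((d : ℝ) - 1) κ']
    ring
  clear_value bound
  have hsub : {ω | ActiveBoundary.AllGood P (fun r => Y r ω) n δ lam α} ⊆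
      {ω | P.excessRisk (ActiveBoundary.classifier (fun r => Y r ω) n δ lam) ≤ bound ∧
        P.excessRisk (ActiveBoundary.setClassifier (fun r => Y r ω) n δ lam) ≤ bound} := by
    intro ω hω
    rw [Set.mem_ofPred_eq] at hω ⊢
    have heq : ∀ y ∈ ActiveBoundary.cube d,
        ActiveBoundary.bandWidth d c κ α lam x < |y.2 - g y.1| →
        ActiveBoundary.classifier (fun r => Y r ω) n δ lam y = P.bayes y ∧
          ActiveBoundary.setClassifier (fun r => Y r ω) n δ lam y = P.bayes y := fun y hy hfar =>
      ActiveBoundary.classifier_eq_bayes_of_allGood (lab := fun r => Y r ω) hd hκ hc hαL hαL' hlam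
        hδ hδ1 hlarge hg hnoise hω hy hfar
    have hm := (hmass _ ⟨hw.le, hΔ⟩).trans_eq hbound
    have hexc : ∀ f : ActiveBoundary.Point d → Bool, Measurable f →
        (∀ y ∈ ActiveBoundary.cube d, ActiveBoundary.bandWidth d c κ α lam x < |y.2 - g y.1| →
          f y = P.bayes y) → P.excessRisk f ≤ bound := fun f hf h =>
      (P.excessRisk_le hf (S := {y ∈ ActiveBoundary.cube d |
        |y.2 - g y.1| ≤ ActiveBoundary.bandWidth d c κ α lam x}) fun y hy hne =>
          ⟨hy, not_lt.mp fun hfar => hne (h y hy hfar)⟩).trans hm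
    exact ⟨hexc _ (ActiveBoundary.measurable_classifier _ n δ lam)
        fun y hy hfar => (heq y hy hfar).1,
      hexc _ (ActiveBoundary.measurable_setClassifier _ n δ lam)
        fun y hy hfar => (heq y hy hfar).2⟩
  refine le_trans ?_ (MeasureTheory.measure_mono hsub)
  have hbad := ActiveBoundary.measure_not_allGood_le (lam := lam) hY hδ hδ1 hlarge.conf_le
  -- Subadditivity replaces the complement rule, so measurability of the good event is not needed.
  have huniv : (1 : ENNReal) ≤ μ {ω | ActiveBoundary.AllGood P (fun r => Y r ω) n δ lam α} +
      μ {ω | ¬ ActiveBoundary.AllGood P (fun r => Y r ω) n δ lam α} := by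
    rw [← MeasureTheory.measure_univ (μ := μ)]
    refine le_trans (MeasureTheory.measure_mono fun ω _ => ?_) (MeasureTheory.measure_union_le _ _)
    exact em _
  calc ENNReal.ofReal (1 - 2 * δ) ≤ ENNReal.ofReal (1 - δ) :=
        ENNReal.ofReal_le_ofReal (by linarith)
    _ = 1 - ENNReal.ofReal δ := by rw [ENNReal.ofReal_sub _ hδ.le, ENNReal.ofReal_one]
    _ ≤ _ := tsub_le_iff_right.mpr (huniv.trans (add_le_add_right hbad _))
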